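/- **Theorem (Gate).** Let $\mathbb{T}^2$ be the triangular lattice and let $\Lambda$ be the set of the $2L^2$ triangular faces of a parallelogram of side length $L$ cut along two coordinate axes of $\mathbb{T}^2$, with periodic boundary conditions; two faces are nearest neighbors if they share an edge (so $\Lambda$ is a hexagonal lattice on a torus). On $\mathcal X=\{-1,+1\}^\Lambda$ let $$H(\sigma)=-\frac J2\sum_{\{i,j\}}\sigma(i)\sigma(j)-\frac h2\sum_{i\in\Lambda}\sigma(i),$$ the first sum being over unordered pairs of nearest neighbors. Assume $0<h<1$, $J\ge 2h$, $|\Lambda|=2L^2\ge(4J/h)^2$. Let $r^*=\lfloor\frac J{2h}-\frac12\rfloor$ and $\delta=\frac J{2h}-\frac12-r^*$, assume $\delta\notin\{0,\frac12\}$, and put $$A^*=\begin{cases}6{r^*}^2+10r^*+5&\text{if }0<\delta<\frac12,\\ 6(r^*+1)^2+2(r^*+1)+1&\text{if }\frac12<\delta<1.\end{cases}$$ A path is a finite sequence of configurations in which consecutive ones differ by a single spin flip; $\Phi(\sigma,\eta)$ is the minimum over the paths from $\sigma$ to $\eta$ of the maximum of $H$ along the path, and a path is optimal if it attains this minimum.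 The set $\mathscr S(\sigma,\eta)$ of minimal saddles consists of the $\zeta$ lying on some path from $\sigma$ to $\eta$ whose maximal energy is $H(\zeta)=\Phi(\sigma,\eta)$. A gate is a set $\mathcal W\subseteq\mathscr S(\sigma,\eta)$ met by every optimal path from $\sigma$ to $\eta$; it is minimal if each proper subset of $\mathcal W$ is avoided by some optimal path. The quasi-regular hexagon $E_{B_i}(r)$ ($r\ge1$, $0\le i\le5$) is obtained from the regular hexagon $E(r)$ of radius $r$ by attaching bars (rows of faces, of $2l-1$ faces on a side of length $l$) to $i$ consecutive sides, one after the other, inside the concentric regular hexagon $E(r+1)$; all its translates and rotations by multiples of $\pi/3$ are allowed. For $A\in\mathbb N$ let $\tilde{\mathcal S}(A)$ be the set of configurations whose pluses form a single cluster, of area (number of faces) $A$, that consists of a quasi-regular hexagon and an elementary rhombus (two faces sharing an edge) contained in the bar on one of its longest sides. Let $\tilde{\mathcal D}(A)$ be the set of configurations whose pluses form a single cluster, of area $A$, that consists of a quasi-regular hexagon and two faces attached to one and the same longest side of it, at lattice distance $2$ from one another. Then every optimal path from $\underline{-1}$ (all spins $-1$) to $\underline{+1}$ (all spins $+1$) visits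 $\tilde{\mathcal S}(A^*)\cup\tilde{\mathcal D}(A^*)$, and $\tilde{\mathcal S}(A^*)\cup\tilde{\mathcal D}(A^*)$ is the union of all minimal gates for the transition from $\underline{-1}$ to $\underline{+1}$. -/

import Mathlib

noncomputable section

namespace HexIsing

/-! ### The hexagonal lattice as the dual of the triangular lattice -/

/-- Faces of the triangular lattice with coordinates in `R`, which are the sites of the hexagonal
lattice.  In the lattice basis `e₁, e₂` (unit vectors at angle `π / 3`), the face `((x, y), true)`
is the triangle with vertices `(x, y), (x + 1, y), (x, y + 1)` and the face `((x, y), false)` is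
the triangle with vertices `(x + 1, y), (x, y + 1), (x + 1, y + 1)`.
With `R = ℤ` this is the infinite planar lattice; with `R = ZMod L` it is the parallelogram of side
length `L` cut along two coordinate axes of the triangular lattice, with periodic boundary. -/
abbrev Site (R : Type) : Type := (R × R) × Bool

/-- The hexagonal lattice: two faces of the triangular lattice are nearest neighbors iff they
share an edge.  The triangle `((x, y), true)` has the neighbors `((x, y), false)`,
`((x - 1, y), false)` and `((x, y - 1), false)`. -/
def hexLattice (R : Type) [CommRing R] : SimpleGraph (Site R) :=
  SimpleGraph.fromRel fun s t =>
    s.2 = true ∧ t.2 = false ∧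
      (t.1 = s.1 ∨ t.1 = (s.1.1 - 1, s.1.2) ∨ t.1 = (s.1.1, s.1.2 - 1))

/-! ### The Ising model -/

/-- Spin configurations on the torus: every site carries a spin in `{-1, +1}`. -/
abbrev Config (L : ℕ) : Type := Site (ZMod L) → ℤˣ

/-- All spins are `-1`. -/
def allMinus (L : ℕ) : Config L := fun _ => -1

/-- All spins are `+1`. -/
def allPlus (L : ℕ) : Config L := fun _ => 1

/-- The set of sites with spin `+1`. -/
def plusSet {L : ℕ} (σ : Config L) : Set (Site (ZMod L)) := {s | σ s = 1}

open Classical in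
/-- The Hamiltonian `H(σ) = -(J/2) ∑_{{i,j}} σ(i) σ(j) - (h/2) ∑_i σ(i)`; the first sum is over
the unordered pairs of nearest neighbors. -/
def hamiltonian {L : ℕ} [NeZero L] (J h : ℝ) (σ : Config L) : ℝ :=
  -(J / 2) * ∑ e ∈ (hexLattice (ZMod L)).edgeFinset, (e.map fun s => ((σ s : ℤ) : ℝ)).mul
    - (h / 2) * ∑ s : Site (ZMod L), ((σ s : ℤ) : ℝ)

/-- The configuration `σ^(x)`: the spin at `x` is flipped. -/
def flip {L : ℕ} (σ : Config L) (x : Site (ZMod L)) : Config L := Function.update σ x (-σ x)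

theorem flip_flip {L : ℕ} (σ : Config L) (x : Site (ZMod L)) : flip (flip σ x) x = σ := by
  simp [flip]

theorem flip_ne {L : ℕ} (σ : Config L) (x : Site (ZMod L)) : flip σ x ≠ σ := by
  intro hh
  have h1 := congrFun hh x
  simp only [flip, Function.update_self] at h1
  rcases Int.units_eq_one_or (σ x) with h2 | h2 <;> rw [h2] at h1 <;> exact absurd h1 (by decide)

/-- The graph of single spin flips.  The walks in this graph are the paths of configurations. -/
def flipGraph (L : ℕ) : SimpleGraph (Config L) where
  Adj σ η := ∃ x, η = flip σ x
  symm := ⟨fun σ _ ⟨x, hx⟩ => ⟨x, by rw [hx, flip_flip]⟩⟩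
  loopless := ⟨fun σ ⟨x, hx⟩ => flip_ne σ x hx.symm⟩

/-- A path of configurations from `σ` to `η`, where consecutive ones differ by one spin flip. -/
abbrev Path {L : ℕ} (σ η : Config L) : Type := (flipGraph L).Walk σ η

/-- The maximum of the energy along a path. -/
def height {L : ℕ} [NeZero L] (J h : ℝ) {σ η : Config L} (ω : Path σ η) : ℝ :=
  ω.support.toFinset.sup' ⟨σ, by simp⟩ (hamiltonian J h)

/-- The communication height `Φ(σ, η)`: the minimum, over all paths from `σ` to `η`, of the maximum
of the energy along the path. -/
def commHeight {L : ℕ} [NeZero L] (J h : ℝ) (σ η : Config L) : ℝ :=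
  ⨅ ω : Path σ η, height J h ω

theorem flipGraph_preconnected (L : ℕ) [NeZero L] : (flipGraph L).Preconnected := by
  intro σ η
  suffices H : ∀ (s : Finset (Site (ZMod L))) (σ : Config L), (∀ x, x ∉ s → σ x = η x) →
      (flipGraph L).Reachable σ η from H Finset.univ σ (by simp)
  intro s
  induction s using Finset.induction_on with
  | empty =>
    intro σ hs
    have : σ = η := funext fun x => hs x (by simp)
    rw [this]
  | insert a s ha ih =>
    intro σ hs
    by_cases haη : σ a = η a
    · refine ih σ fun x hx => ?_
      by_cases hxa : x = a
      · rw [hxa, haη]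
      · exact hs x (by simp [hxa, hx])
    · have h1 : (flipGraph L).Adj σ (flip σ a) := ⟨a, rfl⟩
      refine h1.reachable.trans (ih _ fun x hx => ?_)
      by_cases hxa : x = a
      · subst hxa
        simp only [flip, Function.update_self]
        rcases Int.units_eq_one_or (σ x) with h2 | h2 <;>
          rcases Int.units_eq_one_or (η x) with h3 | h3 <;> simp_all
      · simp only [flip, Function.update_of_ne hxa]
        exact hs x (by simp [hxa, hx])

/-- The infimum in the definition of the communication height is a minimum. -/
theorem commHeight_isLeast {L : ℕ} [NeZero L] (J h : ℝ) (σ η : Config L) :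
    IsLeast (Set.range fun ω : Path σ η => height J h ω) (commHeight J h σ η) := by
  have hfin : (Set.range fun ω : Path σ η => height J h ω).Finite := by
    refine (Set.finite_range (hamiltonian J h : Config L → ℝ)).subset ?_
    rintro _ ⟨ω, rfl⟩
    obtain ⟨ζ, -, hζ⟩ := Finset.exists_mem_eq_sup' (s := ω.support.toFinset)
      ⟨σ, by simp⟩ (hamiltonian J h)
    exact ⟨ζ, hζ.symm⟩
  have hne : (Set.range fun ω : Path σ η => height J h ω).Nonempty := by
    obtain ⟨ω⟩ := flipGraph_preconnected L σ η
    exact ⟨_, ω, rfl⟩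
  exact ⟨hne.csInf_mem hfin, fun _ hx => csInf_le hfin.bddBelow hx⟩

/-- Optimal paths: those that realize the min-max `Φ(σ, η)`. -/
def IsOptimal {L : ℕ} [NeZero L] (J h : ℝ) {σ η : Config L} (ω : Path σ η) : Prop :=
  height J h ω = commHeight J h σ η

/-- The set of minimal saddles between `σ` and `η`. -/
def saddles {L : ℕ} [NeZero L] (J h : ℝ) (σ η : Config L) : Set (Config L) :=
  {ζ | ∃ ω : Path σ η, ζ ∈ ω.support ∧ height J h ω = hamiltonian J h ζ ∧
    hamiltonian J h ζ = commHeight J h σ η}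

/-- A gate for the transition from `σ` to `η`: a set of minimal saddles that is visited by every
optimal path. -/
def IsGate {L : ℕ} [NeZero L] (J h : ℝ) (σ η : Config L) (W : Set (Config L)) : Prop :=
  W ⊆ saddles J h σ η ∧ ∀ ω : Path σ η, IsOptimal J h ω → ∃ ζ ∈ ω.support, ζ ∈ W

/-- A minimal gate: a gate such that every proper subset is avoided by some optimal path. -/
def IsMinimalGate {L : ℕ} [NeZero L] (J h : ℝ) (σ η : Config L) (W : Set (Config L)) : Prop :=
  IsGate J h σ η W ∧
    ∀ W' : Set (Config L), W' ⊂ W →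
      ∃ ω : Path σ η, IsOptimal J h ω ∧ ∀ ζ ∈ ω.support, ζ ∉ W'

/-- The union of all minimal gates for the transition from `σ` to `η`. -/
def minimalGatesUnion {L : ℕ} [NeZero L] (J h : ℝ) (σ η : Config L) : Set (Config L) :=
  ⋃₀ {W | IsMinimalGate J h σ η W}

/-! ### Shapes in the plane -/

/-- The three vertices of a face of the planar triangular lattice. -/
def vertices (f : Site ℤ) : Finset (ℤ × ℤ) :=
  if f.2 then {f.1, (f.1.1 + 1, f.1.2), (f.1.1, f.1.2 + 1)}
  else {(f.1.1 + 1, f.1.2), (f.1.1, f.1.2 + 1), (f.1.1 + 1, f.1.2 + 1)}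

/-- The six linear forms, in counter-clockwise order, whose level lines are the lines of the
triangular lattice.  They are the outer normals of the six sides of a lattice hexagon; in the
lattice basis the hexagonal norm of `v` is `max_k sideForm k v`. -/
def sideForm (k : Fin 6) (v : ℤ × ℤ) : ℤ :=
  ![v.1, v.1 + v.2, v.2, -v.1, -(v.1 + v.2), -v.2] k

/-- The hexagon cut out by the six inequalities `sideForm k v ≤ b k`, as a set of faces. -/
def hexagon (b : Fin 6 → ℤ) : Set (Site ℤ) :=
  {f | ∀ v ∈ vertices f, ∀ k, sideForm k v ≤ b k}

/-- The length of the side number `k` of `hexagon b`. -/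
def sideLength (b : Fin 6 → ℤ) (k : Fin 6) : ℤ := b (k - 1) + b (k + 1) - b k

/-- The side number `k` of `hexagon b` is one of its longest sides. -/
def IsLongestSide (b : Fin 6 → ℤ) (k : Fin 6) : Prop := ∀ k', sideLength b k' ≤ sideLength b k

/-- The bar on the side number `k` of `hexagon b`: the row of faces outside of the hexagon that is
obtained by pushing this side outwards by one row.  It has `2 l - 1` faces when the side has
length `l`, and its larger base (of length `l`) is that side. -/
def sideBar (b : Fin 6 → ℤ) (k : Fin 6) : Set (Site ℤ) :=
  hexagon (Function.update b k (b k + 1)) \ hexagon b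

/-- The quasi-regular hexagon `E_{B_i}(r)`: the regular hexagon `E(r)` of radius `r` centered at
the vertex `c`, to which `i` bars have been attached, one on each of the `i` consecutive sides
`d, d + 1, …, d + i - 1`, inside the concentric regular hexagon `E(r + 1)`. -/
def quasiHexBounds (c : ℤ × ℤ) (r i : ℕ) (d : Fin 6) : Fin 6 → ℤ :=
  fun k => sideForm k c + r + if (k - d).val < i then 1 else 0

/-- `b` is the family of bounds of a quasi-regular hexagon: some `E_{B_i}(r)` with `r ≥ 1` and
`0 ≤ i ≤ 5`, in any of its positions and orientations. -/
def IsQuasiRegular (b : Fin 6 → ℤ) : Prop :=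
  ∃ (c : ℤ × ℤ) (r i : ℕ) (d : Fin 6), 1 ≤ r ∧ i ≤ 5 ∧ b = quasiHexBounds c r i d

/-- `f` shares an edge with some face of `P`. -/
def IsAttachedTo (f : Site ℤ) (P : Set (Site ℤ)) : Prop := ∃ e ∈ P, (hexLattice ℤ).Adj f e

/-- `P` is a quasi-regular hexagon with an elementary rhombus (two faces sharing an edge)
attached to one of its longest sides, inside the bar on that side. -/
def IsCanonicalShape (P : Set (Site ℤ)) : Prop :=
  ∃ (b : Fin 6 → ℤ) (k : Fin 6) (f g : Site ℤ), IsQuasiRegular b ∧ IsLongestSide b k ∧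
    f ∈ sideBar b k ∧ g ∈ sideBar b k ∧ (hexLattice ℤ).Adj f g ∧ P = hexagon b ∪ {f, g}

/-- `P` is a quasi-regular hexagon with two faces attached to one of its longest sides at lattice
distance `2` from one another. -/
def IsDefectiveShape (P : Set (Site ℤ)) : Prop :=
  ∃ (b : Fin 6 → ℤ) (k : Fin 6) (f g : Site ℤ), IsQuasiRegular b ∧ IsLongestSide b k ∧
    f ∈ sideBar b k ∧ g ∈ sideBar b k ∧
    IsAttachedTo f (hexagon b) ∧ IsAttachedTo g (hexagon b) ∧
    (hexLattice ℤ).dist f g = 2 ∧ P = hexagon b ∪ {f, g}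

/-! ### Critical configurations -/

/-- The projection of the planar lattice onto the torus. -/
def toTorus (L : ℕ) (f : Site ℤ) : Site (ZMod L) := (((f.1.1 : ZMod L), (f.1.2 : ZMod L)), f.2)

/-- The pluses of `σ` are exactly a copy on the torus of the planar shape `P`. -/
def HasCluster {L : ℕ} (σ : Config L) (P : Set (Site ℤ)) : Prop :=
  Set.InjOn (toTorus L) P ∧ plusSet σ = toTorus L '' P

/-- `S̃(A)`: the configurations with a single cluster, of area `A`, whose shape is a quasi-regular
hexagon with an elementary rhombus on a longest side. -/
def canonicalConfigs (L A : ℕ) : Set (Config L) :=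
  {σ | ∃ P : Set (Site ℤ), IsCanonicalShape P ∧ P.ncard = A ∧ HasCluster σ P}

/-- `D̃(A)`: the configurations with a single cluster, of area `A`, whose shape is a quasi-regular
hexagon with two faces at lattice distance `2` on a longest side. -/
def defectiveConfigs (L A : ℕ) : Set (Config L) :=
  {σ | ∃ P : Set (Site ℤ), IsDefectiveShape P ∧ P.ncard = A ∧ HasCluster σ P}

/-- The critical radius `r* = ⌊J / (2h) - 1 / 2⌋`. -/
def criticalRadius (J h : ℝ) : ℕ := ⌊J / (2 * h) - 1 / 2⌋₊

/-- The fractional part `δ` of `J / (2h) - 1 / 2`. -/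
def delta (J h : ℝ) : ℝ := Int.fract (J / (2 * h) - 1 / 2)

open Classical in
/-- The critical area: `A*₁ = 6 r*² + 10 r* + 5` if `δ < 1/2`, and
`A*₂ = 6 (r* + 1)² + 2 (r* + 1) + 1` if `δ > 1/2`. -/
def criticalArea (J h : ℝ) : ℕ :=
  if delta J h < 1 / 2 then 6 * criticalRadius J h ^ 2 + 10 * criticalRadius J h + 5
  else 6 * (criticalRadius J h + 1) ^ 2 + 2 * (criticalRadius J h + 1) + 1

end HexIsing

end

/-! Up to the constant `hamiltonian J h (allMinus L)`, the energy of a configuration with plus set S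
is E(S) = J per(S) - h |S| (`hamiltonian_eq`). Let p and N be the perimeter and the area of the
critical quasi-regular hexagon: 6 N + 7 = p², with p = 6 r* + 5 if δ < 1/2 and p = 6 r* + 7 if δ >
1/2. The critical area is N + 2. Put Γ = J (p + 2) - h (N + 2), and let W be the union of the
canonical and the defective configurations. Two facts suffice: every path whose energies are at most
Γ meets W, and every element of W is the only configuration of energy at least Γ on some path. Then
the barrier is Γ, W is a gate, and every gate contains W, so W is the only minimal gate
(`minimalGatesUnion_eq`).

Isoperimetry. Every strip that meets a finite planar set has a boundary edge at both ends, and every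
edge is crossed along two of the three strip directions. Hence the perimeter is at least the number
of strips met, which without gaps is at least the perimeter ∑ b of the smallest hexagon around the
set. The area of a hexagon is (∑ b)² / 6 minus an explicit quadratic form (`six_mul_card_hexFin`).
It follows that N is the largest area at perimeter p, attained only by quasi-regular hexagons, since
for odd p the form is at least 7 by parity. Sets with a gap are much worse
(`six_mul_card_le_of_split`). On the torus, a set of small area and perimeter misses a strip in each
of two directions; cutting there lifts it to the plane.

Crossing the gate. Let M be the largest area at perimeter p + 1. Below Γ a set of area at most M has
perimeter at most p + 2. Perimeter and area have the same parity, so observing the path at even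
areas only improves this to p + 1. A set of even area above N then fills a hexagon of perimeter p +
1. Such a set cannot move towards a target hexagon of area M unless it is the critical hexagon with
one additional face. The invariant `Subcritical` records this, and `Critical.mem_gate_of_flips`
shows that it is lost only when a critical hexagon Q receives three faces of a bar of the target.
The third must share two edges, so the first two form a rhombus or are at distance two, and the bar
lies on a longest side because M is maximal.

Reference paths. Quasi-regular hexagons grow bar by bar. The first two faces of a bar cost J - h
each, and the rest is filled without exceeding this level. The hexagon of perimeter p is the strict
maximum of the energies along this chain (`Barrier.peak`), and any element of W can be inserted as
the top of its bar. From perimeter 6 R on, with J ≤ (2 R - 1) h, bars no longer raise the energy,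
and translates of the hexagon cover the torus (`low_univ`). -/

namespace HexIsing

/-! ### Neighbors and perimeter of finite sets of faces -/

section Perimeter

variable {R : Type} [CommRing R] [DecidableEq R]

/-- The neighbor of the face `f` across its edge of direction `i`. -/
def nb (f : Site R) (i : Fin 3) : Site R :=
  (![f.1, if f.2 then (f.1.1 - 1, f.1.2) else (f.1.1 + 1, f.1.2),
    if f.2 then (f.1.1, f.1.2 - 1) else (f.1.1, f.1.2 + 1)] i, !f.2)

omit [DecidableEq R] in
@[simp] theorem nb_nb (f : Site R) (i : Fin 3) : nb (nb f i) i = f := by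
  obtain ⟨⟨x, y⟩, t⟩ := f
  fin_cases i <;> cases t <;> simp [nb]

omit [DecidableEq R] in
theorem nb_snd (f : Site R) (i : Fin 3) : (nb f i).2 = !f.2 := rfl

omit [DecidableEq R] in
theorem nb_ne (f : Site R) (i : Fin 3) : nb f i ≠ f := by
  intro h
  have := congrArg Prod.snd h
  simp [nb] at this

omit [DecidableEq R] in
theorem hexLattice_adj_iff (f g : Site R) : (hexLattice R).Adj f g ↔ ∃ i, g = nb f i := by
  obtain ⟨⟨x, y⟩, t⟩ := f
  obtain ⟨⟨x', y'⟩, t'⟩ := g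
  simp only [hexLattice, SimpleGraph.fromRel_adj, Fin.exists_fin_succ, nb, ne_eq]
  cases t <;> cases t' <;> simp [Prod.ext_iff, eq_sub_iff_add_eq, eq_comm]

/-- The perimeter of a finite set of faces: the number of its boundary edges. -/
def per (S : Finset (Site R)) : ℕ := ∑ f ∈ S, (Finset.univ.filter fun i => nb f i ∉ S).card

/-- The number of edges of `f` shared with the faces of `S`. -/
def deg (S : Finset (Site R)) (f : Site R) : ℕ := (Finset.univ.filter fun i => nb f i ∈ S).card

theorem deg_mono {S T : Finset (Site R)} (h : S ⊆ T) (f : Site R) : deg S f ≤ deg T f :=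
  Finset.card_le_card fun i hi => by
    simp only [Finset.mem_filter, Finset.mem_univ, true_and] at hi ⊢
    exact h hi

theorem deg_eq_sum (S : Finset (Site R)) (f : Site R) :
    deg S f = ∑ i : Fin 3, if nb f i ∈ S then 1 else 0 := by
  rw [deg, Finset.card_filter]

theorem per_eq_sum (S : Finset (Site R)) :
    per S = ∑ i : Fin 3, ∑ f ∈ S, if nb f i ∉ S then 1 else 0 := by
  rw [per, Finset.sum_comm]
  exact Finset.sum_congr rfl fun f _ => Finset.card_filter _ _

theorem one_le_deg {S : Finset (Site R)} {f : Site R} (i : Fin 3) (h : nb f i ∈ S) :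
    1 ≤ deg S f :=
  Finset.card_pos.2 ⟨i, by simp [h]⟩

theorem two_le_deg {S : Finset (Site R)} {f : Site R} {i j : Fin 3} (hij : i ≠ j)
    (hi : nb f i ∈ S) (hj : nb f j ∈ S) : 2 ≤ deg S f := by
  rw [deg, ← Finset.card_pair hij]
  exact Finset.card_le_card fun k hk => by
    simp only [Finset.mem_insert, Finset.mem_singleton] at hk
    rcases hk with rfl | rfl <;> simp [hi, hj]

theorem exists_of_one_le_deg {S : Finset (Site R)} {f : Site R} (h : 1 ≤ deg S f) :
    ∃ i, nb f i ∈ S := by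
  obtain ⟨i, hi⟩ := Finset.card_pos.1 h
  exact ⟨i, by simpa using hi⟩

theorem exists_of_two_le_deg {S : Finset (Site R)} {f : Site R} (h : 2 ≤ deg S f) :
    ∃ i j, i ≠ j ∧ nb f i ∈ S ∧ nb f j ∈ S := by
  obtain ⟨i, hi, j, hj, hij⟩ := Finset.one_lt_card.1 h
  exact ⟨i, j, hij, by simpa using hi, by simpa using hj⟩

theorem per_insert {S : Finset (Site R)} {f : Site R} (hf : f ∉ S) :
    (per (insert f S) : ℤ) = per S + 3 - 2 * deg S f := by
  have key : ∀ i : Fin 3,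
      ((∑ g ∈ insert f S, if nb g i ∉ insert f S then 1 else 0 : ℕ) : ℤ) =
        (∑ g ∈ S, if nb g i ∉ S then 1 else 0 : ℕ) + 1 - 2 * (if nb f i ∈ S then 1 else 0) := by
    intro i
    rw [Finset.sum_insert hf]
    have h1 : ∀ g ∈ S, ((if nb g i ∉ insert f S then 1 else 0 : ℕ) : ℤ) =
        (if nb g i ∉ S then 1 else 0 : ℕ) - (if g = nb f i then 1 else 0) := by
      intro g _
      by_cases h2 : g = nb f i
      · simp [h2, hf]
      · have : nb g i ≠ f := fun h3 => h2 (by rw [← h3, nb_nb])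
        simp [h2, this]
    push_cast
    have h1' : (∑ g ∈ S, (if nb g i ∉ insert f S then 1 else 0 : ℤ)) =
        ∑ g ∈ S, ((if nb g i ∉ S then 1 else 0 : ℤ) - (if g = nb f i then 1 else 0)) := by
      refine Finset.sum_congr rfl fun g hg => ?_
      have := h1 g hg
      push_cast at this
      exact this
    rw [h1', Finset.sum_sub_distrib, Finset.sum_ite_eq']
    by_cases h3 : nb f i ∈ S
    · simp [h3]
      ring
    · simp [h3, nb_ne]
      ring
  rw [per_eq_sum, per_eq_sum, deg_eq_sum]
  push_cast
  rw [Finset.mul_sum, ← Finset.sum_congr rfl fun i _ => by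
    have := key i
    push_cast at this
    exact this.symm]
  simp only [Finset.sum_sub_distrib, Finset.sum_add_distrib]
  simp

theorem per_insert_le_of_one {S : Finset (Site R)} {f : Site R} (hf : f ∉ S) (h : 1 ≤ deg S f) :
    per (insert f S) ≤ per S + 1 := by
  have := per_insert hf
  omega

theorem per_insert_le_of_two {S : Finset (Site R)} {f : Site R} (hf : f ∉ S) (h : 2 ≤ deg S f) :
    per (insert f S) + 1 ≤ per S := by
  have := per_insert hf
  omega

theorem per_erase {S : Finset (Site R)} {f : Site R} (hf : f ∈ S) :
    (per (S.erase f) : ℤ) = per S - 3 + 2 * deg (S.erase f) f := by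
  have := per_insert (S := S.erase f) (f := f) (by simp)
  rw [Finset.insert_erase hf] at this
  omega

@[simp] theorem per_empty : per (∅ : Finset (Site R)) = 0 := by simp [per]

/-- One more face changes the perimeter by the odd number 3 - 2 `deg`. This parity is what
repeatedly improves a perimeter bound by one unit. -/
theorem per_mod_two (S : Finset (Site R)) : per S % 2 = S.card % 2 := by
  induction S using Finset.induction_on with
  | empty => simp
  | insert f S hf ih =>
    have := per_insert hf
    rw [Finset.card_insert_of_notMem hf]
    omega

theorem per_union {S T : Finset (Site R)} (hd : Disjoint S T)
    (h : ∀ f ∈ S, ∀ i, nb f i ∉ T) : per (S ∪ T) = per S + per T := by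
  have h' : ∀ f ∈ T, ∀ i, nb f i ∉ S := fun f hf i hs => h _ hs i (by simpa using hf)
  rw [per, Finset.sum_union hd, per, per]
  congr 1
  · refine Finset.sum_congr rfl fun f hf => ?_
    congr 1
    ext i
    simp [h f hf i]
  · refine Finset.sum_congr rfl fun f hf => ?_
    congr 1
    ext i
    simp [h' f hf i]

end Perimeter

/-! ### Strips -/

section Strips

variable {R : Type} [CommRing R]

/-- The indices of the strips of the three directions that contain a face. -/
def strip (k : Fin 3) (f : Site R) : R :=
  ![f.1.1, f.1.2, f.1.1 + f.1.2 + if f.2 then 0 else 1] k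

theorem strip_zero (f : Site R) : strip 0 f = f.1.1 := rfl
theorem strip_one (f : Site R) : strip 1 f = f.1.2 := rfl
-- Crossing an edge changes exactly one of the three strip indices, and the three edges change
-- different ones. This is the convexity of hexagons in local form.
theorem strip_nb_of_ne (f : Site R) {i j : Fin 3} (hij : i ≠ j) (k : Fin 3) :
    strip k (nb f i) = strip k f ∨ strip k (nb f j) = strip k f := by
  obtain ⟨⟨x, y⟩, t⟩ := f
  fin_cases i <;> fin_cases j <;> fin_cases k <;> cases t <;>
    first
    | exact absurd rfl hij
    | (left; simp [strip, nb]; done)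
    | (right; simp [strip, nb]; done)
    | (left; simp [strip, nb]; ring; done)
    | (right; simp [strip, nb]; ring)

end Strips

theorem abs_strip_nb_sub_le (f : Site ℤ) (i k : Fin 3) : |strip k (nb f i) - strip k f| ≤ 1 := by
  obtain ⟨⟨x, y⟩, t⟩ := f
  rw [abs_le]
  fin_cases i <;> fin_cases k <;> cases t <;> simp [strip, nb] <;> omega

/-! ### A finite planar set has at least as many boundary edges as it meets strips -/

section StripCount

variable {R : Type} [CommRing R] [DecidableEq R]

theorem card_filter_nb (P : Finset (Site R)) (a b : Fin 3) :
    (P.filter fun f => nb f (if f.2 then a else b) ∉ P).card =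
      (P.filter fun f => f.2 = true ∧ nb f a ∉ P).card +
        (P.filter fun f => f.2 = false ∧ nb f b ∉ P).card := by
  rw [← Finset.card_union_of_disjoint]
  · congr 1
    ext f
    rcases h : f.2 <;> simp [h]
  · rw [Finset.disjoint_left]
    intro f h1 h2
    simp only [Finset.mem_filter] at h1 h2
    exact absurd (h1.2.1.symm.trans h2.2.1) (by simp)

theorem per_eq_classes (P : Finset (Site R)) :
    per P = ∑ i : Fin 3, ((P.filter fun f => f.2 = true ∧ nb f i ∉ P).card +
        (P.filter fun f => f.2 = false ∧ nb f i ∉ P).card) := by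
  rw [per_eq_sum]
  refine Finset.sum_congr rfl fun i _ => ?_
  rw [← card_filter_nb P i i, Finset.card_filter]
  simp

/-- Every edge is crossed when moving along exactly two of the three strip directions. The six
summands count the exits from P, forwards and backwards, along the three directions. -/
theorem two_mul_per (P : Finset (Site R)) :
    2 * per P = ((P.filter fun f => nb f (if f.2 then 0 else 2) ∉ P).card +
        (P.filter fun f => nb f (if f.2 then 2 else 0) ∉ P).card) +
      ((P.filter fun f => nb f (if f.2 then 0 else 1) ∉ P).card +
        (P.filter fun f => nb f (if f.2 then 1 else 0) ∉ P).card) +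
      ((P.filter fun f => nb f (if f.2 then 2 else 1) ∉ P).card +
        (P.filter fun f => nb f (if f.2 then 1 else 2) ∉ P).card) := by
  simp only [card_filter_nb]
  rw [per_eq_classes, Fin.sum_univ_three]
  ring

end StripCount

/-- In each row met by P, the last face of P has its successor outside of P. -/
theorem card_image_le_card_filter (P : Finset (Site ℤ)) (row pos : Site ℤ → ℤ)
    (s : Site ℤ → Site ℤ) (hrow : ∀ f, row (s f) = row f) (hpos : ∀ f, pos f < pos (s f)) :
    (P.image row).card ≤ (P.filter fun f => s f ∉ P).card := by
  refine (Finset.card_le_card ?_).trans (Finset.card_image_le (f := row))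
  intro c hc
  obtain ⟨f, hf, rfl⟩ := Finset.mem_image.1 hc
  obtain ⟨g, hg, hmax⟩ := Finset.exists_max_image (P.filter fun g => row g = row f) pos
    ⟨f, by simp [hf]⟩
  simp only [Finset.mem_filter] at hg hmax
  refine Finset.mem_image.2 ⟨g, Finset.mem_filter.2 ⟨hg.1, fun h => ?_⟩, hg.2⟩
  exact absurd (hmax _ ⟨h, (hrow g).trans hg.2⟩) (not_le.2 (hpos g))

theorem sum_card_image_strip_le_per (P : Finset (Site ℤ)) :
    (P.image (strip 0)).card + (P.image (strip 1)).card + (P.image (strip 2)).card ≤ per P := by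
  -- Along a strip the other two indices change alternately by one, so their sum (in direction 2,
  -- their difference) is a strictly monotone position.
  have h0 := card_image_le_card_filter P (strip 0) (fun f => strip 1 f + strip 2 f)
    (fun f => nb f (if f.2 then 0 else 2))
    (by rintro ⟨⟨x, y⟩, _ | _⟩ <;> simp [strip, nb])
    (by rintro ⟨⟨x, y⟩, _ | _⟩ <;> simp [strip, nb] <;> omega)
  have h0' := card_image_le_card_filter P (strip 0) (fun f => -(strip 1 f + strip 2 f))
    (fun f => nb f (if f.2 then 2 else 0))
    (by rintro ⟨⟨x, y⟩, _ | _⟩ <;> simp [strip, nb])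
    (by rintro ⟨⟨x, y⟩, _ | _⟩ <;> simp [strip, nb] <;> omega)
  have h1 := card_image_le_card_filter P (strip 1) (fun f => strip 0 f + strip 2 f)
    (fun f => nb f (if f.2 then 0 else 1))
    (by rintro ⟨⟨x, y⟩, _ | _⟩ <;> simp [strip, nb])
    (by rintro ⟨⟨x, y⟩, _ | _⟩ <;> simp [strip, nb] <;> omega)
  have h1' := card_image_le_card_filter P (strip 1) (fun f => -(strip 0 f + strip 2 f))
    (fun f => nb f (if f.2 then 1 else 0))
    (by rintro ⟨⟨x, y⟩, _ | _⟩ <;> simp [strip, nb])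
    (by rintro ⟨⟨x, y⟩, _ | _⟩ <;> simp [strip, nb] <;> omega)
  have h2 := card_image_le_card_filter P (strip 2) (fun f => strip 0 f - strip 1 f)
    (fun f => nb f (if f.2 then 2 else 1))
    (by rintro ⟨⟨x, y⟩, _ | _⟩ <;> simp [strip, nb] <;> omega)
    (by rintro ⟨⟨x, y⟩, _ | _⟩ <;> simp [strip, nb])
  have h2' := card_image_le_card_filter P (strip 2) (fun f => -(strip 0 f - strip 1 f))
    (fun f => nb f (if f.2 then 1 else 2))
    (by rintro ⟨⟨x, y⟩, _ | _⟩ <;> simp [strip, nb] <;> omega)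
    (by rintro ⟨⟨x, y⟩, _ | _⟩ <;> simp [strip, nb])
  have := two_mul_per P
  omega

/-! ### Hexagons -/

/-- The maxima over the vertices of a face of the six linear forms. -/
def top (f : Site ℤ) (k : Fin 6) : ℤ :=
  ![strip 0 f + 1, strip 2 f + 1, strip 1 f + 1, -strip 0 f, -strip 2 f, -strip 1 f] k

theorem mem_hexagon {b : Fin 6 → ℤ} {f : Site ℤ} : f ∈ hexagon b ↔ ∀ k, top f k ≤ b k := by
  obtain ⟨⟨x, y⟩, t⟩ := f
  cases t <;>
  · simp [hexagon, vertices, sideForm, top, strip, Fin.forall_fin_succ]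
    constructor
    · intro h
      have h1 := h _ _ (Or.inl ⟨rfl, rfl⟩)
      have h2 := h _ _ (Or.inr (Or.inl ⟨rfl, rfl⟩))
      have h3 := h _ _ (Or.inr (Or.inr ⟨rfl, rfl⟩))
      omega
    · rintro h v w (⟨rfl, rfl⟩ | ⟨rfl, rfl⟩ | ⟨rfl, rfl⟩) <;> omega

/-- The hexagon `hexagon b` as a finite set. -/
noncomputable def hexFin (b : Fin 6 → ℤ) : Finset (Site ℤ) :=
  ((Finset.Ico (-b 3) (b 0) ×ˢ Finset.Ico (-b 5) (b 2)) ×ˢ Finset.univ).filter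
    fun f => -b 4 ≤ strip 2 f ∧ strip 2 f < b 1

theorem mem_hexFin {b : Fin 6 → ℤ} {f : Site ℤ} : f ∈ hexFin b ↔ ∀ k, top f k ≤ b k := by
  simp only [hexFin, Finset.mem_filter, Finset.mem_product, Finset.mem_Ico, Finset.mem_univ,
    and_true, top, strip_zero, strip_one, Fin.forall_fin_succ]
  simp
  omega

theorem coe_hexFin (b : Fin 6 → ℤ) : (hexFin b : Set (Site ℤ)) = hexagon b := by
  ext f
  rw [Finset.mem_coe, mem_hexFin, mem_hexagon]

theorem hexFin_mono {b b' : Fin 6 → ℤ} (h : ∀ k, b k ≤ b' k) : hexFin b ⊆ hexFin b' :=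
  fun _ hf => mem_hexFin.2 fun k => (mem_hexFin.1 hf k).trans (h k)

/-- The row u of a triangle of side n has 2 (n - 1 - u) + 1 faces, and the first n odd numbers add
up to n². -/
theorem card_triangle (n : ℕ) :
    (((Finset.range n ×ˢ Finset.range n) ×ˢ (Finset.univ : Finset Bool)).filter fun f =>
      f.1.1 + f.1.2 + (if f.2 then 1 else 0) < n).card = n ^ 2 := by
  rw [Finset.card_filter, Finset.sum_product, Finset.sum_product]
  have h : ∀ u ∈ Finset.range n, (∑ v ∈ Finset.range n, ∑ t : Bool,
      if u + v + (if t then 1 else 0) < n then 1 else 0) = 2 * (n - 1 - u) + 1 := by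
    intro u hu
    rw [Finset.mem_range] at hu
    simp only [Fintype.sum_bool, if_true, Finset.sum_add_distrib]
    rw [← Finset.card_filter, ← Finset.card_filter]
    have h1 : (Finset.range n).filter (fun v => u + v + 1 < n) = Finset.range (n - 1 - u) := by
      ext v; simp; omega
    have h2 : (Finset.range n).filter (fun v => u + v + (if false = true then 1 else 0) < n) =
        Finset.range (n - u) := by
      ext v; simp; omega
    rw [h1, h2, Finset.card_range, Finset.card_range]
    omega
  rw [Finset.sum_congr rfl h, Finset.sum_range_reflect (fun u => 2 * u + 1) n]
  clear h
  induction n with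
  | zero => rfl
  | succ n ih => rw [Finset.sum_range_succ, ih]; ring

theorem card_upper_corner (C : Finset (Site ℤ)) (X Y : ℤ) (n : ℕ)
    (h : ∀ f, f ∈ C ↔ strip 0 f < X ∧ strip 1 f < Y ∧ X + Y - n ≤ strip 2 f) :
    C.card = n ^ 2 := by
  rw [← card_triangle n]
  refine Finset.card_bij' (fun f _ => (((X - 1 - f.1.1).toNat, (Y - 1 - f.1.2).toNat), f.2))
    (fun f _ => ((X - 1 - f.1.1, Y - 1 - f.1.2), f.2)) ?_ ?_ ?_ ?_
  · rintro ⟨⟨x, y⟩, t⟩ hf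
    rw [h] at hf
    cases t <;> simp [strip] at hf ⊢ <;> omega
  · rintro ⟨⟨x, y⟩, t⟩ hf
    rw [h]
    cases t <;> simp [strip] at hf ⊢ <;> omega
  · rintro ⟨⟨x, y⟩, t⟩ hf
    rw [h] at hf
    cases t <;> simp [strip] at hf ⊢ <;> omega
  · rintro ⟨⟨x, y⟩, t⟩ hf
    cases t <;> simp at hf ⊢

theorem card_lower_corner (C : Finset (Site ℤ)) (X Y : ℤ) (n : ℕ)
    (h : ∀ f, f ∈ C ↔ X ≤ strip 0 f ∧ Y ≤ strip 1 f ∧ strip 2 f < X + Y + n) :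
    C.card = n ^ 2 := by
  rw [← card_triangle n]
  refine Finset.card_bij' (fun f _ => (((f.1.1 - X).toNat, (f.1.2 - Y).toNat), !f.2))
    (fun f _ => ((X + f.1.1, Y + f.1.2), !f.2)) ?_ ?_ ?_ ?_
  · rintro ⟨⟨x, y⟩, t⟩ hf
    rw [h] at hf
    cases t <;> simp [strip] at hf ⊢ <;> omega
  · rintro ⟨⟨x, y⟩, t⟩ hf
    rw [h]
    cases t <;> simp [strip] at hf ⊢ <;> omega
  · rintro ⟨⟨x, y⟩, t⟩ hf
    rw [h] at hf
    cases t <;> simp [strip] at hf ⊢ <;> omega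
  · rintro ⟨⟨x, y⟩, t⟩ hf
    cases t <;> simp at hf ⊢

theorem forall_sideLength_nonneg_iff {b : Fin 6 → ℤ} : (∀ k, 0 ≤ sideLength b k) ↔
    0 ≤ b 5 + b 1 - b 0 ∧ 0 ≤ b 0 + b 2 - b 1 ∧ 0 ≤ b 1 + b 3 - b 2 ∧ 0 ≤ b 2 + b 4 - b 3 ∧
      0 ≤ b 3 + b 5 - b 4 ∧ 0 ≤ b 4 + b 0 - b 5 := by
  simp only [Fin.forall_fin_succ]
  simp only [sideLength]
  constructor
  · rintro ⟨h0, h1, h2, h3, h4, h5, -⟩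
    exact ⟨h0, h1, h2, h3, h4, h5⟩
  · rintro ⟨h0, h1, h2, h3, h4, h5⟩
    exact ⟨h0, h1, h2, h3, h4, h5, fun i => i.elim0⟩

/-- The area of a hexagon: a parallelogram without two corners. -/
theorem card_hexFin {b : Fin 6 → ℤ} (hb : ∀ k, 0 ≤ sideLength b k) :
    ((hexFin b).card : ℤ) = 2 * (b 0 + b 3) * (b 2 + b 5) - (b 0 + b 2 - b 1) ^ 2 -
      (b 3 + b 5 - b 4) ^ 2 := by
  rw [forall_sideLength_nonneg_iff] at hb
  obtain ⟨h0, h1, h2, h3, h4, h5⟩ := hb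
  set B : Finset (Site ℤ) :=
    (Finset.Ico (-b 3) (b 0) ×ˢ Finset.Ico (-b 5) (b 2)) ×ˢ Finset.univ with hB
  have hmem : ∀ f, f ∈ B ↔ (-b 3 ≤ strip 0 f ∧ strip 0 f < b 0) ∧
      -b 5 ≤ strip 1 f ∧ strip 1 f < b 2 := by
    intro f
    simp [hB, strip_zero, strip_one]
  have hcz : ∀ f : Site ℤ, strip 0 f + strip 1 f ≤ strip 2 f ∧
      strip 2 f ≤ strip 0 f + strip 1 f + 1 := by
    rintro ⟨⟨x, y⟩, _ | _⟩ <;> simp [strip]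
  have hBcard : (B.card : ℤ) = 2 * (b 0 + b 3) * (b 2 + b 5) := by
    rw [hB, Finset.card_product, Finset.card_product, Int.card_Ico, Int.card_Ico]
    push_cast
    rw [Int.toNat_of_nonneg (by omega), Int.toNat_of_nonneg (by omega)]
    simp
    ring
  have hC1 : (B.filter fun f => b 1 ≤ strip 2 f).card = (b 0 + b 2 - b 1).toNat ^ 2 := by
    refine card_upper_corner _ (b 0) (b 2) _ fun f => ?_
    have := hcz f
    rw [Finset.mem_filter, hmem]
    omega
  have hC2 : (B.filter fun f => strip 2 f < -b 4).card = (b 3 + b 5 - b 4).toNat ^ 2 := by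
    refine card_lower_corner _ (-b 3) (-b 5) _ fun f => ?_
    have := hcz f
    rw [Finset.mem_filter, hmem]
    omega
  have hsplit : B.card = (hexFin b).card + (B.filter fun f => b 1 ≤ strip 2 f).card +
      (B.filter fun f => strip 2 f < -b 4).card := by
    rw [← Finset.card_union_of_disjoint, ← Finset.card_union_of_disjoint]
    · congr 1
      ext f
      simp only [hexFin, ← hB, Finset.mem_union, Finset.mem_filter]
      constructor
      · intro hf
        simp only [hf, true_and]
        omega
      · tauto
    · rw [Finset.disjoint_left]
      intro f hf hf'
      simp only [hexFin, ← hB, Finset.mem_union, Finset.mem_filter] at hf hf'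
      omega
    · rw [Finset.disjoint_left]
      intro f hf hf'
      simp only [hexFin, ← hB, Finset.mem_filter] at hf hf'
      omega
  have e1 : ((b 0 + b 2 - b 1).toNat : ℤ) = b 0 + b 2 - b 1 := Int.toNat_of_nonneg (by omega)
  have e2 : ((b 3 + b 5 - b 4).toNat : ℤ) = b 3 + b 5 - b 4 := Int.toNat_of_nonneg (by omega)
  have := congrArg (Nat.cast : ℕ → ℤ) hsplit
  rw [hC1, hC2] at this
  push_cast at this
  rw [e1, e2, hBcard] at this
  linarith

/-! ### The isoperimetric inequality in the plane -/

/-- Completion of squares, with ∑ b the perimeter of the hexagon. The deficit consists of the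
differences of the three widths and of the alternating sum of the bounds, all zero for a regular
hexagon, so the extremal cases can be read off from it. -/
theorem six_mul_card_hexFin {b : Fin 6 → ℤ} (hb : ∀ k, 0 ≤ sideLength b k) :
    6 * ((hexFin b).card : ℤ) = (∑ k, b k) ^ 2 -
      2 * ((b 0 + b 3 - (b 1 + b 4)) ^ 2 + (b 1 + b 4 - (b 2 + b 5)) ^ 2 +
        (b 0 + b 3 - (b 2 + b 5)) ^ 2) - 3 * (b 0 + b 2 + b 4 - (b 1 + b 3 + b 5)) ^ 2 := by
  rw [card_hexFin hb]
  simp only [Fin.sum_univ_succ, Fin.sum_univ_zero]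
  have e : ∀ x y z u v w : ℤ, 6 * (2 * (x + u) * (z + w) - (x + z - y) ^ 2 - (u + w - v) ^ 2) =
    (x + (y + (z + (u + (v + (w + 0)))))) ^ 2 -
      2 * ((x + u - (y + v)) ^ 2 + (y + v - (z + w)) ^ 2 +
        (x + u - (z + w)) ^ 2) - 3 * (x + z + v - (y + u + w)) ^ 2 := by intros; ring
  exact e (b 0) (b 1) (b 2) (b 3) (b 4) (b 5)

theorem six_mul_card_hexFin_le {b : Fin 6 → ℤ} (hb : ∀ k, 0 ≤ sideLength b k) :
    6 * ((hexFin b).card : ℤ) ≤ (∑ k, b k) ^ 2 := by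
  rw [six_mul_card_hexFin hb]
  nlinarith [sq_nonneg (b 0 + b 3 - (b 1 + b 4)), sq_nonneg (b 1 + b 4 - (b 2 + b 5)),
    sq_nonneg (b 0 + b 3 - (b 2 + b 5)), sq_nonneg (b 0 + b 2 + b 4 - (b 1 + b 3 + b 5))]

theorem sum_nonneg_of_sideLength {b : Fin 6 → ℤ} (hb : ∀ k, 0 ≤ sideLength b k) :
    0 ≤ ∑ k, b k := by
  rw [forall_sideLength_nonneg_iff] at hb
  simp only [Fin.sum_univ_succ, Fin.sum_univ_zero]
  have : ∀ x y z u v w : ℤ, (0 ≤ w + y - x ∧ 0 ≤ x + z - y ∧ 0 ≤ y + u - z ∧ 0 ≤ z + v - u ∧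
      0 ≤ u + w - v ∧ 0 ≤ v + x - w) → 0 ≤ (x + (y + (z + (u + (v + (w + 0)))))) := by
    intros; omega
  exact this (b 0) (b 1) (b 2) (b 3) (b 4) (b 5) hb

/-- The bounds of the smallest hexagon that contains a nonempty finite set of faces. -/
noncomputable def bd (P : Finset (Site ℤ)) (k : Fin 6) : ℤ :=
  if h : P.Nonempty then P.sup' h fun f => top f k else 0

theorem top_le_bd {P : Finset (Site ℤ)} {f : Site ℤ} (hf : f ∈ P) (k : Fin 6) :
    top f k ≤ bd P k := by
  rw [bd, dif_pos ⟨f, hf⟩]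
  exact Finset.le_sup' (fun f => top f k) hf

theorem exists_top_eq_bd {P : Finset (Site ℤ)} (hP : P.Nonempty) (k : Fin 6) :
    ∃ f ∈ P, top f k = bd P k := by
  rw [bd, dif_pos hP]
  obtain ⟨f, hf, h⟩ := Finset.exists_mem_eq_sup' hP fun f => top f k
  exact ⟨f, hf, h.symm⟩

theorem bd_le {P : Finset (Site ℤ)} (hP : P.Nonempty) {k : Fin 6} {c : ℤ}
    (h : ∀ f ∈ P, top f k ≤ c) : bd P k ≤ c := by
  obtain ⟨f, hf, hk⟩ := exists_top_eq_bd hP k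
  exact hk ▸ h f hf

theorem bd_mono {P Q : Finset (Site ℤ)} (hP : P.Nonempty) (h : P ⊆ Q) (k : Fin 6) :
    bd P k ≤ bd Q k :=
  bd_le hP fun _ hf => top_le_bd (h hf) k

theorem subset_hexFin_bd (P : Finset (Site ℤ)) : P ⊆ hexFin (bd P) :=
  fun _ hf => mem_hexFin.2 fun k => top_le_bd hf k

theorem sideLength_top_nonneg (f : Site ℤ) (k : Fin 6) : 0 ≤ sideLength (top f) k := by
  revert k
  rw [forall_sideLength_nonneg_iff]
  obtain ⟨⟨x, y⟩, _ | _⟩ := f <;> simp [top, strip] <;> omega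

theorem sideLength_bd_nonneg {P : Finset (Site ℤ)} (hP : P.Nonempty) (k : Fin 6) :
    0 ≤ sideLength (bd P) k := by
  obtain ⟨f, hf, hk⟩ := exists_top_eq_bd hP k
  have h1 := top_le_bd hf (k - 1)
  have h2 := top_le_bd hf (k + 1)
  have h3 := sideLength_top_nonneg f k
  simp only [sideLength] at h3 ⊢
  omega

theorem sum_bd_mono {P Q : Finset (Site ℤ)} (hP : P.Nonempty) (h : P ⊆ Q) :
    ∑ k, bd P k ≤ ∑ k, bd Q k :=
  Finset.sum_le_sum fun k _ => bd_mono hP h k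

theorem six_mul_card_le_sum_bd {P : Finset (Site ℤ)} (hP : P.Nonempty) :
    6 * (P.card : ℤ) ≤ (∑ k, bd P k) ^ 2 := by
  have h1 := six_mul_card_hexFin_le (sideLength_bd_nonneg hP)
  have h2 := Finset.card_le_card (subset_hexFin_bd P)
  omega

/-- The strips of direction `k` that meet `P` are consecutive. -/
def NoGap (k : Fin 3) (P : Finset (Site ℤ)) : Prop :=
  ∀ a, (∃ f ∈ P, strip k f < a) → (∃ f ∈ P, a < strip k f) → ∃ f ∈ P, strip k f = a

theorem NoGap.le_card {k : Fin 3} {P : Finset (Site ℤ)} (h : NoGap k P) {f g : Site ℤ}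
    (hf : f ∈ P) (hg : g ∈ P) :
    strip k f + 1 + -strip k g ≤ (P.image (strip k)).card := by
  have h1 : Finset.Icc (strip k g) (strip k f) ⊆ P.image (strip k) := by
    intro a ha
    rw [Finset.mem_Icc] at ha
    rw [Finset.mem_image]
    rcases ha.1.eq_or_lt with h2 | h2
    · exact ⟨g, hg, h2⟩
    rcases ha.2.eq_or_lt with h3 | h3
    · exact ⟨f, hf, h3.symm⟩
    · exact h a ⟨g, hg, h2⟩ ⟨f, hf, h3⟩
  have h2 := Finset.card_le_card h1
  rw [Int.card_Icc] at h2
  omega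

/-- Two opposite bounds add up to the width in one direction, which without gaps is the number of
strips met. -/
theorem sum_bd_le_per_of_noGap {P : Finset (Site ℤ)} (hP : P.Nonempty) (h : ∀ k, NoGap k P) :
    ∑ k, bd P k ≤ per P := by
  have key := sum_card_image_strip_le_per P
  obtain ⟨f0, hf0, e0⟩ := exists_top_eq_bd hP 0
  obtain ⟨f1, hf1, e1⟩ := exists_top_eq_bd hP 1
  obtain ⟨f2, hf2, e2⟩ := exists_top_eq_bd hP 2
  obtain ⟨f3, hf3, e3⟩ := exists_top_eq_bd hP 3
  obtain ⟨f4, hf4, e4⟩ := exists_top_eq_bd hP 4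
  obtain ⟨f5, hf5, e5⟩ := exists_top_eq_bd hP 5
  have h0 := (h 0).le_card hf0 hf3
  have h1 := (h 1).le_card hf2 hf5
  have h2 := (h 2).le_card hf1 hf4
  have e : ∑ k, bd P k = bd P 0 + bd P 1 + bd P 2 + bd P 3 + bd P 4 + bd P 5 :=
    Fin.sum_univ_six _
  rw [e, ← e0, ← e1, ← e2, ← e3, ← e4, ← e5]
  change (strip 0 f0 + 1) + (strip 2 f1 + 1) + (strip 1 f2 + 1) + -strip 0 f3 + -strip 2 f4 +
    -strip 1 f5 ≤ _
  omega

/-- The strip indices of neighbors differ by at most one, so no edge joins the two sides of an empty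
strip. -/
theorem exists_split_of_gap {k : Fin 3} {P : Finset (Site ℤ)} (h : ¬ NoGap k P) :
    ∃ P₁ P₂ : Finset (Site ℤ), P₁.Nonempty ∧ P₂.Nonempty ∧ P.card = P₁.card + P₂.card ∧
      per P = per P₁ + per P₂ := by
  simp only [NoGap, not_forall, not_exists, not_and] at h
  obtain ⟨a, ⟨f, hf, hfa⟩, ⟨g, hg, hga⟩, hne⟩ := h
  have hd : Disjoint (P.filter fun f => strip k f < a) (P.filter fun f => ¬ strip k f < a) :=
    Finset.disjoint_filter_filter_not _ _ _
  have hu : (P.filter fun f => strip k f < a) ∪ (P.filter fun f => ¬ strip k f < a) = P :=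
    Finset.filter_union_filter_not_eq _ _
  refine ⟨P.filter fun f => strip k f < a, P.filter fun f => ¬ strip k f < a,
    ⟨f, by simp [hf, hfa]⟩, ⟨g, by simp [hg, hga.le]⟩, ?_, ?_⟩
  · rw [← Finset.card_union_of_disjoint hd, hu]
  · rw [← per_union hd, hu]
    intro u hu i hv
    simp only [Finset.mem_filter] at hu hv
    have h1 := abs_le.1 (abs_strip_nb_sub_le u i k)
    have h2 := hne _ hv.1
    omega

theorem three_le_of_six_le_sq {n : ℕ} (h : 6 ≤ n ^ 2) : 3 ≤ n := by
  by_contra h'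
  have : n ≤ 2 := by omega
  nlinarith

/-- Both perimeters are at least 3, and p₁² + p₂² with a given sum is then largest when one of them
equals 3; this is (p₁ - 3) (p₂ - 3) ≥ 0. -/
theorem six_mul_card_le_of_split {n₁ n₂ p₁ p₂ : ℕ} (h1 : 6 * n₁ ≤ p₁ ^ 2)
    (h2 : 6 * n₂ ≤ p₂ ^ 2) (h3 : 0 < n₁) (h4 : 0 < n₂) :
    3 ≤ p₁ + p₂ ∧ 6 * ((n₁ + n₂ : ℕ) : ℤ) ≤ (((p₁ + p₂ : ℕ) : ℤ) - 3) ^ 2 + 9 := by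
  have a1 := three_le_of_six_le_sq (n := p₁) (by omega)
  have a2 := three_le_of_six_le_sq (n := p₂) (by omega)
  refine ⟨by omega, ?_⟩
  zify at *
  nlinarith [mul_nonneg (sub_nonneg.2 a1) (sub_nonneg.2 a2)]

/-- The isoperimetric inequality. -/
theorem six_mul_card_le_per_sq (P : Finset (Site ℤ)) : 6 * P.card ≤ per P ^ 2 := by
  induction hn : P.card using Nat.strong_induction_on generalizing P with
  | _ n ih =>
    subst hn
    rcases P.eq_empty_or_nonempty with rfl | hP
    · simp
    by_cases h : ∀ k, NoGap k P
    · have h1 := sum_bd_le_per_of_noGap hP h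
      have h2 := six_mul_card_le_sum_bd hP
      have h3 := sum_nonneg_of_sideLength (sideLength_bd_nonneg hP)
      zify
      nlinarith
    · push Not at h
      obtain ⟨k, hk⟩ := h
      obtain ⟨P₁, P₂, hP₁, hP₂, hc, hp⟩ := exists_split_of_gap hk
      have c1 := hP₁.card_pos
      have c2 := hP₂.card_pos
      have := six_mul_card_le_of_split (ih _ (by omega) P₁ rfl) (ih _ (by omega) P₂ rfl) c1 c2
      rw [← hc, ← hp] at this
      zify at this ⊢
      nlinarith

theorem sum_bd_le_per {P : Finset (Site ℤ)} (hP : P.Nonempty)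
    (h : ((per P : ℤ) - 3) ^ 2 + 9 < 6 * P.card) : ∑ k, bd P k ≤ per P := by
  by_cases h' : ∀ k, NoGap k P
  · exact sum_bd_le_per_of_noGap hP h'
  · push Not at h'
    obtain ⟨k, hk⟩ := h'
    obtain ⟨P₁, P₂, hP₁, hP₂, hc, hp⟩ := exists_split_of_gap hk
    have := six_mul_card_le_of_split (six_mul_card_le_per_sq P₁) (six_mul_card_le_per_sq P₂)
      hP₁.card_pos hP₂.card_pos
    rw [← hc, ← hp] at this
    omega

/-! ### Hexagons of maximal area -/

/-- The perimeter p is odd, which makes the alternating sum of the bounds odd at perimeter p and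
keeps the deficit away from zero. -/
theorem card_hexFin_le {b : Fin 6 → ℤ} (hb : ∀ k, 0 ≤ sideLength b k) {N p : ℕ}
    (hN : 6 * N + 7 = p ^ 2) (hp : 7 ≤ p) (hs : ∑ k, b k ≤ p) : (hexFin b).card ≤ N := by
  have h1 := six_mul_card_hexFin hb
  have h0 := sum_nonneg_of_sideLength hb
  set s := ∑ k, b k
  zify at *
  have t1 := sq_nonneg (b 0 + b 3 - (b 1 + b 4))
  have t2 := sq_nonneg (b 1 + b 4 - (b 2 + b 5))
  have t3 := sq_nonneg (b 0 + b 3 - (b 2 + b 5))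
  have t4 := sq_nonneg (b 0 + b 2 + b 4 - (b 1 + b 3 + b 5))
  have t5 : s ^ 2 ≤ p ^ 2 := by nlinarith
  by_contra hlt
  push Not at hlt
  -- An area above N leaves a deficit of at most 1, and this square enters with the factor 3. At
  -- perimeter p the area identity then fails modulo 2; below p, already (p - 1)² is too small.
  have ht : (b 0 + b 2 + b 4 - (b 1 + b 3 + b 5)) ^ 2 = 0 := by omega
  rcases hs.eq_or_lt with h2 | h2
  · rw [h2] at h1
    omega
  · have : s ^ 2 ≤ ((p : ℤ) - 1) ^ 2 := by nlinarith
    nlinarith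

theorem isQuasiRegular_of_bounds {b : Fin 6 → ℤ} (r i : ℕ) (d : Fin 6) (hr : 1 ≤ r) (hi : i ≤ 5)
    (c : ℤ × ℤ) (h : ∀ k, b k = quasiHexBounds c r i d k) : IsQuasiRegular b :=
  ⟨c, r, i, d, hr, hi, funext h⟩

theorem quadratic_eq_seven {u v t : ℤ} (hq : 2 * (u ^ 2 + v ^ 2 + (u + v) ^ 2) + 3 * t ^ 2 = 7) :
    (t = 1 ∨ t = -1) ∧ (u = 1 ∧ v = 0 ∨ u = -1 ∧ v = 0 ∨ u = 0 ∧ v = 1 ∨ u = 0 ∧ v = -1 ∨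
      u = 1 ∧ v = -1 ∨ u = -1 ∧ v = 1) := by
  have hu1 : u ≤ 1 := by nlinarith [sq_nonneg t, sq_nonneg (u + 2 * v)]
  have hu2 : -1 ≤ u := by nlinarith [sq_nonneg t, sq_nonneg (u + 2 * v)]
  have hv1 : v ≤ 1 := by nlinarith [sq_nonneg t, sq_nonneg (2 * u + v)]
  have hv2 : -1 ≤ v := by nlinarith [sq_nonneg t, sq_nonneg (2 * u + v)]
  have ht1 : t ≤ 1 := by nlinarith [sq_nonneg u, sq_nonneg v, sq_nonneg (u + v)]
  have ht2 : -1 ≤ t := by nlinarith [sq_nonneg u, sq_nonneg v, sq_nonneg (u + v)]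
  interval_cases t <;> interval_cases u <;> interval_cases v <;> simp at hq ⊢

/-- Equality case: the deficit is exactly 7. The form then has twelve solutions, which are the six
positions of a single bar and the six positions of a single missing bar. -/
theorem isQuasiRegular_of_card {b : Fin 6 → ℤ} (hb : ∀ k, 0 ≤ sideLength b k) {N p : ℕ}
    (hN : 6 * N + 7 = p ^ 2) (hp : 7 ≤ p) (hs : ∑ k, b k = p) (hcard : (hexFin b).card = N) :
    IsQuasiRegular b := by
  have h1 := six_mul_card_hexFin hb
  rw [hs, hcard] at h1
  have hs' : b 0 + b 1 + b 2 + b 3 + b 4 + b 5 = p := by rw [← hs]; exact (Fin.sum_univ_six _).symm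
  zify at hN hp
  obtain ⟨u, hu⟩ : ∃ u, u = b 0 + b 3 - (b 1 + b 4) := ⟨_, rfl⟩
  obtain ⟨v, hv⟩ : ∃ v, v = b 1 + b 4 - (b 2 + b 5) := ⟨_, rfl⟩
  obtain ⟨t, ht⟩ : ∃ t, t = b 0 + b 2 + b 4 - (b 1 + b 3 + b 5) := ⟨_, rfl⟩
  have huv : b 0 + b 3 - (b 2 + b 5) = u + v := by omega
  rw [← hu, ← hv, huv, ← ht] at h1
  have hq : 2 * (u ^ 2 + v ^ 2 + (u + v) ^ 2) + 3 * t ^ 2 = 7 := by linarith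
  obtain ⟨htt, huv'⟩ := quadratic_eq_seven hq
  clear h1 hq hb hs hcard huv
  have one : ∀ d : Fin 6, ∀ r : ℕ, 1 ≤ r → (∃ x y : ℤ, ∀ k,
      b k = sideForm k (x, y) + r + if k = d then 1 else 0) → IsQuasiRegular b := by
    rintro d r hr ⟨x, y, h⟩
    refine isQuasiRegular_of_bounds r 1 d hr (by norm_num) (x, y) fun k => ?_
    rw [h k, quasiHexBounds]
    congr 2
    rw [eq_iff_iff, Nat.lt_one_iff, Fin.val_eq_zero_iff, sub_eq_zero]
  have five : ∀ m : Fin 6, ∀ r : ℕ, 1 ≤ r → (∃ x y : ℤ, ∀ k,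
      b k = sideForm k (x, y) + r + if k = m then 0 else 1) → IsQuasiRegular b := by
    rintro m r hr ⟨x, y, h⟩
    refine isQuasiRegular_of_bounds r 5 (m + 1) hr (by norm_num) (x, y) fun k => ?_
    rw [h k, quasiHexBounds]
    congr 1
    have : ∀ k m : Fin 6, ((k - (m + 1)).val < 5) ↔ ¬ k = m := by decide
    simp only [this, ite_not]
  -- The values of u, v, t determine p modulo 6: one bar for residue 1, five bars for residue 5. The
  -- center is then recovered from `b 0` and `b 2`.
  obtain ⟨R, hR⟩ : ∃ R : ℕ, (p : ℤ) = 6 * R + 1 ∨ (p : ℤ) = 6 * R + 5 := by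
    refine ⟨p / 6, ?_⟩
    rcases htt with rfl | rfl <;>
      rcases huv' with h | h | h | h | h | h <;> obtain ⟨rfl, rfl⟩ := h <;> omega
  have hR1' : 1 ≤ R := by omega
  have hform : ∀ (g : Fin 6 → ℤ), b 0 = g 0 → b 1 = g 1 → b 2 = g 2 → b 3 = g 3 → b 4 = g 4 →
      b 5 = g 5 → ∀ k, b k = g k := by
    intro g h0 h1 h2 h3 h4 h5 k
    fin_cases k <;> assumption
  rcases htt with rfl | rfl <;> rcases huv' with h | h | h | h | h | h <;> obtain ⟨rfl, rfl⟩ := h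
  · refine one 0 R hR1' ⟨b 0 - R - 1, b 2 - R, hform _ ?_ ?_ ?_ ?_ ?_ ?_⟩ <;>
      simp [sideForm] <;> omega
  · refine five 3 R hR1' ⟨b 0 - R - 1, b 2 - R - 1, hform _ ?_ ?_ ?_ ?_ ?_ ?_⟩ <;>
      simp [sideForm] <;> omega
  · refine five 5 R hR1' ⟨b 0 - R - 1, b 2 - R - 1, hform _ ?_ ?_ ?_ ?_ ?_ ?_⟩ <;>
      simp [sideForm] <;> omega
  · refine one 2 R hR1' ⟨b 0 - R, b 2 - R - 1, hform _ ?_ ?_ ?_ ?_ ?_ ?_⟩ <;>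
      simp [sideForm] <;> omega
  · refine five 1 R hR1' ⟨b 0 - R - 1, b 2 - R - 1, hform _ ?_ ?_ ?_ ?_ ?_ ?_⟩ <;>
      simp [sideForm] <;> omega
  · refine one 4 R hR1' ⟨b 0 - R, b 2 - R, hform _ ?_ ?_ ?_ ?_ ?_ ?_⟩ <;>
      simp [sideForm] <;> omega
  · refine one 3 R hR1' ⟨b 0 - R, b 2 - R, hform _ ?_ ?_ ?_ ?_ ?_ ?_⟩ <;>
      simp [sideForm] <;> omega
  · refine five 0 R hR1' ⟨b 0 - R, b 2 - R - 1, hform _ ?_ ?_ ?_ ?_ ?_ ?_⟩ <;>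
      simp [sideForm] <;> omega
  · refine five 2 R hR1' ⟨b 0 - R - 1, b 2 - R, hform _ ?_ ?_ ?_ ?_ ?_ ?_⟩ <;>
      simp [sideForm] <;> omega
  · refine one 5 R hR1' ⟨b 0 - R, b 2 - R, hform _ ?_ ?_ ?_ ?_ ?_ ?_⟩ <;>
      simp [sideForm] <;> omega
  · refine five 4 R hR1' ⟨b 0 - R - 1, b 2 - R - 1, hform _ ?_ ?_ ?_ ?_ ?_ ?_⟩ <;>
      simp [sideForm] <;> omega
  · refine one 1 R hR1' ⟨b 0 - R, b 2 - R, hform _ ?_ ?_ ?_ ?_ ?_ ?_⟩ <;>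
      simp [sideForm] <;> omega

theorem card_hexFin_update {b : Fin 6 → ℤ} (hb : ∀ k, 0 ≤ sideLength b k) {k : Fin 6}
    (hk : 1 ≤ sideLength b k) :
    (∀ k', 0 ≤ sideLength (Function.update b k (b k + 1)) k') ∧
      ((hexFin (Function.update b k (b k + 1))).card : ℤ) =
        (hexFin b).card + 2 * sideLength b k - 1 := by
  have e : (-1 : Fin 6) = 5 := rfl
  have h1 : ∀ k', 0 ≤ sideLength (Function.update b k (b k + 1)) k' := by
    rw [forall_sideLength_nonneg_iff] at hb ⊢
    obtain ⟨h0, h1, h2, h3, h4, h5⟩ := hb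
    fin_cases k <;> simp [sideLength, Function.update, e] at hk ⊢ <;>
      refine ⟨?_, ?_, ?_, ?_, ?_, ?_⟩ <;> omega
  refine ⟨h1, ?_⟩
  rw [card_hexFin hb, card_hexFin h1]
  fin_cases k <;> simp [sideLength, Function.update, e] <;> ring

/-! ### Cutting the torus -/

section Torus

variable {L : ℕ} [NeZero L]

/-- `F` runs around a closed strip with alternating orientations, so closure under the successor
propagates from one face to the whole cycle. -/
theorem full_of_closed {P : Finset (Site (ZMod L))} (F : ZMod L → Bool → Site (ZMod L))
    (h1 : ∀ y, F y true ∈ P → F y false ∈ P) (h2 : ∀ y, F y false ∈ P → F (y + 1) true ∈ P)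
    (hne : ∃ y t, F y t ∈ P) (y : ZMod L) (t : Bool) : F y t ∈ P := by
  obtain ⟨y₀, hy₀⟩ : ∃ y, F y true ∈ P := by
    obtain ⟨y, _ | _, hy⟩ := hne
    · exact ⟨_, h2 _ hy⟩
    · exact ⟨_, hy⟩
  have h3 : ∀ n : ℕ, F (y₀ + n) true ∈ P := by
    intro n
    induction n with
    | zero => simpa using hy₀
    | succ n ih =>
      rw [Nat.cast_succ, ← add_assoc]
      exact h2 _ (h1 _ ih)
  have h4 : F y true ∈ P := by
    have := h3 (y - y₀).val
    rwa [ZMod.natCast_zmod_val, add_sub_cancel] at this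
  cases t
  · exact h1 _ h4
  · exact h4

theorem card_rows_le {P : Finset (Site (ZMod L))} (row : Site (ZMod L) → ZMod L)
    (s : Site (ZMod L) → Site (ZMod L))
    (hs : ∀ c, (∃ f ∈ P, row f = c) → (∀ f ∈ P, row f = c → s f ∈ P) → ∀ f, row f = c → f ∈ P) :
    ((P.image row).filter fun c => ¬ ∀ f, row f = c → f ∈ P).card ≤
      (P.filter fun f => s f ∉ P).card := by
  refine (Finset.card_le_card ?_).trans (Finset.card_image_le (f := row))
  intro c hc
  simp only [Finset.mem_filter, Finset.mem_image] at hc ⊢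
  by_contra hcon
  refine hc.2 (hs c hc.1 fun f hf hfc => ?_)
  by_contra hsf
  exact hcon ⟨f, ⟨hf, hsf⟩, hfc⟩

/-- A strip that is met but not full is left by P in both senses of rotation, through different
boundary edges. -/
theorem two_mul_card_rows_zero_le (P : Finset (Site (ZMod L))) :
    2 * ((P.image (strip 0)).filter fun c => ¬ ∀ f, strip 0 f = c → f ∈ P).card ≤ per P := by
  have h1 := card_rows_le (P := P) (strip 0) (fun f => nb f (if f.2 then 0 else 2)) (by
    rintro c ⟨⟨⟨x, y⟩, t⟩, hf, rfl⟩ hcl ⟨⟨x', y'⟩, t'⟩ rfl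
    refine full_of_closed (fun y t => ((x', y), t)) (fun y hy => ?_) (fun y hy => ?_) ⟨y, t, hf⟩ _ _
    · simpa [nb] using hcl _ hy rfl
    · simpa [nb] using hcl _ hy rfl)
  have h2 := card_rows_le (P := P) (strip 0) (fun f => nb f (if f.2 then 2 else 0)) (by
    rintro c ⟨⟨⟨x, y⟩, t⟩, hf, rfl⟩ hcl ⟨⟨x', y'⟩, t'⟩ rfl
    have := full_of_closed (P := P) (fun y t => ((x', -y), !t)) (fun y hy => ?_) (fun y hy => ?_)
      ⟨-y, !t, by simpa [strip_zero] using hf⟩ (-y') (!t')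
    · simpa using this
    · simpa [nb] using hcl _ hy rfl
    · simpa [nb, sub_eq_add_neg, add_comm] using hcl _ hy rfl)
  rw [card_filter_nb] at h1 h2
  rw [per_eq_classes, Fin.sum_univ_three]
  omega

theorem two_mul_card_rows_one_le (P : Finset (Site (ZMod L))) :
    2 * ((P.image (strip 1)).filter fun c => ¬ ∀ f, strip 1 f = c → f ∈ P).card ≤ per P := by
  have h1 := card_rows_le (P := P) (strip 1) (fun f => nb f (if f.2 then 0 else 1)) (by
    rintro c ⟨⟨⟨x, y⟩, t⟩, hf, rfl⟩ hcl ⟨⟨x', y'⟩, t'⟩ rfl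
    refine full_of_closed (fun x t => ((x, y'), t)) (fun y hy => ?_) (fun y hy => ?_) ⟨x, t, hf⟩ _ _
    · simpa [nb] using hcl _ hy rfl
    · simpa [nb] using hcl _ hy rfl)
  have h2 := card_rows_le (P := P) (strip 1) (fun f => nb f (if f.2 then 1 else 0)) (by
    rintro c ⟨⟨⟨x, y⟩, t⟩, hf, rfl⟩ hcl ⟨⟨x', y'⟩, t'⟩ rfl
    have := full_of_closed (P := P) (fun x t => ((-x, y'), !t)) (fun y hy => ?_) (fun y hy => ?_)
      ⟨-x, !t, by simpa [strip_one] using hf⟩ (-x') (!t')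
    · simpa using this
    · simpa [nb] using hcl _ hy rfl
    · simpa [nb, sub_eq_add_neg, add_comm] using hcl _ hy rfl)
  rw [card_filter_nb] at h1 h2
  rw [per_eq_classes, Fin.sum_univ_three]
  omega

theorem card_full_rows_mul_le (P : Finset (Site (ZMod L))) (row : Site (ZMod L) → ZMod L)
    (F : ZMod L → ZMod L → Bool → Site (ZMod L)) (hF : ∀ c y t, row (F c y t) = c)
    (hinj : ∀ c y t c' y' t', F c y t = F c' y' t' → c = c' ∧ y = y' ∧ t = t')
    (C : Finset (ZMod L)) (hC : ∀ c ∈ C, ∀ f, row f = c → f ∈ P) :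
    C.card * (L * 2) ≤ P.card := by
  have : (C ×ˢ (Finset.univ : Finset (ZMod L × Bool))).card ≤ P.card := by
    refine Finset.card_le_card_of_injOn (fun q => F q.1 q.2.1 q.2.2) ?_ ?_
    · rintro ⟨c, y, t⟩ hq
      simp only [Finset.coe_product, Set.mem_prod, Finset.mem_coe] at hq
      exact hC c hq.1 _ (hF _ _ _)
    · rintro ⟨c, y, t⟩ _ ⟨c', y', t'⟩ _ h
      obtain ⟨rfl, rfl, rfl⟩ := hinj _ _ _ _ _ _ h
      rfl
  rw [Finset.card_product] at this
  simpa [Fintype.card_prod, ZMod.card] using this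

/-- A full strip meets all L transversal strips. The u full ones among these use 2 L faces each and
the v others two boundary edges each; u + v = L gives 2 L² ≤ |P| + L per(P). -/
theorem not_full_of_small {P : Finset (Site (ZMod L))} (row row' : Site (ZMod L) → ZMod L)
    (hrow : ∀ c c', ∃ f, row f = c ∧ row' f = c')
    (h : P.card + L * per P < 2 * L ^ 2)
    (h1 : 2 * ((P.image row').filter fun c => ¬ ∀ f, row' f = c → f ∈ P).card ≤ per P)
    (h2 : ∀ C : Finset (ZMod L), (∀ c ∈ C, ∀ f, row' f = c → f ∈ P) → C.card * (L * 2) ≤ P.card)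
    (c : ZMod L) : ¬ ∀ f, row f = c → f ∈ P := by
  intro hfull
  have himg : P.image row' = Finset.univ := by
    refine Finset.eq_univ_of_forall fun c' => ?_
    obtain ⟨f, hf, hf'⟩ := hrow c c'
    exact Finset.mem_image.2 ⟨f, hfull f hf, hf'⟩
  rw [himg] at h1
  have h3 := h2 (Finset.univ.filter fun c => ∀ f, row' f = c → f ∈ P) (by simp)
  have h4 := Finset.card_filter_add_card_filter_not (s := (Finset.univ : Finset (ZMod L)))
    (fun c => ∀ f, row' f = c → f ∈ P)
  rw [Finset.card_univ, ZMod.card] at h4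
  set u := (Finset.univ.filter fun c => ∀ f, row' f = c → f ∈ P).card
  set v := (Finset.univ.filter fun c => ¬ ∀ f, row' f = c → f ∈ P).card
  have h5 : L * (2 * v) ≤ L * per P := Nat.mul_le_mul_left _ h1
  have h6 : 2 * L ^ 2 = u * (L * 2) + L * (2 * v) := by rw [← h4]; ring
  omega

theorem two_mul_card_strip_le {P : Finset (Site (ZMod L))} (h : P.card + L * per P < 2 * L ^ 2) :
    2 * (P.image (strip 0)).card ≤ per P ∧ 2 * (P.image (strip 1)).card ≤ per P := by
  have z := two_mul_card_rows_zero_le P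
  have o := two_mul_card_rows_one_le P
  have h0 := not_full_of_small (strip 0) (strip 1) (fun c c' => ⟨((c, c'), true), rfl, rfl⟩) h o
    (card_full_rows_mul_le P (strip 1) (fun c x t => ((x, c), t)) (fun _ _ _ => rfl) (by simp))
  have h1 := not_full_of_small (strip 1) (strip 0) (fun c c' => ⟨((c', c), true), rfl, rfl⟩) h z
    (card_full_rows_mul_le P (strip 0) (fun c x t => ((c, x), t)) (fun _ _ _ => rfl) (by simp))
  rw [Finset.filter_true_of_mem fun c _ => h0 c] at z
  rw [Finset.filter_true_of_mem fun c _ => h1 c] at o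
  exact ⟨z, o⟩

/-! ### Lifting small sets from the torus to the plane -/

omit [NeZero L] in
theorem toTorus_nb (f : Site ℤ) (i : Fin 3) : toTorus L (nb f i) = nb (toTorus L f) i := by
  obtain ⟨⟨x, y⟩, t⟩ := f
  fin_cases i <;> cases t <;> simp [toTorus, nb]

/-- The lift to the plane of the torus cut along the strips `a` and `b`. -/
def lift (a b : ZMod L) (f : Site (ZMod L)) : Site ℤ :=
  ((((f.1.1 - a).val + a.val : ℤ), ((f.1.2 - b).val + b.val : ℤ)), f.2)

theorem toTorus_lift (a b : ZMod L) (f : Site (ZMod L)) : toTorus L (lift a b f) = f := by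
  obtain ⟨⟨x, y⟩, t⟩ := f
  simp [toTorus, lift]

theorem lift_injective (a b : ZMod L) : Function.Injective (lift a b) :=
  Function.LeftInverse.injective (toTorus_lift a b)

/-- The face `f` is not on the cut. -/
def OffCut (a b : ZMod L) (f : Site (ZMod L)) : Prop := strip 0 f ≠ a ∧ strip 1 f ≠ b

theorem val_sub_one_sub {x a : ZMod L} (h : x ≠ a) :
    ((x - 1 - a).val : ℤ) = (x - a).val - 1 := by
  have h1 : (x - a).val ≠ 0 := by
    rw [Ne, ZMod.val_eq_zero, sub_eq_zero]
    exact h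
  have h2 : x - 1 - a = ((((x - a).val - 1 : ℕ)) : ZMod L) := by
    rw [Nat.cast_sub (by omega), ZMod.natCast_zmod_val]
    ring
  have h3 := ZMod.val_lt (x - a)
  rw [h2, ZMod.val_natCast_of_lt (by omega)]
  omega

theorem val_add_one_sub {x a : ZMod L} (h : x + 1 ≠ a) :
    ((x + 1 - a).val : ℤ) = (x - a).val + 1 := by
  have := val_sub_one_sub h
  rw [add_sub_cancel_right] at this
  omega

theorem lift_nb {a b : ZMod L} {f : Site (ZMod L)} {i : Fin 3} (hf : OffCut a b f)
    (hi : OffCut a b (nb f i)) : lift a b (nb f i) = nb (lift a b f) i := by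
  obtain ⟨⟨x, y⟩, t⟩ := f
  obtain ⟨h1, h2⟩ := hf
  obtain ⟨h3, h4⟩ := hi
  fin_cases i <;> cases t <;> simp [nb, strip_zero, strip_one] at h1 h2 h3 h4 <;>
    simp [nb, lift, val_sub_one_sub, val_add_one_sub, -ZMod.natCast_val, *] <;> ring

theorem nb_lift_mem_iff {a b : ZMod L} {f : Site (ZMod L)} {i : Fin 3}
    {S : Finset (Site (ZMod L))} (hf : OffCut a b f) (hS : ∀ g ∈ S, OffCut a b g) :
    nb (lift a b f) i ∈ S.image (lift a b) ↔ nb f i ∈ S := by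
  rw [Finset.mem_image]
  constructor
  · rintro ⟨g, hg, h⟩
    have := congrArg (toTorus L) h
    rw [toTorus_nb, toTorus_lift, toTorus_lift] at this
    rwa [← this]
  · intro h
    exact ⟨_, h, lift_nb hf (hS _ h)⟩

theorem per_image_lift {a b : ZMod L} {S : Finset (Site (ZMod L))}
    (hS : ∀ g ∈ S, OffCut a b g) : per (S.image (lift a b)) = per S := by
  rw [per, Finset.sum_image (lift_injective a b).injOn, per]
  refine Finset.sum_congr rfl fun f hf => ?_
  congr 1
  ext i
  simp only [Finset.mem_filter, Finset.mem_univ, true_and]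
  rw [nb_lift_mem_iff (hS f hf) hS]

theorem deg_image_lift {a b : ZMod L} {f : Site (ZMod L)} {S : Finset (Site (ZMod L))}
    (hf : OffCut a b f) (hS : ∀ g ∈ S, OffCut a b g) :
    deg (S.image (lift a b)) (lift a b f) = deg S f := by
  rw [deg, deg]
  congr 1
  ext i
  simp only [Finset.mem_filter, Finset.mem_univ, true_and]
  rw [nb_lift_mem_iff hf hS]

theorem card_image_lift (a b : ZMod L) (S : Finset (Site (ZMod L))) :
    (S.image (lift a b)).card = S.card :=
  Finset.card_image_of_injective _ (lift_injective a b)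

theorem image_toTorus_image_lift (a b : ZMod L) (S : Finset (Site (ZMod L))) :
    (S.image (lift a b)).image (toTorus L) = S := by
  rw [Finset.image_image, show toTorus L ∘ lift a b = id from funext fun f => toTorus_lift a b f,
    Finset.image_id]

theorem exists_offCut {S : Finset (Site (ZMod L))} (h0 : (S.image (strip 0)).card < L)
    (h1 : (S.image (strip 1)).card < L) : ∃ a b, ∀ g ∈ S, OffCut a b g := by
  obtain ⟨a, ha⟩ : ∃ a, a ∉ S.image (strip 0) := by
    by_contra! h
    rw [Finset.eq_univ_of_forall h, Finset.card_univ, ZMod.card] at h0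
    exact lt_irrefl _ h0
  obtain ⟨b, hb⟩ : ∃ b, b ∉ S.image (strip 1) := by
    by_contra! h
    rw [Finset.eq_univ_of_forall h, Finset.card_univ, ZMod.card] at h1
    exact lt_irrefl _ h1
  exact ⟨a, b, fun g hg => ⟨fun h => ha (Finset.mem_image.2 ⟨g, hg, h⟩),
    fun h => hb (Finset.mem_image.2 ⟨g, hg, h⟩)⟩⟩

theorem per_lt_of_small {P : Finset (Site (ZMod L))} (h : P.card + L * per P < 2 * L ^ 2) :
    per P < 2 * L := by
  by_contra! h'
  have := Nat.mul_le_mul_left L h'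
  have e : L * (2 * L) = 2 * L ^ 2 := by ring
  omega

/-- The isoperimetric inequality on the torus. -/
theorem six_mul_card_le_per_sq_of_small {P : Finset (Site (ZMod L))}
    (h : P.card + L * per P < 2 * L ^ 2) : 6 * P.card ≤ per P ^ 2 := by
  have h1 := two_mul_card_strip_le h
  have h2 := per_lt_of_small h
  obtain ⟨a, b, hab⟩ := exists_offCut (S := P) (by omega) (by omega)
  have := six_mul_card_le_per_sq (P.image (lift a b))
  rwa [card_image_lift, per_image_lift hab] at this

/-! ### The energy -/

/-- The set of sites with spin `+1`, as a finite set. -/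
def plus (σ : Config L) : Finset (Site (ZMod L)) := Finset.univ.filter fun s => σ s = 1

/-- The configuration with a given set of sites with spin `+1`. -/
def conf (S : Finset (Site (ZMod L))) : Config L := fun s => if s ∈ S then 1 else -1

@[simp] theorem mem_plus {σ : Config L} {s : Site (ZMod L)} : s ∈ plus σ ↔ σ s = 1 := by
  simp [plus]

omit [NeZero L] in
theorem conf_apply_eq_one_iff {S : Finset (Site (ZMod L))} {s : Site (ZMod L)} :
    conf S s = 1 ↔ s ∈ S := by
  by_cases h : s ∈ S
  · simp [conf, h]
  · simp only [conf, h, if_false, iff_false]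
    decide

@[simp] theorem plus_conf (S : Finset (Site (ZMod L))) : plus (conf S) = S := by
  ext s
  rw [mem_plus, conf_apply_eq_one_iff]

@[simp] theorem conf_plus (σ : Config L) : conf (plus σ) = σ := by
  funext s
  rcases Int.units_eq_one_or (σ s) with h | h
  · simp [conf, h]
  · have : ¬ ((-1 : ℤˣ) = 1) := by decide
    simp [conf, h, this]

theorem coe_plus (σ : Config L) : (plus σ : Set (Site (ZMod L))) = plusSet σ := by
  ext s
  simp [plusSet]

@[simp] theorem plus_allMinus : plus (allMinus L) = ∅ := by
  ext s
  simp only [mem_plus, allMinus, Finset.notMem_empty, iff_false]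
  decide

@[simp] theorem plus_allPlus : plus (allPlus L) = Finset.univ := by
  ext s
  simp [allPlus]

/-- The energy of a configuration relative to the one of all minuses. -/
def energy (J h : ℝ) (S : Finset (Site (ZMod L))) : ℝ := J * per S - h * S.card

/-- For L = 1 the three neighbors of a face coincide. From L = 2 on, the edges correspond to the
pairs of a face of type `true` and a direction. -/
theorem nb_injective (hL : 2 ≤ L) (f : Site (ZMod L)) : Function.Injective (nb f) := by
  have : Fact (1 < L) := ⟨hL⟩
  obtain ⟨⟨x, y⟩, t⟩ := f
  intro i j h
  fin_cases i <;> fin_cases j <;> cases t <;> simp [nb, eq_sub_iff_add_eq] at h ⊢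

theorem sum_edgeFinset (hL : 2 ≤ L) (F : Sym2 (Site (ZMod L)) → ℝ)
    [Fintype (hexLattice (ZMod L)).edgeSet] :
    ∑ e ∈ (hexLattice (ZMod L)).edgeFinset, F e =
      ∑ q ∈ (Finset.univ.filter fun f : Site (ZMod L) => f.2 = true) ×ˢ
        (Finset.univ : Finset (Fin 3)), F s(q.1, nb q.1 q.2) := by
  symm
  refine Finset.sum_bij (fun q _ => s(q.1, nb q.1 q.2)) ?_ ?_ ?_ (fun _ _ => rfl)
  · rintro ⟨f, i⟩ _
    rw [SimpleGraph.mem_edgeFinset, SimpleGraph.mem_edgeSet, hexLattice_adj_iff]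
    exact ⟨i, rfl⟩
  · rintro ⟨f, i⟩ hf ⟨g, j⟩ hg hfg
    simp only [Finset.mem_product, Finset.mem_filter, Finset.mem_univ, true_and, and_true] at hf hg
    rw [Sym2.eq_iff] at hfg
    rcases hfg with ⟨h1, h2⟩ | ⟨h1, -⟩
    · dsimp only at h1 h2
      subst h1
      rw [nb_injective hL f h2]
    · have := congrArg Prod.snd h1
      simp [nb_snd, hf, hg] at this
  · intro e he
    induction e using Sym2.ind with
    | _ f g =>
      rw [SimpleGraph.mem_edgeFinset, SimpleGraph.mem_edgeSet, hexLattice_adj_iff] at he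
      obtain ⟨i, rfl⟩ := he
      cases ht : f.2
      · refine ⟨(nb f i, i), by simp [nb_snd, ht], ?_⟩
        rw [nb_nb, Sym2.eq_swap]
      · exact ⟨(f, i), by simp [ht], rfl⟩

theorem spin_eq (σ : Config L) (s : Site (ZMod L)) :
    ((σ s : ℤ) : ℝ) = if s ∈ plus σ then 1 else -1 := by
  rw [← conf_plus σ, plus_conf]
  by_cases h : s ∈ plus σ <;> simp [conf, h]

/-- An edge has exactly one end of type `true`; the boundary edges are sorted according to whether
this end lies in S. -/
theorem sum_disagree (S : Finset (Site (ZMod L))) :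
    (∑ q ∈ (Finset.univ.filter fun f : Site (ZMod L) => f.2 = true) ×ˢ
        (Finset.univ : Finset (Fin 3)), if (q.1 ∈ S ↔ nb q.1 q.2 ∈ S) then 0 else 1) = per S := by
  rw [Finset.sum_product_right, per_eq_classes]
  refine Finset.sum_congr rfl fun i _ => ?_
  have h1 : (S.filter fun f => f.2 = false ∧ nb f i ∉ S).card =
      ((Finset.univ.filter fun f : Site (ZMod L) => f.2 = true).filter
        fun f => f ∉ S ∧ nb f i ∈ S).card := by
    refine Finset.card_bij' (fun f _ => nb f i) (fun f _ => nb f i) ?_ ?_ ?_ ?_ <;>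
      simp +contextual [nb_snd]
  have h2 : (S.filter fun f => f.2 = true ∧ nb f i ∉ S).card =
      ((Finset.univ.filter fun f : Site (ZMod L) => f.2 = true).filter
        fun f => f ∈ S ∧ nb f i ∉ S).card := by
    congr 1
    ext f
    simp only [Finset.mem_filter, Finset.mem_univ, true_and]
    tauto
  rw [h1, h2, Finset.card_filter, Finset.card_filter, ← Finset.sum_add_distrib]
  refine Finset.sum_congr rfl fun f _ => ?_
  by_cases a : f ∈ S <;> by_cases b : nb f i ∈ S <;> simp [a, b]

theorem hamiltonian_eq (hL : 2 ≤ L) (J h : ℝ) (σ : Config L) :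
    hamiltonian J h σ = hamiltonian J h (allMinus L) + energy J h (plus σ) := by
  have key : ∀ σ : Config L, hamiltonian J h σ =
      -(J / 2) * (∑ q ∈ (Finset.univ.filter fun f : Site (ZMod L) => f.2 = true) ×ˢ
        (Finset.univ : Finset (Fin 3)), (1 : ℝ)) + (h / 2) * (∑ s : Site (ZMod L), (1 : ℝ)) +
        energy J h (plus σ) := by
    intro σ
    rw [hamiltonian, sum_edgeFinset hL]
    have h1 : ∀ q : Site (ZMod L) × Fin 3,
        (Sym2.map (fun s => ((σ s : ℤ) : ℝ)) s(q.1, nb q.1 q.2)).mul =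
          1 - 2 * ((if (q.1 ∈ plus σ ↔ nb q.1 q.2 ∈ plus σ) then 0 else 1 : ℕ) : ℝ) := by
      intro q
      rw [Sym2.map_mk, Sym2.mul_mk, spin_eq, spin_eq]
      by_cases a : q.1 ∈ plus σ <;> by_cases b : nb q.1 q.2 ∈ plus σ <;>
        simp only [a, b] <;> norm_num
    have h2 : ∀ s : Site (ZMod L), ((σ s : ℤ) : ℝ) = 2 * (if s ∈ plus σ then 1 else 0) - 1 := by
      intro s
      rw [spin_eq]
      split_ifs <;> norm_num
    rw [Finset.sum_congr rfl fun q _ => h1 q, Finset.sum_congr rfl fun s _ => h2 s]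
    rw [Finset.sum_sub_distrib, Finset.sum_sub_distrib, ← Finset.mul_sum, ← Finset.mul_sum,
      ← Nat.cast_sum, sum_disagree, Finset.sum_ite_mem, Finset.univ_inter, energy]
    simp only [Finset.sum_const, nsmul_eq_mul, mul_one]
    ring
  rw [key σ, key (allMinus L), plus_allMinus]
  simp [energy]

end Torus

/-! ### Rotations and bars -/

/-- The rotation of the plane by `π / 3` around the origin. -/
def rot (f : Site ℤ) : Site ℤ :=
  if f.2 then ((-f.1.2 - 1, f.1.1 + f.1.2), false) else ((-f.1.2 - 1, f.1.1 + f.1.2 + 1), true)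

theorem rot_nb (f : Site ℤ) (i : Fin 3) : rot (nb f i) = nb (rot f) (i + 2) := by
  obtain ⟨⟨x, y⟩, t⟩ := f
  fin_cases i <;> cases t <;> simp [rot, nb] <;> first | ring1 | (constructor <;> ring1)

theorem top_rot (f : Site ℤ) (k : Fin 6) : top (rot f) (k + 1) = top f k := by
  obtain ⟨⟨x, y⟩, t⟩ := f
  fin_cases k <;> cases t <;> simp [rot, top, strip] <;> ring

theorem rot_surjective : Function.Surjective rot := by
  rintro ⟨⟨x, y⟩, t⟩
  cases t
  · exact ⟨((x + y + 1, -x - 1), true), by simp [rot]⟩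
  · exact ⟨((x + y, -x - 1), false), by simp [rot]; ring⟩

theorem rot_injective : Function.Injective rot := by
  rintro ⟨⟨x, y⟩, t⟩ ⟨⟨x', y'⟩, t'⟩ h
  cases t <;> cases t' <;> simp [rot] at h ⊢ <;> omega

theorem rot_mem_hexFin {b : Fin 6 → ℤ} {f : Site ℤ} :
    rot f ∈ hexFin b ↔ f ∈ hexFin fun k => b (k + 1) := by
  rw [mem_hexFin, mem_hexFin]
  constructor
  · intro h k
    rw [← top_rot]
    exact h _
  · intro h k
    have := h (k - 1)
    rwa [sub_add_cancel, ← top_rot, sub_add_cancel] at this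

/-- The bounds of the hexagon with one more row of faces on the side `k`. -/
def grow (b : Fin 6 → ℤ) (k : Fin 6) : Fin 6 → ℤ := Function.update b k (b k + 1)

theorem le_grow (b : Fin 6 → ℤ) (k k' : Fin 6) : b k' ≤ grow b k k' := by
  by_cases h : k' = k
  · subst h
    simp [grow]
  · simp [grow, h]

/-- The faces `f n` form the row outside of the side `k` of the hexagon, `n = 0` being the first
face of the bar on that side. -/
structure IsBar (b : Fin 6 → ℤ) (k : Fin 6) (f : ℤ → Site ℤ) (i₀ i₁ i₂ : Fin 3) : Prop where
  ne₀₁ : i₀ ≠ i₁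
  ne₀₂ : i₀ ≠ i₂
  ne₁₂ : i₁ ≠ i₂
  odd : ∀ j, f (2 * j + 1) = nb (f (2 * j)) i₀
  even : ∀ j, f (2 * j + 2) = nb (f (2 * j + 1)) i₁
  inj : Function.Injective f
  mem : ∀ g, (g ∈ hexFin (grow b k) ∧ g ∉ hexFin b) ↔
    ∃ n, 0 ≤ n ∧ n < 2 * sideLength b k - 1 ∧ f n = g
  below : ∀ j, 0 ≤ j → j < sideLength b k → nb (f (2 * j)) i₂ ∈ hexFin b
  above : ∀ j, nb (f (2 * j + 1)) i₂ ∉ hexFin (grow b k)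
  notMem : ∀ n, f n ∉ hexFin b

theorem exists_isBar_zero {b : Fin 6 → ℤ} (hb : ∀ k, 0 ≤ sideLength b k)
    (hne : (hexFin b).Nonempty) : ∃ f i₀ i₁ i₂, IsBar b 0 f i₀ i₁ i₂ := by
  have hw : 1 ≤ b 0 + b 3 := by
    obtain ⟨g, hg⟩ := hne
    have h0 := mem_hexFin.1 hg 0
    have h3 := mem_hexFin.1 hg 3
    simp [top] at h0 h3
    omega
  rw [forall_sideLength_nonneg_iff] at hb
  -- The bar on side 0 lies in the strip of index `b 0` and starts at height `-b 5`. Even positions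
  -- have type `true` and rest on the side through direction 1; odd positions point outwards.
  refine ⟨fun n => ((b 0, -b 5 + n / 2), decide (n % 2 = 0)), 0, 2, 1, by decide, by decide,
    by decide, fun j => ?_, fun j => ?_, fun m n h => ?_, ?_, fun j h0 h1 => ?_, fun j => ?_,
    fun n h => ?_⟩
  · have h1 : (2 * j + 1) / 2 = j := by omega
    have h2 : (2 * j + 1) % 2 = 1 := by omega
    simp [nb, h1, h2]
  · have h1 : (2 * j + 1) / 2 = j := by omega
    have h2 : (2 * j + 1) % 2 = 1 := by omega
    have h3 : (2 * j + 2) / 2 = j + 1 := by omega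
    have h4 : (2 * j + 2) % 2 = 0 := by omega
    simp [nb, h1, h2, h3, h4]
    ring
  · simp only [Prod.mk.injEq, decide_eq_decide] at h
    omega
  · have e : (-1 : Fin 6) = 5 := rfl
    rintro ⟨⟨x, y⟩, t⟩
    rw [mem_hexFin, mem_hexFin]
    constructor
    · rintro ⟨h1, h2⟩
      have hx : x = b 0 := by
        by_contra hne
        refine h2 fun k => ?_
        have h3 := h1 k
        by_cases hk : k = 0
        · subst hk
          simp [grow, top, strip] at h3 ⊢
          omega
        · simpa [grow, hk] using h3
      subst hx
      have h31 := h1 1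
      have h35 := h1 5
      cases t
      · refine ⟨2 * (y + b 5) + 1, ?_⟩
        simp [grow, top, strip, sideLength, e] at h31 h35 ⊢
        omega
      · refine ⟨2 * (y + b 5), ?_⟩
        simp [grow, top, strip, sideLength, e] at h31 h35 ⊢
        omega
    · rintro ⟨n, h0, h1, h2⟩
      simp only [Prod.mk.injEq] at h2
      obtain ⟨⟨rfl, rfl⟩, rfl⟩ := h2
      simp [sideLength, e] at h1
      rcases Int.emod_two_eq_zero_or_one n with h | h <;>
      · constructor
        · simp [Fin.forall_fin_succ, grow, top, strip, h]
          omega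
        · intro h3
          have := h3 0
          simp [top, strip] at this
  · have e : (-1 : Fin 6) = 5 := rfl
    rw [mem_hexFin]
    simp [sideLength, e] at h1
    simp [Fin.forall_fin_succ, top, strip, nb]
    omega
  · rw [mem_hexFin]
    intro h
    have h1 := h 0
    have h2 : (2 * j + 1) % 2 = 1 := by omega
    simp [top, strip, nb, grow, h2] at h1
  · rw [mem_hexFin] at h
    have h1 := h 0
    simp [top, strip] at h1

theorem IsBar.rot {b : Fin 6 → ℤ} {k : Fin 6} {f : ℤ → Site ℤ} {i₀ i₁ i₂ : Fin 3}
    (h : IsBar (fun k => b (k + 1)) k f i₀ i₁ i₂) :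
    IsBar b (k + 1) (fun n => rot (f n)) (i₀ + 2) (i₁ + 2) (i₂ + 2) := by
  have hg : (fun j => grow b (k + 1) (j + 1)) = grow (fun k => b (k + 1)) k := by
    funext j
    by_cases hj : j = k
    · subst hj
      simp [grow]
    · simp [grow, hj]
  have hs : sideLength b (k + 1) = sideLength (fun k => b (k + 1)) k := by
    simp only [sideLength]
    rw [add_sub_cancel_right, sub_add_cancel]
  refine ⟨fun e => h.ne₀₁ (add_right_cancel e), fun e => h.ne₀₂ (add_right_cancel e),
    fun e => h.ne₁₂ (add_right_cancel e), fun j => ?_, fun j => ?_,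
    rot_injective.comp h.inj, fun g => ?_, fun j h0 h1 => ?_, fun j => ?_, fun n => ?_⟩
  · rw [h.odd, rot_nb]
  · rw [h.even, rot_nb]
  · obtain ⟨g, rfl⟩ := rot_surjective g
    rw [rot_mem_hexFin, rot_mem_hexFin, hg, h.mem, hs]
    simp only [rot_injective.eq_iff]
  · rw [← rot_nb, rot_mem_hexFin]
    exact h.below j h0 (hs ▸ h1)
  · rw [← rot_nb, rot_mem_hexFin, hg]
    exact h.above j
  · rw [rot_mem_hexFin]
    exact h.notMem n

/-- The rotation by π / 3 carries a bar on the side k to one on the side k + 1, so the explicit bar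
on side 0 suffices. -/
theorem exists_isBar (k : Fin 6) : ∀ b : Fin 6 → ℤ, (∀ k, 0 ≤ sideLength b k) →
    (hexFin b).Nonempty → ∃ f i₀ i₁ i₂, IsBar b k f i₀ i₁ i₂ := by
  have step : ∀ k : Fin 6, (∀ b : Fin 6 → ℤ, (∀ k, 0 ≤ sideLength b k) →
      (hexFin b).Nonempty → ∃ f i₀ i₁ i₂, IsBar b k f i₀ i₁ i₂) →
      ∀ b : Fin 6 → ℤ, (∀ k, 0 ≤ sideLength b k) →
      (hexFin b).Nonempty → ∃ f i₀ i₁ i₂, IsBar b (k + 1) f i₀ i₁ i₂ := by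
    intro k ih b hb hne
    obtain ⟨f, i₀, i₁, i₂, h⟩ := ih (fun k => b (k + 1)) (fun j => by
      have := hb (j + 1)
      simp only [sideLength] at this ⊢
      rw [add_sub_cancel_right] at this
      rwa [sub_add_cancel]) (by
      obtain ⟨g, hg⟩ := hne
      obtain ⟨g, rfl⟩ := rot_surjective g
      exact ⟨g, rot_mem_hexFin.1 hg⟩)
    exact ⟨_, _, _, _, h.rot⟩
  have h0 := fun b hb hne => exists_isBar_zero (b := b) hb hne
  have h1 := step 0 h0
  have h2 := step 1 h1
  have h3 := step 2 h2
  have h4 := step 3 h3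
  have h5 := step 4 h4
  fin_cases k
  exacts [h0, h1, h2, h3, h4, h5]

/-! ### Incidences between the faces of a bar -/

namespace IsBar

variable {b : Fin 6 → ℤ} {k : Fin 6} {f : ℤ → Site ℤ} {i₀ i₁ i₂ : Fin 3}

theorem nb_even_zero (h : IsBar b k f i₀ i₁ i₂) (j : ℤ) : nb (f (2 * j)) i₀ = f (2 * j + 1) :=
  (h.odd j).symm

theorem nb_even_one (h : IsBar b k f i₀ i₁ i₂) (j : ℤ) : nb (f (2 * j)) i₁ = f (2 * j - 1) := by
  have := h.even (j - 1)
  rw [show 2 * (j - 1) + 2 = 2 * j by ring, show 2 * (j - 1) + 1 = 2 * j - 1 by ring] at this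
  rw [this, nb_nb]

theorem nb_odd_zero (h : IsBar b k f i₀ i₁ i₂) (j : ℤ) : nb (f (2 * j + 1)) i₀ = f (2 * j) := by
  rw [h.odd, nb_nb]

theorem nb_odd_one (h : IsBar b k f i₀ i₁ i₂) (j : ℤ) : nb (f (2 * j + 1)) i₁ = f (2 * j + 2) :=
  (h.even j).symm

theorem index_cases (h : IsBar b k f i₀ i₁ i₂) (i : Fin 3) : i = i₀ ∨ i = i₁ ∨ i = i₂ := by
  have := h.ne₀₁
  have := h.ne₀₂
  have := h.ne₁₂
  omega

theorem even_of_deg (h : IsBar b k f i₀ i₁ i₂) {n : ℤ} (hn : 1 ≤ deg (hexFin b) (f n)) :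
    ∃ j, n = 2 * j := by
  rcases Int.even_or_odd' n with ⟨j, rfl | rfl⟩
  · exact ⟨j, rfl⟩
  · exfalso
    obtain ⟨i, hi⟩ := exists_of_one_le_deg hn
    rcases h.index_cases i with rfl | rfl | rfl
    · rw [h.nb_odd_zero] at hi
      exact h.notMem _ hi
    · rw [h.nb_odd_one] at hi
      exact h.notMem _ hi
    · exact h.above j (hexFin_mono (le_grow b k) hi)

theorem adj_succ (h : IsBar b k f i₀ i₁ i₂) (n : ℤ) : (hexLattice ℤ).Adj (f n) (f (n + 1)) := by
  rw [hexLattice_adj_iff]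
  rcases Int.even_or_odd' n with ⟨j, rfl | rfl⟩
  · exact ⟨i₀, h.odd j⟩
  · refine ⟨i₁, ?_⟩
    rw [show 2 * j + 1 + 1 = 2 * j + 2 by ring]
    exact h.even j

theorem dist_add_two (h : IsBar b k f i₀ i₁ i₂) (n : ℤ) :
    (hexLattice ℤ).dist (f n) (f (n + 2)) = 2 := by
  have h1 := h.adj_succ n
  have h2 := h.adj_succ (n + 1)
  rw [show n + 1 + 1 = n + 2 by ring] at h2
  have hle : (hexLattice ℤ).dist (f n) (f (n + 2)) ≤ 2 :=
    SimpleGraph.dist_le (SimpleGraph.Walk.cons h1 (SimpleGraph.Walk.cons h2 .nil))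
  have hr : (hexLattice ℤ).Reachable (f n) (f (n + 2)) := h1.reachable.trans h2.reachable
  have h0 : (hexLattice ℤ).dist (f n) (f (n + 2)) ≠ 0 := by
    rw [Ne, hr.dist_eq_zero_iff, h.inj.eq_iff]
    omega
  have hne : (hexLattice ℤ).dist (f n) (f (n + 2)) ≠ 1 := by
    rw [Ne, SimpleGraph.dist_eq_one_iff_adj]
    intro h3
    obtain ⟨i, hi⟩ := (hexLattice_adj_iff _ _).1 h1
    obtain ⟨j, hj⟩ := (hexLattice_adj_iff _ _).1 h2
    obtain ⟨l, hl⟩ := (hexLattice_adj_iff _ _).1 h3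
    have e1 := congrArg Prod.snd hi
    have e2 := congrArg Prod.snd hj
    have e3 := congrArg Prod.snd hl
    rw [nb_snd] at e1 e2 e3
    rw [e2, e1] at e3
    simp at e3
  omega

theorem attached (h : IsBar b k f i₀ i₁ i₂) {j : ℤ} (h0 : 0 ≤ j) (h1 : j < sideLength b k) :
    IsAttachedTo (f (2 * j)) (hexagon b) := by
  refine ⟨_, ?_, (hexLattice_adj_iff _ _).2 ⟨i₂, rfl⟩⟩
  rw [← coe_hexFin]
  exact h.below j h0 h1

end IsBar

theorem sideBar_eq (b : Fin 6 → ℤ) (k : Fin 6) {g : Site ℤ} :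
    g ∈ sideBar b k ↔ g ∈ hexFin (grow b k) ∧ g ∉ hexFin b := by
  rw [sideBar, ← coe_hexFin, ← coe_hexFin]
  rfl

/-- Three faces of a bar, attached one after the other to a hexagon, the last one by two edges:
the first two form an elementary rhombus or are at distance two from one another. -/
theorem rhombus_or_dist_two {b : Fin 6 → ℤ} {k : Fin 6} (hb : ∀ k, 0 ≤ sideLength b k)
    (hne : (hexFin b).Nonempty) {x g y : Site ℤ} (hx : x ∈ sideBar b k) (hg : g ∈ sideBar b k)
    (hy : y ∈ sideBar b k)
    (hxg : x ≠ g) (dx : 1 ≤ deg (hexFin b) x) (dg : 1 ≤ deg (insert x (hexFin b)) g)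
    (dy : 2 ≤ deg (insert g (insert x (hexFin b))) y) :
    (hexLattice ℤ).Adj x g ∨ IsAttachedTo x (hexagon b) ∧ IsAttachedTo g (hexagon b) ∧
      (hexLattice ℤ).dist x g = 2 := by
  obtain ⟨f, i₀, i₁, i₂, h⟩ := exists_isBar k b hb hne
  rw [sideBar_eq] at hx hg hy
  have hsub : insert g (insert x (hexFin b)) ⊆ hexFin (grow b k) := by
    intro u hu
    rw [Finset.mem_insert, Finset.mem_insert] at hu
    rcases hu with rfl | rfl | hu
    · exact hg.1
    · exact hx.1
    · exact hexFin_mono (le_grow b k) hu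
  obtain ⟨n, hn0, hn1, rfl⟩ := (h.mem x).1 hx
  obtain ⟨l, hl0, hl1, rfl⟩ := (h.mem g).1 hg
  obtain ⟨m, hm0, hm1, rfl⟩ := (h.mem y).1 hy
  obtain ⟨j, rfl⟩ := h.even_of_deg dx
  have hmem : ∀ r, f r ∈ insert (f l) (insert (f (2 * j)) (hexFin b)) → r = l ∨ r = 2 * j := by
    intro r hr
    rw [Finset.mem_insert, Finset.mem_insert, h.inj.eq_iff, h.inj.eq_iff] at hr
    rcases hr with hr | hr | hr
    · exact Or.inl hr
    · exact Or.inr hr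
    · exact absurd hr (h.notMem r)
  obtain ⟨i, i', hii, hi, hi'⟩ := exists_of_two_le_deg dy
  have hlj : l ≠ 2 * j := fun e => hxg (by rw [e])
  -- The face x has even index. If y is even, at most one of its two shared edges leads into the
  -- hexagon, so a bar neighbor of y, of odd index, is occupied; it is g, and as odd faces do not
  -- touch the hexagon, g touches x. If y is odd, its two bar neighbors are x and g.
  rcases Int.even_or_odd' m with ⟨m, rfl | rfl⟩
  · left
    have hl : l = 2 * m + 1 ∨ l = 2 * m - 1 := by
      have key : ∀ i, i ≠ i₂ → nb (f (2 * m)) i ∈ insert (f l) (insert (f (2 * j)) (hexFin b)) →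
          l = 2 * m + 1 ∨ l = 2 * m - 1 := by
        intro i hne hi
        rcases h.index_cases i with rfl | rfl | rfl
        · rw [h.nb_even_zero] at hi
          have := hmem _ hi
          omega
        · rw [h.nb_even_one] at hi
          have := hmem _ hi
          omega
        · exact absurd rfl hne
      by_cases e : i = i₂
      · exact key i' (fun e' => hii (e.trans e'.symm)) hi'
      · exact key i e hi
    obtain ⟨q, rfl⟩ : ∃ q, l = 2 * q + 1 := by
      rcases hl with rfl | rfl
      · exact ⟨m, rfl⟩
      · exact ⟨m - 1, by ring⟩
    obtain ⟨i, hi⟩ := exists_of_one_le_deg dg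
    have hx' : nb (f (2 * q + 1)) i = f (2 * j) := by
      rw [Finset.mem_insert] at hi
      rcases hi with hi | hi
      · exact hi
      · exfalso
        rcases h.index_cases i with rfl | rfl | rfl
        · rw [h.nb_odd_zero] at hi
          exact h.notMem _ hi
        · rw [h.nb_odd_one] at hi
          exact h.notMem _ hi
        · exact h.above q (hexFin_mono (le_grow b k) hi)
    rw [SimpleGraph.adj_comm, hexLattice_adj_iff]
    exact ⟨i, hx'.symm⟩
  · right
    have hne : ∀ i, nb (f (2 * m + 1)) i ∈ insert (f l) (insert (f (2 * j)) (hexFin b)) →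
        i ≠ i₂ := by
      rintro i hi rfl
      exact h.above m (hsub hi)
    have h01 : (2 * m = l ∨ 2 * m = 2 * j) ∧ (2 * m + 2 = l ∨ 2 * m + 2 = 2 * j) := by
      have k0 : nb (f (2 * m + 1)) i₀ ∈ insert (f l) (insert (f (2 * j)) (hexFin b)) := by
        rcases h.index_cases i with rfl | rfl | rfl
        · exact hi
        · rcases h.index_cases i' with rfl | rfl | rfl
          · exact hi'
          · exact absurd rfl hii
          · exact absurd rfl (hne _ hi')
        · exact absurd rfl (hne _ hi)
      have k1 : nb (f (2 * m + 1)) i₁ ∈ insert (f l) (insert (f (2 * j)) (hexFin b)) := by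
        rcases h.index_cases i with rfl | rfl | rfl
        · rcases h.index_cases i' with rfl | rfl | rfl
          · exact absurd rfl hii
          · exact hi'
          · exact absurd rfl (hne _ hi')
        · exact hi
        · exact absurd rfl (hne _ hi)
      rw [h.nb_odd_zero] at k0
      rw [h.nb_odd_one] at k1
      exact ⟨hmem _ k0, hmem _ k1⟩
    have hl : l = 2 * (j + 1) ∨ l = 2 * (j - 1) := by omega
    refine ⟨h.attached (by omega) (by omega), ?_, ?_⟩
    · rcases hl with rfl | rfl
      · exact h.attached (by omega) (by omega)
      · exact h.attached (by omega) (by omega)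
    · rcases hl with rfl | rfl
      · have := h.dist_add_two (2 * j)
        rwa [show 2 * j + 2 = 2 * (j + 1) by ring] at this
      · have := h.dist_add_two (2 * (j - 1))
        rwa [show 2 * (j - 1) + 2 = 2 * j by ring, SimpleGraph.dist_comm] at this

/-! ### Crossing the critical area -/

/-- The relations between the side `L` of the torus, the perimeter `p` and the area `N` of the
critical quasi-regular hexagon, and the area `M` of this hexagon with one more bar. -/
structure Critical (L N p M : ℕ) : Prop where
  area_eq : 6 * N + 7 = p ^ 2
  seven_le : 7 ≤ p
  lt_six_mul : (p + 1) ^ 2 < 6 * M + 6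
  odd : N % 2 = 1
  even : M % 2 = 0
  le : N + 3 ≤ M
  cut : M + L * (p + 2) < 2 * L ^ 2
  width : p + 3 < 2 * L

/-- The bounds on the perimeter of a set of area at most `M` that result from the bound
`J (p + 2) - h (N + 2)` on its energy. -/
def Admissible {L : ℕ} (N p M : ℕ) (S : Finset (Site (ZMod L))) : Prop :=
  S.card ≤ M → per S ≤ p + 2 ∧ (S.card < N + 2 → per S ≤ p + 1)

/-- The area and the perimeter of the critical quasi-regular hexagon. -/
def IsCore {L : ℕ} (N p : ℕ) (Q : Finset (Site (ZMod L))) : Prop := Q.card = N ∧ per Q = p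

/-- A critical quasi-regular hexagon with one more face. -/
def IsCorePlus {L : ℕ} (N p : ℕ) (S : Finset (Site (ZMod L))) : Prop :=
  ∃ Q x, IsCore N p Q ∧ x ∉ Q ∧ S = insert x Q

/-- The area and the perimeter of a critical quasi-regular hexagon with one more bar. -/
def IsTarget {L : ℕ} (p M : ℕ) (T : Finset (Site (ZMod L))) : Prop := T.card = M ∧ per T = p + 1

/-- The set `S` has not yet crossed the gate. -/
def Subcritical {L : ℕ} (N p M : ℕ) (S : Finset (Site (ZMod L))) : Prop :=
  S.card < M ∧ (S.card ≤ N ∨ IsCorePlus N p S ∨ ∀ T, IsTarget p M T → ¬ S ⊆ T)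

/-- Of two neighbors of f, at least one lies in the same strip of any given direction, so f would
satisfy all six inequalities. -/
theorem deg_hexFin_le {b : Fin 6 → ℤ} {f : Site ℤ} (hf : f ∉ hexFin b) : deg (hexFin b) f ≤ 1 := by
  by_contra! h
  obtain ⟨i, j, hij, hi, hj⟩ := exists_of_two_le_deg h
  rw [mem_hexFin] at hi hj
  refine hf (mem_hexFin.2 fun k => ?_)
  have s0 := strip_nb_of_ne f hij 0
  have s1 := strip_nb_of_ne f hij 1
  have s2 := strip_nb_of_ne f hij 2
  have hi := hi k
  have hj := hj k
  fin_cases k <;> simp [top] at hi hj ⊢ <;> omega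

theorem eq_of_le_of_sum_le {b b' : Fin 6 → ℤ} (h : ∀ k, b k ≤ b' k) (hs : ∑ k, b' k ≤ ∑ k, b k) :
    b = b' := by
  have := (Finset.sum_eq_sum_iff_of_le fun k (_ : k ∈ Finset.univ) => h k).1
    (le_antisymm (Finset.sum_le_sum fun k _ => h k) hs)
  exact funext fun k => this k (Finset.mem_univ k)

theorem exists_grow {b b' : Fin 6 → ℤ} (h : ∀ k, b k ≤ b' k)
    (hs : ∑ k, b' k = ∑ k, b k + 1) : ∃ k, b' = grow b k := by
  obtain ⟨k, hk⟩ : ∃ k, b k < b' k := by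
    by_contra! h'
    have := Finset.sum_le_sum fun k (_ : k ∈ Finset.univ) => h' k
    omega
  refine ⟨k, (eq_of_le_of_sum_le (fun k' => ?_) ?_).symm⟩
  · by_cases e : k' = k
    · subst e
      simp [grow]
      omega
    · simpa [grow, e] using h k'
  · rw [grow, Finset.sum_update_of_mem (Finset.mem_univ k), hs,
      ← Finset.add_sum_erase _ b (Finset.mem_univ k), Finset.sdiff_singleton_eq_erase]
    omega

namespace Critical

variable {L N p M : ℕ}

theorem one_le (hc : Critical L N p M) : 1 ≤ N := by
  have := hc.area_eq
  have := hc.seven_le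
  nlinarith

theorem odd_p (hc : Critical L N p M) : p % 2 = 1 := by
  have h := hc.area_eq
  rcases Nat.even_or_odd' p with ⟨q, rfl | rfl⟩
  · have : (2 * q) ^ 2 = 2 * (2 * q ^ 2) := by ring
    omega
  · omega

theorem two_le [NeZero L] (hc : Critical L N p M) : 2 ≤ L := by
  have := hc.width
  have := hc.seven_le
  omega

/-! ### Extremal planar sets of areas N and M -/

section Plane

variable {P : Finset (Site ℤ)}

theorem lt_sum_bd (hc : Critical L N p M) (hP : N + 1 ≤ P.card) : (p : ℤ) + 1 ≤ ∑ k, bd P k := by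
  by_contra! h
  have hne : P.Nonempty := Finset.card_pos.1 (by omega)
  have := card_hexFin_le (sideLength_bd_nonneg hne) hc.area_eq hc.seven_le (by omega)
  have := Finset.card_le_card (subset_hexFin_bd P)
  omega

theorem sum_bd_le (hc : Critical L N p M) (hP : N + 1 ≤ P.card) (hp : per P ≤ p + 2) :
    ∑ k, bd P k ≤ per P := by
  have h1 := hc.area_eq
  have h2 := hc.seven_le
  refine sum_bd_le_per (Finset.card_pos.1 (by omega)) ?_
  zify at *
  nlinarith

/-- The enclosing hexagon has perimeter at most p and hence area at most N, so the set fills it. -/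
theorem eq_hexFin_of_core (hc : Critical L N p M) (hP : P.card = N) (hp : per P = p) :
    P = hexFin (bd P) ∧ ∑ k, bd P k = p := by
  have h1 := hc.area_eq
  have h2 := hc.seven_le
  have h3 := hc.one_le
  have hne : P.Nonempty := Finset.card_pos.1 (by omega)
  have h4 : ∑ k, bd P k ≤ per P := by
    refine sum_bd_le_per hne ?_
    zify at *
    nlinarith
  rw [hp] at h4
  refine ⟨Finset.eq_of_subset_of_card_le (subset_hexFin_bd P) ?_, ?_⟩
  · rw [hP]
    exact card_hexFin_le (sideLength_bd_nonneg hne) hc.area_eq hc.seven_le h4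
  · have h5 := six_mul_card_le_sum_bd hne
    have h6 := sum_nonneg_of_sideLength (sideLength_bd_nonneg hne)
    by_contra h7
    have h8 : ∑ k, bd P k ≤ p - 1 := by omega
    rw [hP] at h5
    zify at *
    nlinarith

/-- By (p + 1)² < 6 M + 6, no hexagon of perimeter p + 1 has area larger than M. -/
theorem eq_hexFin_of_target (hc : Critical L N p M) (hP : P.card = M) (hp : per P = p + 1) :
    P = hexFin (bd P) ∧ ∑ k, bd P k = p + 1 := by
  have h1 := hc.le
  have hne : P.Nonempty := Finset.card_pos.1 (by omega)
  have h4 := hc.sum_bd_le (P := P) (by omega) (by omega)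
  have h5 := hc.lt_sum_bd (P := P) (by omega)
  rw [hp] at h4
  have h6 : ∑ k, bd P k = p + 1 := by push_cast at h4; omega
  refine ⟨Finset.eq_of_subset_of_card_le (subset_hexFin_bd P) ?_, h6⟩
  have h7 := six_mul_card_hexFin_le (sideLength_bd_nonneg hne)
  have h8 := hc.lt_six_mul
  rw [h6] at h7
  rw [hP]
  zify at *
  omega

end Plane

theorem sub_one_ne_self (k : Fin 6) : k - 1 ≠ k := by revert k; decide

theorem add_one_ne_self (k : Fin 6) : k + 1 ≠ k := by revert k; decide

/-- A critical hexagon in a target hexagon: the difference is the bar on a longest side. -/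
theorem exists_longest_side (hc : Critical L N p M) {Q T : Finset (Site ℤ)} (hQT : Q ⊆ T)
    (cQ : Q.card = N) (pQ : per Q = p) (cT : T.card = M) (pT : per T = p + 1) :
    ∃ k, bd T = grow (bd Q) k ∧ (∀ k, 0 ≤ sideLength (bd Q) k) ∧ (hexFin (bd Q)).Nonempty ∧
      IsLongestSide (bd Q) k ∧ IsQuasiRegular (bd Q) := by
  obtain ⟨eQ, sQ⟩ := hc.eq_hexFin_of_core cQ pQ
  obtain ⟨eT, sT⟩ := hc.eq_hexFin_of_target cT pT
  have hQne : Q.Nonempty := Finset.card_pos.1 (by rw [cQ]; exact hc.one_le)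
  have hTne : T.Nonempty := hQne.mono hQT
  obtain ⟨k, hk⟩ := exists_grow (bd_mono hQne hQT) (by rw [sQ, sT])
  have hβ0 := sideLength_bd_nonneg hQne
  have hT0 := sideLength_bd_nonneg hTne
  have hQcard : (hexFin (bd Q)).card = N := by rw [← eQ, cQ]
  have hTcard : (hexFin (grow (bd Q) k)).card = M := by rw [← hk, ← eT, cT]
  have hne : (hexFin (bd Q)).Nonempty := eQ ▸ hQne
  generalize bd Q = β at *
  have hl : 1 ≤ sideLength β k := by
    have h3 := hT0 k
    rw [hk] at h3
    simp only [sideLength, grow, Function.update_self, Function.update_of_ne (sub_one_ne_self k),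
      Function.update_of_ne (add_one_ne_self k)] at h3 ⊢
    omega
  have hM : ((hexFin (grow β k)).card : ℤ) = (hexFin β).card + 2 * sideLength β k - 1 :=
    (card_hexFin_update hβ0 hl).2
  rw [hTcard, hQcard] at hM
  refine ⟨k, hk, hβ0, hne, fun k' => ?_,
    isQuasiRegular_of_card hβ0 hc.area_eq hc.seven_le sQ hQcard⟩
  -- Growing the side k' also gives a hexagon of perimeter p + 1, whose area is at most M. The
  -- length of k' is therefore at most that of k; this is why the gate sits on a longest side.
  by_cases h3 : 1 ≤ sideLength β k'
  · obtain ⟨h4, h5⟩ := card_hexFin_update hβ0 h3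
    have h6 := six_mul_card_hexFin_le h4
    rw [Finset.sum_update_of_mem (Finset.mem_univ k')] at h6
    have h7 := Finset.add_sum_erase _ β (Finset.mem_univ k')
    rw [Finset.sdiff_singleton_eq_erase] at h6
    rw [show β k' + 1 + ∑ x ∈ Finset.univ.erase k', β x = p + 1 by omega] at h6
    have h8 := hc.lt_six_mul
    rw [hQcard] at h5
    zify at h8
    omega
  · omega

/-! ### Perimeter bounds on the torus and the moves near the gate -/

section Torus

variable [NeZero L] {S T Q : Finset (Site (ZMod L))}

theorem small (hc : Critical L N p M) (hS : S.card ≤ M) (hp : per S ≤ p + 2) :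
    S.card + L * per S < 2 * L ^ 2 := by
  have := hc.cut
  have := Nat.mul_le_mul_left L hp
  omega

theorem six_mul_card_le (hc : Critical L N p M) (hS : S.card ≤ M) (hp : per S ≤ p + 2) :
    6 * S.card ≤ per S ^ 2 :=
  six_mul_card_le_per_sq_of_small (hc.small hS hp)

theorem le_per (hc : Critical L N p M) (hS : S.card ≤ M) (hN : N ≤ S.card) : p ≤ per S := by
  by_contra! h
  have h1 := hc.six_mul_card_le hS (by omega)
  have h2 := hc.area_eq
  have h3 := hc.seven_le
  have h4 : per S ≤ p - 1 := by omega
  obtain ⟨q, rfl⟩ : ∃ q, p = q + 1 := ⟨p - 1, by omega⟩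
  rw [Nat.add_sub_cancel] at h4
  nlinarith

/-- At perimeter p the area is odd, so it would be at least N + 2, while 6 (N + 2) = p² + 5. -/
theorem add_one_le_per (hc : Critical L N p M) (hS : S.card ≤ M) (hN : N + 1 ≤ S.card) :
    p + 1 ≤ per S := by
  have h1 := hc.le_per hS (by omega)
  by_contra! h
  have h2 : per S = p := by omega
  have h3 := hc.six_mul_card_le hS (by omega)
  have h4 := hc.area_eq
  have h5 := per_mod_two S
  have h6 := hc.odd_p
  have h7 := hc.odd
  rw [h2] at h3 h5
  omega

theorem add_two_le_per (hc : Critical L N p M) (hS : S.card = N + 2) : p + 2 ≤ per S := by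
  have h0 := hc.le
  have h1 := hc.add_one_le_per (S := S) (by omega) (by omega)
  have h5 := per_mod_two S
  have h6 := hc.odd_p
  have h7 := hc.odd
  omega

/-- The value p + 2 is odd and thus excluded. This is the gain from observing paths at even areas
only. -/
theorem per_le_of_even (hc : Critical L N p M) (h : Admissible N p M S) (hS : S.card ≤ M)
    (he : S.card % 2 = 0) : per S ≤ p + 1 := by
  have h1 := h hS
  have h5 := per_mod_two S
  have h6 := hc.odd_p
  omega

theorem isCore_of_card (hc : Critical L N p M) (h : Admissible N p M S) (hS : S.card = N) :
    IsCore N p S := by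
  have h0 := hc.le
  have h1 := h (by omega)
  have h5 := per_mod_two S
  have h6 := hc.odd_p
  have h7 := hc.odd
  have := hc.le_per (S := S) (by omega) (by omega)
  exact ⟨hS, by omega⟩

theorem exists_offCut_insert (hc : Critical L N p M) (hT : IsTarget p M T) (w : Site (ZMod L)) :
    ∃ a b, ∀ g ∈ insert w T, OffCut a b g := by
  have h1 := two_mul_card_strip_le (hc.small (S := T) hT.1.le (by rw [hT.2]; omega))
  rw [hT.2] at h1
  have h2 := hc.width
  have key : ∀ k : Fin 3, ((insert w T).image (strip k)).card ≤ (T.image (strip k)).card + 1 := by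
    intro k
    rw [Finset.image_insert]
    exact Finset.card_insert_le _ _
  have k0 := key 0
  have k1 := key 1
  exact exists_offCut (by omega) (by omega)

theorem le_per_add_one (hc : Critical L N p M) (hS : S.card + 1 = N) : p ≤ per S + 1 := by
  by_contra! h
  have h1 := hc.le
  have h2 := hc.area_eq
  have h3 := hc.seven_le
  have i1 := hc.six_mul_card_le (S := S) (by omega) (by omega)
  have h4 : per S + 2 ≤ p := by omega
  nlinarith

/-- If a face `y` of the critical hexagon is removed from this hexagon with two more faces, and
the perimeter decreases, then the critical hexagon has been changed by a sliding face. -/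
theorem isCorePlus_of_slide (hc : Critical L N p M) (hQ : IsCore N p Q) {x g y : Site (ZMod L)}
    (hx : x ∉ Q) (hg : g ∉ insert x Q) (hy : y ∈ Q)
    (h1 : Admissible N p M (insert g (insert x Q)))
    (h2 : Admissible N p M ((insert g (insert x Q)).erase y)) :
    IsCorePlus N p ((insert g (insert x Q)).erase y) := by
  have hle := hc.le
  have hodd := hc.odd_p
  have harea := hc.area_eq
  have hseven := hc.seven_le
  have cQ := hQ.1
  have cx : (insert x Q).card = N + 1 := by rw [Finset.card_insert_of_notMem hx, cQ]
  have ct : (insert g (insert x Q)).card = N + 2 := by rw [Finset.card_insert_of_notMem hg, cx]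
  have hyt : y ∈ insert g (insert x Q) := by simp [hy]
  have cs : ((insert g (insert x Q)).erase y).card = N + 1 := by
    rw [Finset.card_erase_of_mem hyt, ct]
    rfl
  have p1 := (h1 (by omega)).1
  have p1' := hc.add_two_le_per ct
  have p2 := (h2 (by omega)).2 (by omega)
  have e1 := per_erase hyt
  have hxy : x ≠ y := fun e => hx (e ▸ hy)
  have hgx : g ≠ x := fun e => hg (by simp [e])
  have hgQ : g ∉ Q := fun e => hg (by simp [e])
  have hgy : g ≠ y := fun e => hgQ (e ▸ hy)
  have hS : (insert g (insert x Q)).erase y = insert g (insert x (Q.erase y)) := by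
    rw [Finset.erase_insert_of_ne hgy, Finset.erase_insert_of_ne hxy]
  have hsub : Q.erase y ⊆ (insert g (insert x Q)).erase y := by
    rw [hS]
    exact (Finset.subset_insert _ _).trans (Finset.subset_insert _ _)
  have d1 := deg_mono hsub y
  have e2 := per_erase hy
  have cE : (Q.erase y).card = N - 1 := by rw [Finset.card_erase_of_mem hy, cQ]
  have hN := hc.one_le
  have pE : p ≤ per (Q.erase y) + 1 := hc.le_per_add_one (by omega)
  have hQp := hQ.2
  have hxE : x ∉ Q.erase y := fun e => hx (Finset.mem_of_mem_erase e)
  have hgE : g ∉ Q.erase y := fun e => hgQ (Finset.mem_of_mem_erase e)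
  have hgxE : g ∉ insert x (Q.erase y) := by simp [hgx, hgQ]
  -- Removing y lowers the perimeter from p + 2, so y has at most one neighbor left. Hence Q without
  -- y has perimeter p - 1, and any face attached to it restores a core.
  have core : ∀ u, u ∉ Q.erase y → 1 ≤ deg (Q.erase y) u → IsCore N p (insert u (Q.erase y)) := by
    intro u hu hd
    have c1 : (insert u (Q.erase y)).card = N := by
      rw [Finset.card_insert_of_notMem hu, cE]
      omega
    have q1 := per_insert hu
    have q2 := hc.le_per (S := insert u (Q.erase y)) (by omega) (by omega)
    exact ⟨c1, by omega⟩
  rw [hS] at p2 ⊢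
  by_cases hd : 1 ≤ deg (Q.erase y) x
  · exact ⟨_, g, core x hxE hd, hgxE, rfl⟩
  -- If x is isolated from Q without y, the perimeter becomes p + 2, and g must share two edges to
  -- reduce it. Only one of them can be with x, so g attaches to the rest of Q.
  · have q1 := per_insert hxE
    have q2 := per_insert hgxE
    have hd2 : 2 ≤ deg (insert x (Q.erase y)) g := by omega
    obtain ⟨i, j, hij, hi, hj⟩ := exists_of_two_le_deg hd2
    rw [Finset.mem_insert] at hi hj
    have hd3 : 1 ≤ deg (Q.erase y) g := by
      rcases hi with hi | hi
      · rcases hj with hj | hj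
        · exact absurd (nb_injective hc.two_le g (hi.trans hj.symm)) hij
        · exact one_le_deg j hj
      · exact one_le_deg i hi
    refine ⟨_, x, core g hgE hd3, by simp [hgx.symm, hxE], ?_⟩
    rw [Finset.insert_comm]

theorem hasCluster_lift (a b : ZMod L) (S : Finset (Site (ZMod L))) :
    HasCluster (conf S) ((S.image (lift a b) : Finset (Site ℤ)) : Set (Site ℤ)) := by
  constructor
  · rw [Finset.coe_image]
    rintro _ ⟨u, -, rfl⟩ _ ⟨v, -, rfl⟩ huv
    rw [toTorus_lift, toTorus_lift] at huv
    rw [huv]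
  · rw [← coe_plus, plus_conf, ← Finset.coe_image, image_toTorus_image_lift]

/-- The gate: a critical quasi-regular hexagon with two more faces on a longest side, that are
adjacent or at distance two from one another. -/
theorem mem_gate_of_step (hc : Critical L N p M) (hQ : IsCore N p Q) {x g y : Site (ZMod L)}
    (hx : x ∉ Q) (hg : g ∉ insert x Q) (hy : y ∉ insert g (insert x Q))
    (h0 : Admissible N p M (insert x Q)) (h1 : Admissible N p M (insert g (insert x Q)))
    (h2 : Admissible N p M (insert y (insert g (insert x Q))))
    (hT : IsTarget p M T) (hsub : insert y (insert g (insert x Q)) ⊆ T) :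
    conf (insert g (insert x Q)) ∈ canonicalConfigs L (N + 2) ∪ defectiveConfigs L (N + 2) := by
  have hle := hc.le
  have cQ := hQ.1
  have cx : (insert x Q).card = N + 1 := by rw [Finset.card_insert_of_notMem hx, cQ]
  have ct : (insert g (insert x Q)).card = N + 2 := by rw [Finset.card_insert_of_notMem hg, cx]
  have cs : (insert y (insert g (insert x Q))).card = N + 3 := by
    rw [Finset.card_insert_of_notMem hy, ct]
  have p0 := (h0 (by omega)).2 (by omega)
  have p1 := (h1 (by omega)).1
  have p1' := hc.add_two_le_per ct
  have p0' := hc.add_one_le_per (S := insert x Q) (by omega) (by omega)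
  have p2 := hc.per_le_of_even h2 (by omega) (by rw [cs]; have := hc.odd; omega)
  have hQp := hQ.2
  -- At areas N, N + 1, N + 2, N + 3 the perimeters are p, p + 1, p + 2 and at most p + 1. These
  -- values dictate how the three faces are attached.
  have dx : 1 ≤ deg Q x := by
    have := per_insert hx
    omega
  have dg : 1 ≤ deg (insert x Q) g := by
    have := per_insert hg
    omega
  have dy : 2 ≤ deg (insert g (insert x Q)) y := by
    have := per_insert hy
    omega
  obtain ⟨a, b, hab'⟩ := hc.exists_offCut_insert hT x
  have hab : ∀ g ∈ T, OffCut a b g := fun g hg =>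
    hab' g (Finset.mem_insert_of_mem hg)
  have hyT : y ∈ T := hsub (by simp)
  have hgT : g ∈ T := hsub (by simp)
  have hxT : x ∈ T := hsub (by simp)
  have hS2 : insert g (insert x Q) ⊆ T := (Finset.subset_insert _ _).trans hsub
  have hS1 : insert x Q ⊆ T := (Finset.subset_insert _ _).trans hS2
  have hS0 : Q ⊆ T := (Finset.subset_insert _ _).trans hS1
  have oQ : ∀ g ∈ Q, OffCut a b g := fun g hg =>
    hab g (hS0 hg)
  have cQ' := (card_image_lift a b Q).trans cQ
  have pQ' := (per_image_lift oQ).trans hQp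
  have cT' := (card_image_lift a b T).trans hT.1
  have pT' := (per_image_lift hab).trans hT.2
  obtain ⟨eQ, sQ⟩ := hc.eq_hexFin_of_core cQ' pQ'
  obtain ⟨eT, sT⟩ := hc.eq_hexFin_of_target cT' pT'
  obtain ⟨k, hk, hβ0, hne, hlong, hquasi⟩ :=
    hc.exists_longest_side (Finset.image_subset_image hS0) cQ' pQ' cT' pT'
  rw [hk] at eT
  generalize bd (Q.image (lift a b)) = β at *
  have hmemT : ∀ u ∈ T, lift a b u ∈ hexFin (grow β k) := by
    intro u hu
    rw [← eT]
    exact Finset.mem_image_of_mem _ hu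
  have hnotQ : ∀ u, u ∉ Q → lift a b u ∉ hexFin β := by
    intro u hu h
    rw [← eQ, (lift_injective a b).mem_finset_image] at h
    exact hu h
  have hgQ : g ∉ Q := fun e => hg (by simp [e])
  have hyQ : y ∉ Q := fun e => hy (by simp [e])
  have bx := (sideBar_eq β k).2 ⟨hmemT x hxT, hnotQ x hx⟩
  have bg := (sideBar_eq β k).2 ⟨hmemT g hgT, hnotQ g hgQ⟩
  have bY := (sideBar_eq β k).2 ⟨hmemT y hyT, hnotQ y hyQ⟩
  have ix : (insert x Q).image (lift a b) = insert (lift a b x) (hexFin β) := by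
    rw [Finset.image_insert, ← eQ]
  have ig : (insert g (insert x Q)).image (lift a b) =
      insert (lift a b g) (insert (lift a b x) (hexFin β)) := by
    rw [Finset.image_insert, ix]
  have key := rhombus_or_dist_two hβ0 hne bx bg bY
    (fun e => hg (by rw [lift_injective a b e]; simp))
    (by rw [← eQ, deg_image_lift (hab x hxT) oQ]; exact dx)
    (by rw [← ix, deg_image_lift (hab g hgT) fun u hu => hab u (hS1 hu)]; exact dg)
    (by rw [← ig, deg_image_lift (hab y hyT) fun u hu => hab u (hS2 hu)]; exact dy)
  have hset : (((insert g (insert x Q)).image (lift a b) : Finset (Site ℤ)) : Set (Site ℤ)) =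
      hexagon β ∪ {lift a b x, lift a b g} := by
    rw [ig, ← coe_hexFin]
    ext u
    simp
    tauto
  have hcl : HasCluster (conf (insert g (insert x Q))) (hexagon β ∪ {lift a b x, lift a b g}) := by
    rw [← hset]
    exact hasCluster_lift _ _ _
  have hncard : (hexagon β ∪ {lift a b x, lift a b g}).ncard = N + 2 := by
    rw [← hset, Set.ncard_coe_finset, card_image_lift, ct]
  rcases key with h | ⟨h3, h4, h5⟩
  · exact Or.inl ⟨_, ⟨β, k, _, _, hquasi, hlong, bx, bg, h, rfl⟩, hncard, hcl⟩
  · exact Or.inr ⟨_, ⟨β, k, _, _, hquasi, hlong, bx, bg, h3, h4, h5, rfl⟩, hncard, hcl⟩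

variable {A B C : Finset (Site (ZMod L))}

/-- An area above N already needs an enclosing hexagon of perimeter p + 1, so A spans all of the
target. -/
theorem bd_lift_eq (hc : Critical L N p M) (hT : IsTarget p M T) {a b : ZMod L}
    (hab : ∀ g ∈ T, OffCut a b g) (hAT : A ⊆ T) (hA : N + 1 ≤ A.card) :
    bd (A.image (lift a b)) = bd (T.image (lift a b)) ∧
      T.image (lift a b) = hexFin (bd (T.image (lift a b))) := by
  obtain ⟨eT, sT⟩ := hc.eq_hexFin_of_target (P := T.image (lift a b))
    (by rw [card_image_lift, hT.1]) (by rw [per_image_lift hab, hT.2])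
  have hcard : N + 1 ≤ (A.image (lift a b)).card := by rwa [card_image_lift]
  refine ⟨eq_of_le_of_sum_le (bd_mono (Finset.card_pos.1 (by omega))
    (Finset.image_subset_image hAT)) ?_, eT⟩
  rw [sT]
  exact hc.lt_sum_bd hcard

/-- A face that is added inside of a target hexagon or outside of it. -/
theorem mem_target_of_bd_eq (hc : Critical L N p M) (hT : IsTarget p M T) {a b : ZMod L}
    (hab : ∀ g ∈ T, OffCut a b g) (hAT : A ⊆ T) (hA : N + 1 ≤ A.card) (hAB : A ⊆ B)
    (hB : ∑ k, bd (B.image (lift a b)) k ≤ p + 1) : B ⊆ T := by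
  obtain ⟨e1, e2⟩ := hc.bd_lift_eq hT hab hAT hA
  have hcard : N + 1 ≤ (A.image (lift a b)).card := by rwa [card_image_lift]
  have e3 : bd (A.image (lift a b)) = bd (B.image (lift a b)) := by
    refine eq_of_le_of_sum_le (bd_mono (Finset.card_pos.1 (by omega))
      (Finset.image_subset_image hAB)) ?_
    exact hB.trans (hc.lt_sum_bd hcard)
  intro w hw
  have : lift a b w ∈ hexFin (bd (B.image (lift a b))) :=
    subset_hexFin_bd _ (Finset.mem_image_of_mem _ hw)
  rwa [← e3, e1, ← e2, (lift_injective a b).mem_finset_image] at this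

theorem subset_target_of_insert (hc : Critical L N p M) (hT : IsTarget p M T)
    {w : Site (ZMod L)} (hAT : A ⊆ T) (hA : N + 1 ≤ A.card) (hp : per (insert w A) ≤ p + 1) :
    insert w A ⊆ T := by
  obtain ⟨a, b, hab⟩ := hc.exists_offCut_insert hT w
  have hab' : ∀ g ∈ T, OffCut a b g := fun g hg =>
    hab g (Finset.mem_insert_of_mem hg)
  have hoff : ∀ g ∈ insert w A, OffCut a b g := fun g hg =>
    hab g (Finset.insert_subset_insert _ hAT hg)
  refine hc.mem_target_of_bd_eq hT hab' hAT hA (Finset.subset_insert w A) ?_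
  have h1 := hc.sum_bd_le (P := (insert w A).image (lift a b))
    (by rw [card_image_lift]; exact hA.trans (Finset.card_le_card (Finset.subset_insert _ _)))
    (by rw [per_image_lift hoff]; omega)
  rw [per_image_lift hoff] at h1
  omega

/-- Leaving the target raises the perimeter of the enclosing hexagon to p + 2, and adding w cannot
reduce it again. -/
theorem not_insert_insert (hc : Critical L N p M) (hT : IsTarget p M T) {u w : Site (ZMod L)}
    (hAT : A ⊆ T) (hA : N + 1 ≤ A.card) (hu : u ∉ T) (hw : w ∉ insert u A)
    (hp : per (insert u A) ≤ p + 2) (hp' : per (insert w (insert u A)) ≤ p + 1) : False := by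
  obtain ⟨a, b, hab⟩ := hc.exists_offCut_insert hT u
  have hab' : ∀ g ∈ T, OffCut a b g := fun g hg =>
    hab g (Finset.mem_insert_of_mem hg)
  have hoff : ∀ g ∈ insert u A, OffCut a b g := fun g hg =>
    hab g (Finset.insert_subset_insert _ hAT hg)
  have hcard : N + 1 ≤ (insert u A).card :=
    hA.trans (Finset.card_le_card (Finset.subset_insert _ _))
  have hcard' : N + 1 ≤ (insert w (insert u A)).card :=
    hcard.trans (Finset.card_le_card (Finset.subset_insert _ _))
  have hgt : (p : ℤ) + 2 ≤ ∑ k, bd ((insert u A).image (lift a b)) k := by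
    by_contra! h
    exact hu (hc.mem_target_of_bd_eq hT hab' hAT hA (Finset.subset_insert u A) (by omega) (by simp))
  have h1 := hc.sum_bd_le (P := (insert u A).image (lift a b)) (by rwa [card_image_lift])
    (by rw [per_image_lift hoff]; omega)
  rw [per_image_lift hoff] at h1
  have h2 := per_insert hw
  obtain ⟨i, j, hij, hi, hj⟩ := exists_of_two_le_deg (S := insert u A) (f := w) (by omega)
  -- The cut is chosen for T and u only. The face w avoids it because in each direction one of its
  -- two occupied neighbors lies in the same strip.
  have hoffw : OffCut a b w := by
    have oi := hoff _ hi
    have oj := hoff _ hj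
    constructor
    · rcases strip_nb_of_ne w hij 0 with e | e
      · rw [← e]; exact oi.1
      · rw [← e]; exact oj.1
    · rcases strip_nb_of_ne w hij 1 with e | e
      · rw [← e]; exact oi.2
      · rw [← e]; exact oj.2
  have hoff' : ∀ g ∈ insert w (insert u A), OffCut a b g := by
    intro g hg
    rw [Finset.mem_insert] at hg
    rcases hg with rfl | hg
    · exact hoffw
    · exact hoff g hg
  have h3 := hc.sum_bd_le (P := (insert w (insert u A)).image (lift a b))
    (by rwa [card_image_lift]) (by rw [per_image_lift hoff']; omega)
  rw [per_image_lift hoff'] at h3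
  have h4 := sum_bd_mono (P := (insert u A).image (lift a b)) (by simp)
    (Finset.image_subset_image (f := lift a b) (Finset.subset_insert w (insert u A)))
  omega

/-- If A without u still spanned the target, the perimeter bound would force w into the target. So
its enclosing hexagon has perimeter at most p; as its area is at least N, it is a critical hexagon,
and w is a single attached face. -/
theorem isCorePlus_of_exchange (hc : Critical L N p M) (hT : IsTarget p M T) {u w : Site (ZMod L)}
    (hAT : A ⊆ T) (hA : N + 1 ≤ A.card) (hw : w ∉ T) (hu : u ∈ A)
    (hp : per (insert w (A.erase u)) ≤ p + 1) : IsCorePlus N p (insert w (A.erase u)) := by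
  obtain ⟨a, b, hab⟩ := hc.exists_offCut_insert hT w
  have hab' : ∀ g ∈ T, OffCut a b g := fun g hg =>
    hab g (Finset.mem_insert_of_mem hg)
  have hRT : A.erase u ⊆ T := (Finset.erase_subset _ _).trans hAT
  have hwR : w ∉ A.erase u := fun h => hw (hRT h)
  have cR : (A.erase u).card = A.card - 1 := Finset.card_erase_of_mem hu
  have hoff : ∀ g ∈ insert w (A.erase u), OffCut a b g :=
    fun g hg => hab g (Finset.insert_subset_insert _ hRT hg)
  have hoffR : ∀ g ∈ A.erase u, OffCut a b g := fun g hg =>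
    hab' g (hRT hg)
  have cS : (insert w (A.erase u)).card = A.card := by
    rw [Finset.card_insert_of_notMem hwR, cR]
    omega
  obtain ⟨e1, e2⟩ := hc.bd_lift_eq hT hab' hAT hA
  have h1 := hc.sum_bd_le (P := (insert w (A.erase u)).image (lift a b))
    (by rw [card_image_lift]; omega) (by rw [per_image_lift hoff]; omega)
  rw [per_image_lift hoff] at h1
  set R' := (A.erase u).image (lift a b) with hR'
  have hR'card : R'.card = A.card - 1 := by rw [hR', card_image_lift, cR]
  have hN := hc.one_le
  have hRne : R'.Nonempty := Finset.card_pos.1 (by omega)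
  have hs : ∑ k, bd R' k ≤ p := by
    by_contra! h
    have e3 : bd R' = bd (T.image (lift a b)) := by
      rw [← e1]
      refine eq_of_le_of_sum_le
        (bd_mono hRne (Finset.image_subset_image (Finset.erase_subset _ _))) ?_
      rw [e1]
      have := (hc.eq_hexFin_of_target (P := T.image (lift a b))
        (by rw [card_image_lift, hT.1]) (by rw [per_image_lift hab', hT.2])).2
      omega
    have e4 : bd R' = bd ((insert w (A.erase u)).image (lift a b)) := by
      refine eq_of_le_of_sum_le
        (bd_mono hRne (Finset.image_subset_image (Finset.subset_insert _ _))) ?_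
      omega
    have : lift a b w ∈ hexFin (bd ((insert w (A.erase u)).image (lift a b))) :=
      subset_hexFin_bd _ (Finset.mem_image_of_mem _ (by simp))
    rw [← e4, e3, ← e2, (lift_injective a b).mem_finset_image] at this
    exact hw this
  have h2 := card_hexFin_le (sideLength_bd_nonneg hRne) hc.area_eq hc.seven_le hs
  have h3 := Finset.card_le_card (subset_hexFin_bd R')
  have h4 : R' = hexFin (bd R') :=
    Finset.eq_of_subset_of_card_le (subset_hexFin_bd R') (by omega)
  have h5 : deg (A.erase u) w ≤ 1 := by
    rw [← deg_image_lift (hab w (by simp)) hoffR, ← hR', h4]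
    refine deg_hexFin_le ?_
    rw [← h4, hR', (lift_injective a b).mem_finset_image]
    exact hwR
  have h6 := per_insert hwR
  have hle := hc.le
  have h7 := hc.le_per (S := A.erase u) (by omega) (by omega)
  have h8 := per_mod_two (A.erase u)
  have h9 := hc.odd
  have h10 := hc.odd_p
  exact ⟨_, w, ⟨by omega, by omega⟩, hwR, rfl⟩

end Torus

end Critical

/-- Two sets differ by one face. -/
def Flips {L : ℕ} (A B : Finset (Site (ZMod L))) : Prop :=
  (∃ x, x ∉ A ∧ B = insert x A) ∨ ∃ x, x ∉ B ∧ A = insert x B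

theorem Flips.card {L : ℕ} {A B : Finset (Site (ZMod L))} (h : Flips A B) :
    B.card = A.card + 1 ∨ A.card = B.card + 1 := by
  rcases h with ⟨x, hx, rfl⟩ | ⟨x, hx, rfl⟩
  · exact Or.inl (Finset.card_insert_of_notMem hx)
  · exact Or.inr (Finset.card_insert_of_notMem hx)

theorem flips_of_adj {L : ℕ} [NeZero L] {σ η : Config L} (h : (flipGraph L).Adj σ η) :
    Flips (plus σ) (plus η) := by
  obtain ⟨x, rfl⟩ := h
  rcases Int.units_eq_one_or (σ x) with hx | hx
  · refine Or.inr ⟨x, ?_, ?_⟩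
    · rw [mem_plus, flip, Function.update_self, hx]
      decide
    · ext y
      rw [Finset.mem_insert, mem_plus, mem_plus, flip]
      by_cases e : y = x
      · simp [e, hx]
      · simp [e]
  · refine Or.inl ⟨x, ?_, ?_⟩
    · rw [mem_plus, hx]
      decide
    · ext y
      rw [Finset.mem_insert, mem_plus, mem_plus, flip]
      by_cases e : y = x
      · simp [e, hx]
      · simp [e]

theorem eq_erase_of_insert {L : ℕ} {x : Site (ZMod L)} {A B : Finset (Site (ZMod L))}
    (hx : x ∉ A) (h : B = insert x A) : x ∈ B ∧ A = B.erase x := by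
  subst h
  exact ⟨Finset.mem_insert_self _ _, (Finset.erase_insert hx).symm⟩

/-! ### Paths of bounded energy pass through the gate -/

namespace Critical

variable {L N p M : ℕ} [NeZero L] {A B C : Finset (Site (ZMod L))}

/-- Two consecutive flips cross the critical area only through the gate. -/
theorem mem_gate_of_flips (hc : Critical L N p M) (hA : Admissible N p M A)
    (hB : Admissible N p M B) (hC : Admissible N p M C) (hAB : Flips A B) (hBC : Flips B C)
    (hpar : A.card % 2 = 0) (sA : Subcritical N p M A) (sC : ¬ Subcritical N p M C) :
    conf B ∈ canonicalConfigs L (N + 2) ∪ defectiveConfigs L (N + 2) := by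
  have hle := hc.le
  have hodd := hc.odd
  have heven := hc.even
  have cAB := hAB.card
  have cBC := hBC.card
  have cA := sA.1
  have cC : C.card ≤ M := by omega
  have pA := hc.per_le_of_even hA (by omega) hpar
  have pB := (hB (by omega)).1
  have pC := hc.per_le_of_even hC cC (by omega)
  -- If C has reached area M, then its perimeter is p + 1 and C is itself a target.
  obtain ⟨hCN, T, hT, hCT, hCplus⟩ : N < C.card ∧ ∃ T, IsTarget p M T ∧ C ⊆ T ∧
      (C.card < M → ¬ IsCorePlus N p C) := by
    by_cases h : C.card < M
    · simp only [Subcritical, h, true_and, not_or, not_forall, not_not] at sC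
      obtain ⟨h1, h2, T, hT, hCT⟩ := sC
      exact ⟨by omega, T, hT, hCT, fun _ => h2⟩
    · have h1 := hc.add_one_le_per (S := C) cC (by omega)
      exact ⟨by omega, C, ⟨by omega, by omega⟩, subset_rfl, fun h' => absurd h' h⟩
  have core : B.card = N → ∀ D, D.card = N + 1 → Flips B D → IsCorePlus N p D := by
    intro h D hD hBD
    rcases hBD with ⟨x, hx, rfl⟩ | ⟨x, hx, rfl⟩
    · exact ⟨B, x, hc.isCore_of_card hB h, hx, rfl⟩
    · rw [Finset.card_insert_of_notMem hx] at h
      omega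
  by_cases hBN : B.card = N
  · by_cases hC1 : C.card = N + 1
    · exact absurd (core hBN C hC1 hBC) (hCplus (by omega))
    · omega
  -- B has odd area at least N and different from N, hence at least N + 2.
  have hAN : N < A.card := by omega
  by_cases hplus : IsCorePlus N p A
  · obtain ⟨Q, x, hQ, hx, rfl⟩ := hplus
    have cA' : (insert x Q).card = N + 1 := by rw [Finset.card_insert_of_notMem hx, hQ.1]
    rcases hAB with ⟨g, hg, rfl⟩ | ⟨g, hg, h⟩
    · rcases hBC with ⟨y, hy, rfl⟩ | ⟨y, hy, h⟩
      · exact hc.mem_gate_of_step hQ hx hg hy hA hB hC hT hCT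
      · exfalso
        have cB : (insert g (insert x Q)).card = N + 2 := by
          rw [Finset.card_insert_of_notMem hg, cA']
        have cB' := congrArg Finset.card h
        rw [Finset.card_insert_of_notMem hy] at cB'
        obtain ⟨hyB, rfl⟩ := eq_erase_of_insert hy h
        refine hCplus (by omega) ?_
        rw [Finset.mem_insert, Finset.mem_insert] at hyB
        rcases hyB with rfl | rfl | hyQ
        · rw [Finset.erase_insert hg]
          exact ⟨Q, x, hQ, hx, rfl⟩
        · refine ⟨Q, g, hQ, fun h => hg (by simp [h]), ?_⟩
          rw [Finset.insert_comm, Finset.erase_insert]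
          rw [Finset.mem_insert]
          rintro (rfl | h)
          · exact hg (by simp)
          · exact hx h
        · exact hc.isCorePlus_of_slide hQ hx hg hyQ hB hC
    · have := congrArg Finset.card h
      rw [Finset.card_insert_of_notMem hg] at this
      omega
  -- A is neither small nor a core with one more face, so it lies in no target. Each combination of
  -- two flips that leads into the target T of C contradicts this.
  have hAT : ∀ T, IsTarget p M T → ¬ A ⊆ T := by
    rcases sA.2 with h | h | h
    · omega
    · exact absurd h hplus
    · exact h
  exfalso
  refine hAT T hT ?_
  rcases hAB with ⟨u, hu, rfl⟩ | ⟨w, hw, rfl⟩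
  · rcases hBC with ⟨y, hy, rfl⟩ | ⟨w, hw, h⟩
    · exact ((Finset.subset_insert _ _).trans (Finset.subset_insert _ _)).trans hCT
    · obtain ⟨hwB, hCe⟩ := eq_erase_of_insert hw h
      by_cases hwT : w ∈ T
      · refine (Finset.subset_insert u A).trans ?_
        rw [h]
        exact Finset.insert_subset hwT hCT
      · by_cases huw : u = w
        · subst huw
          rw [Finset.erase_insert hu] at hCe
          rwa [hCe] at hCT
        · exfalso
          have huC : u ∈ C := by
            rw [hCe]
            exact Finset.mem_erase.2 ⟨huw, by simp⟩
          have hAe : A = insert w (C.erase u) := by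
            rw [← Finset.erase_insert_of_ne (Ne.symm huw), ← h, Finset.erase_insert hu]
          refine hplus ?_
          rw [hAe] at pA ⊢
          exact hc.isCorePlus_of_exchange hT hCT hCN hwT huC pA
  · rcases hBC with ⟨y, hy, rfl⟩ | ⟨u, hu, rfl⟩
    · exact hc.subset_target_of_insert hT ((Finset.subset_insert _ _).trans hCT) (by omega) pA
    · by_cases huT : u ∈ T
      · exact hc.subset_target_of_insert hT (Finset.insert_subset huT hCT) (by omega) pA
      · exact (hc.not_insert_insert hT hCT hCN huT hw pB pA).elim

theorem exists_mem_gate (hc : Critical L N p M) : ∀ (n : ℕ) {σ η : Config L}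
    (ω : (flipGraph L).Walk σ η), ω.length ≤ n →
    (∀ ζ ∈ ω.support, Admissible N p M (plus ζ)) → (plus σ).card % 2 = 0 →
    (plus η).card % 2 = 0 → Subcritical N p M (plus σ) → ¬ Subcritical N p M (plus η) →
    ∃ ζ ∈ ω.support, ζ ∈ canonicalConfigs L (N + 2) ∪ defectiveConfigs L (N + 2) := by
  intro n
  induction n with
  | zero =>
    intro σ η ω hn _ _ _ h1 h2
    have := SimpleGraph.Walk.eq_of_length_eq_zero (Nat.le_zero.1 hn)
    subst this
    exact absurd h1 h2
  | succ n ih =>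
    intro σ η ω hn hadm pσ pη h1 h2
    cases ω with
    | nil => exact absurd h1 h2
    | @cons _ τ _ hστ ω =>
      cases ω with
      | nil =>
        have := (flips_of_adj hστ).card
        omega
      | @cons _ υ _ hτυ ω =>
        have aσ := hadm σ (by simp)
        have aτ := hadm τ (by simp)
        have aυ := hadm υ (by simp)
        by_cases h3 : Subcritical N p M (plus υ)
        · have c1 := (flips_of_adj hστ).card
          have c2 := (flips_of_adj hτυ).card
          simp only [SimpleGraph.Walk.length_cons] at hn
          obtain ⟨ζ, hζ, hg⟩ :=
            ih ω (by omega) (fun ζ hζ => hadm ζ (by simp [hζ])) (by omega) pη h3 h2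
          exact ⟨ζ, by simp [hζ], hg⟩
        · have := hc.mem_gate_of_flips aσ aτ aυ (flips_of_adj hστ) (flips_of_adj hτυ) pσ h1 h3
          rw [conf_plus] at this
          exact ⟨τ, by simp, this⟩

end Critical

/-- Up to area M, the field gains less than J compared with area N + 2, so it cannot pay for one
more boundary edge. -/
theorem admissible_of_energy_le {L N p M : ℕ} {J h : ℝ} (hh : 0 < h) (hJ : 0 < J)
    (hM : M * h < J + (N + 2) * h) {S : Finset (Site (ZMod L))}
    (hS : energy J h S ≤ J * (p + 2) - h * (N + 2)) : Admissible N p M S := by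
  intro hSM
  rw [energy] at hS
  have h1 : (S.card : ℝ) * h ≤ M * h :=
    mul_le_mul_of_nonneg_right (by exact_mod_cast hSM) hh.le
  constructor
  · have h2 : J * per S < J * (p + 3) := by nlinarith
    have h3 : (per S : ℝ) < p + 3 := lt_of_mul_lt_mul_left h2 hJ.le
    have h4 : per S < p + 3 := by exact_mod_cast h3
    omega
  · intro hlt
    have h1 : (S.card : ℝ) * h < (N + 2) * h :=
      mul_lt_mul_of_pos_right (by exact_mod_cast hlt) hh
    have h2 : J * per S < J * (p + 2) := by nlinarith
    have h3 : (per S : ℝ) < p + 2 := lt_of_mul_lt_mul_left h2 hJ.le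
    have h4 : per S < p + 2 := by exact_mod_cast h3
    omega

/-! ### Paths below a given energy -/

section Low

variable {L : ℕ} [NeZero L] {J h Γ : ℝ} {A B C : Finset (Site (ZMod L))}

/-- There is a path from `A` to `B` along which the energy is less than `Γ`. -/
def Low (J h Γ : ℝ) (A B : Finset (Site (ZMod L))) : Prop :=
  ∃ ω : Path (conf A) (conf B), ∀ ζ ∈ ω.support, energy J h (plus ζ) < Γ

theorem Low.refl (hA : energy J h A < Γ) : Low J h Γ A A :=
  ⟨.nil, by simpa using hA⟩

theorem Low.trans (hAB : Low J h Γ A B) (hBC : Low J h Γ B C) : Low J h Γ A C := by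
  obtain ⟨ω, hω⟩ := hAB
  obtain ⟨ω', hω'⟩ := hBC
  refine ⟨ω.append ω', fun ζ hζ => ?_⟩
  rw [SimpleGraph.Walk.mem_support_append_iff] at hζ
  rcases hζ with hζ | hζ
  · exact hω ζ hζ
  · exact hω' ζ hζ

theorem conf_insert {x : Site (ZMod L)} (hx : x ∉ A) : conf (insert x A) = flip (conf A) x := by
  funext y
  by_cases e : y = x
  · subst e
    simp [conf, flip, hx]
  · simp [conf, flip, e]

theorem adj_insert {x : Site (ZMod L)} (hx : x ∉ A) :
    (flipGraph L).Adj (conf A) (conf (insert x A)) := ⟨x, conf_insert hx⟩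

theorem Low.insert {x : Site (ZMod L)} (hA : energy J h A < Γ)
    (hx : energy J h (insert x A) < Γ) : Low J h Γ A (insert x A) := by
  by_cases hxA : x ∈ A
  · rw [Finset.insert_eq_of_mem hxA]
    exact .refl hA
  · refine ⟨.cons (adj_insert hxA) .nil, fun ζ hζ => ?_⟩
    simp only [SimpleGraph.Walk.support_cons, SimpleGraph.Walk.support_nil, List.mem_cons,
      List.not_mem_nil, or_false] at hζ
    rcases hζ with rfl | rfl
    · rwa [plus_conf]
    · rwa [plus_conf]

omit [NeZero L] in
theorem energy_le_of_per_le (hh : 0 < h) (hJ : 0 < J) (hAB : A ⊆ B) (hp : per B ≤ per A) :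
    energy J h B ≤ energy J h A := by
  have h1 : (A.card : ℝ) ≤ B.card := by exact_mod_cast Finset.card_le_card hAB
  have h2 : (per B : ℝ) ≤ per A := by exact_mod_cast hp
  have h3 := mul_le_mul_of_nonneg_left h1 hh.le
  have h4 := mul_le_mul_of_nonneg_left h2 hJ.le
  rw [energy, energy]
  linarith

omit [NeZero L] in
theorem energy_insert_le (hJ : 0 < J) {x : Site (ZMod L)} (hx : x ∉ A) (hd : 1 ≤ deg A x) :
    energy J h (insert x A) ≤ energy J h A + J - h := by
  have h2 : (per (insert x A) : ℝ) ≤ per A + 1 := by exact_mod_cast per_insert_le_of_one hx hd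
  have h4 := mul_le_mul_of_nonneg_left h2 hJ.le
  rw [energy, energy, Finset.card_insert_of_notMem hx]
  push_cast
  linarith

/-! ### Filling bars -/

theorem low_insert_of_two_le (hh : 0 < h) (hJ : 0 < J) {x : Site (ZMod L)}
    (hd : x ∈ A ∨ 2 ≤ deg A x) (hA : energy J h A < Γ) :
    Low J h Γ A (insert x A) ∧ per (insert x A) ≤ per A := by
  have hp : per (insert x A) ≤ per A := by
    by_cases hx : x ∈ A
    · rw [Finset.insert_eq_of_mem hx]
    · have := per_insert_le_of_two hx (hd.resolve_left hx)
      omega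
  exact ⟨.insert hA ((energy_le_of_per_le hh hJ (Finset.subset_insert _ _) hp).trans_lt hA), hp⟩

/-- A bar grows by an odd face m, which costs at most J - h, followed by an even face y, which has
two occupied neighbors and restores the perimeter. Either may already be present in A. -/
theorem low_insert_pair (hh : 0 < h) (hJ : h < J) {g m y : Site (ZMod L)} {i₀ i₁ i₂ : Fin 3}
    (h01 : i₀ ≠ i₁) (h12 : i₁ ≠ i₂) (hm : m = nb g i₀) (hy : y = nb m i₁) (hg : g ∈ A)
    (hyA : nb y i₂ ∈ A) (hA : energy J h A + J - h < Γ) :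
    Low J h Γ A (insert y (insert m A)) ∧ per (insert y (insert m A)) ≤ per A := by
  have hJ0 : 0 < J := hh.trans hJ
  have hA' : energy J h A < Γ := by linarith
  have nmg : nb m i₀ = g := by rw [hm, nb_nb]
  have nym : nb y i₁ = m := by rw [hy, nb_nb]
  have dy : 2 ≤ deg (insert m A) y :=
    two_le_deg h12 (by rw [nym]; simp) (Finset.mem_insert_of_mem hyA)
  by_cases hmA : m ∈ A
  · rw [Finset.insert_eq_of_mem hmA] at dy ⊢
    exact low_insert_of_two_le hh hJ0 (Or.inr dy) hA'
  · have d1 : 1 ≤ deg A m := one_le_deg i₀ (by rw [nmg]; exact hg)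
    have e1 := energy_insert_le (h := h) hJ0 hmA d1
    have l1 : Low J h Γ A (insert m A) := .insert hA' (by linarith)
    by_cases hyA' : y ∈ A
    · obtain ⟨l2, p2⟩ := low_insert_of_two_le (A := A) (x := m) hh hJ0
        (Or.inr (two_le_deg h01 (by rw [nmg]; exact hg) (by rw [← hy]; exact hyA'))) hA'
      rw [Finset.insert_eq_of_mem (a := y) (Finset.mem_insert_of_mem hyA')]
      exact ⟨l2, p2⟩
    · have hym : y ∉ insert m A := by
        rw [Finset.mem_insert]
        rintro (e | e)
        · exact nb_ne m i₁ (by rw [← hy, e])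
        · exact hyA' e
      obtain ⟨l2, -⟩ := low_insert_of_two_le (Γ := Γ) (A := insert m A) (x := y) hh hJ0
        (Or.inr dy)
        (by linarith)
      have p1 := per_insert_le_of_one hmA d1
      have p2 := per_insert_le_of_two hym dy
      exact ⟨l1.trans l2, by omega⟩

theorem low_extend (hh : 0 < h) (hJ : h < J) {i₀ i₁ i₂ : Fin 3}
    (h01 : i₀ ≠ i₁) (h12 : i₁ ≠ i₂) (g : ℕ → Site (ZMod L))
    (hodd : ∀ j, g (2 * j + 1) = nb (g (2 * j)) i₀)
    (heven : ∀ j, g (2 * j + 2) = nb (g (2 * j + 1)) i₁) (n : ℕ)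
    (hbelow : ∀ j ≤ n, nb (g (2 * j)) i₂ ∈ A) (h0 : g 0 ∈ A)
    (hA : energy J h A + J - h < Γ) :
    Low J h Γ A (A ∪ (Finset.range (2 * n + 1)).image g) ∧
      per (A ∪ (Finset.range (2 * n + 1)).image g) ≤ per A := by
  have hJ0 : 0 < J := hh.trans hJ
  induction n with
  | zero =>
    have : A ∪ (Finset.range (2 * 0 + 1)).image g = A := by simp [h0]
    rw [this]
    exact ⟨.refl (by linarith), le_rfl⟩
  | succ n ih =>
    obtain ⟨l1, p1⟩ := ih fun j hj => hbelow j (by omega)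
    set B := A ∪ (Finset.range (2 * n + 1)).image g with hB
    have hAB : A ⊆ B := Finset.subset_union_left
    have eB := energy_le_of_per_le (J := J) (h := h) hh hJ0 hAB p1
    obtain ⟨l2, p2⟩ := low_insert_pair (Γ := Γ) (A := B) hh hJ h01 h12 (hodd n) (heven n)
      (Finset.mem_union_right _ (Finset.mem_image_of_mem _ (by simp)))
      (hAB (hbelow (n + 1) le_rfl)) (by linarith)
    have : A ∪ (Finset.range (2 * (n + 1) + 1)).image g =
        insert (g (2 * n + 2)) (insert (g (2 * n + 1)) B) := by
      rw [hB, show 2 * (n + 1) + 1 = 2 * n + 1 + 1 + 1 by ring, Finset.range_add_one,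
        Finset.range_add_one (n := 2 * n + 1), Finset.image_insert, Finset.image_insert,
        Finset.union_insert, Finset.union_insert]
    rw [this]
    exact ⟨l1.trans l2, p2.trans p1⟩

/-- A row of faces of the torus. -/
structure IsRow (f : ℤ → Site (ZMod L)) (i₀ i₁ i₂ : Fin 3) : Prop where
  ne₀₁ : i₀ ≠ i₁
  ne₀₂ : i₀ ≠ i₂
  ne₁₂ : i₁ ≠ i₂
  odd : ∀ j, f (2 * j + 1) = nb (f (2 * j)) i₀
  even : ∀ j, f (2 * j + 2) = nb (f (2 * j + 1)) i₁

variable {f : ℤ → Site (ZMod L)} {i₀ i₁ i₂ : Fin 3}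

/-- A bar is filled downhill, starting from a face of the bar that is attached to `A`. -/
theorem low_fill_of_even_mem (hf : IsRow f i₀ i₁ i₂) (hh : 0 < h) (hJ : h < J) {n : ℕ}
    (hbelow : ∀ j : ℤ, 0 ≤ j → j ≤ n → nb (f (2 * j)) i₂ ∈ A) {a : ℤ} (ha0 : 0 ≤ a) (han : a ≤ n)
    (ha : f (2 * a) ∈ A) (hA : energy J h A + J - h < Γ) :
    Low J h Γ A (A ∪ (Finset.Icc 0 (2 * n : ℤ)).image f) ∧
      per (A ∪ (Finset.Icc 0 (2 * n : ℤ)).image f) ≤ per A := by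
  have hJ0 : 0 < J := hh.trans hJ
  obtain ⟨l1, p1⟩ := low_extend (Γ := Γ) (A := A) hh hJ hf.ne₀₁ hf.ne₁₂ (fun j => f (2 * a + j))
    (fun j => by
      have := hf.odd (a + j)
      push_cast
      rw [show 2 * a + (2 * (j : ℤ) + 1) = 2 * (a + j) + 1 by ring, this]
      ring_nf)
    (fun j => by
      have := hf.even (a + j)
      push_cast
      rw [show 2 * a + (2 * (j : ℤ) + 2) = 2 * (a + j) + 2 by ring, this]
      ring_nf) (n - a).toNat
    (fun j hj => by
      have := hbelow (a + j) (by omega) (by omega)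
      push_cast
      rwa [show 2 * a + 2 * (j : ℤ) = 2 * (a + j) by ring])
    (by simpa using ha) hA
  set B := A ∪ (Finset.range (2 * (n - a).toNat + 1)).image (fun j : ℕ => f (2 * a + j)) with hB
  have hAB : A ⊆ B := Finset.subset_union_left
  have eB := energy_le_of_per_le (J := J) (h := h) hh hJ0 hAB p1
  obtain ⟨l2, p2⟩ := low_extend (Γ := Γ) (A := B) hh hJ hf.ne₀₁.symm hf.ne₀₂
    (fun j => f (2 * a - j))
    (fun j => by
      have := hf.even (a - j - 1)
      push_cast
      rw [show 2 * a - 2 * (j : ℤ) = 2 * (a - j - 1) + 2 by ring, this, nb_nb]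
      ring_nf)
    (fun j => by
      have := hf.odd (a - j - 1)
      push_cast
      rw [show 2 * a - (2 * (j : ℤ) + 1) = 2 * (a - j - 1) + 1 by ring, this, nb_nb]
      ring_nf) a.toNat
    (fun j hj => hAB (by
      have := hbelow (a - j) (by omega) (by omega)
      push_cast
      rwa [show 2 * a - 2 * (j : ℤ) = 2 * (a - j) by ring]))
    (hAB (by simpa using ha)) (by linarith)
  have hset : B ∪ (Finset.range (2 * a.toNat + 1)).image (fun j : ℕ => f (2 * a - j)) =
      A ∪ (Finset.Icc 0 (2 * n : ℤ)).image f := by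
    rw [hB, Finset.union_assoc]
    congr 1
    ext u
    simp only [Finset.mem_union, Finset.mem_image, Finset.mem_range, Finset.mem_Icc]
    constructor
    · rintro (⟨j, hj, rfl⟩ | ⟨j, hj, rfl⟩)
      · exact ⟨_, by omega, rfl⟩
      · exact ⟨_, by omega, rfl⟩
    · rintro ⟨m, hm, rfl⟩
      rcases le_total (2 * a) m with hle | hle
      · exact Or.inl ⟨(m - 2 * a).toNat, by omega, by congr 1; omega⟩
      · exact Or.inr ⟨(2 * a - m).toNat, by omega, by congr 1; omega⟩
  rw [hset] at l2 p2
  exact ⟨l1.trans l2, p2.trans p1⟩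

theorem low_fill_of_mem (hf : IsRow f i₀ i₁ i₂) (hh : 0 < h) (hJ : h < J) {n : ℕ}
    (hbelow : ∀ j : ℤ, 0 ≤ j → j ≤ n → nb (f (2 * j)) i₂ ∈ A) {m : ℤ} (hm0 : 0 ≤ m)
    (hmn : m ≤ 2 * n) (hm : f m ∈ A) (hA : energy J h A + J - h < Γ) :
    Low J h Γ A (A ∪ (Finset.Icc 0 (2 * n : ℤ)).image f) ∧
      per (A ∪ (Finset.Icc 0 (2 * n : ℤ)).image f) ≤ per A := by
  have hJ0 : 0 < J := hh.trans hJ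
  rcases Int.even_or_odd' m with ⟨a, rfl | rfl⟩
  · exact low_fill_of_even_mem hf hh hJ hbelow (by omega) (by omega) hm hA
  -- An odd seed fills the even face beside it at no cost, since that face also touches the side.
  · obtain ⟨l1, p1⟩ := low_insert_of_two_le (Γ := Γ) (A := A) (x := f (2 * a)) hh hJ0
      (Or.inr (two_le_deg hf.ne₀₂ (by rw [← hf.odd]; exact hm) (hbelow a (by omega) (by omega))))
      (by linarith)
    have hsub := Finset.subset_insert (f (2 * a)) A
    have e1 := energy_le_of_per_le (J := J) (h := h) hh hJ0 hsub p1
    obtain ⟨l2, p2⟩ := low_fill_of_even_mem (Γ := Γ) (A := insert (f (2 * a)) A) (n := n) hf hh hJ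
      (fun j h0 h1 => hsub (hbelow j h0 h1)) (a := a) (by omega) (by omega) (by simp) (by linarith)
    have hset : insert (f (2 * a)) A ∪ (Finset.Icc 0 (2 * n : ℤ)).image f =
        A ∪ (Finset.Icc 0 (2 * n : ℤ)).image f := by
      rw [Finset.insert_union, Finset.insert_eq_of_mem]
      exact Finset.mem_union_right _ (Finset.mem_image_of_mem _ (by simp; omega))
    rw [hset] at l2 p2
    exact ⟨l1.trans l2, p2.trans p1⟩

/-- The budget 2 J - 2 h pays for the first two faces of an empty bar; the third takes back one unit
of perimeter. If the bar already meets A, no seed is needed and the perimeter does not increase. -/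
theorem low_fill (hf : IsRow f i₀ i₁ i₂) (hh : 0 < h) (hJ : h < J) {n : ℕ}
    (hbelow : ∀ j : ℤ, 0 ≤ j → j ≤ n → nb (f (2 * j)) i₂ ∈ A)
    (hA : energy J h A + 2 * J - 2 * h < Γ) :
    Low J h Γ A (A ∪ (Finset.Icc 0 (2 * n : ℤ)).image f) ∧
      per (A ∪ (Finset.Icc 0 (2 * n : ℤ)).image f) ≤ per A + 1 ∧
      (Disjoint A ((Finset.Icc 0 (2 * n : ℤ)).image f) ∨
        per (A ∪ (Finset.Icc 0 (2 * n : ℤ)).image f) ≤ per A) := by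
  have hJ0 : 0 < J := hh.trans hJ
  by_cases hd : Disjoint A ((Finset.Icc 0 (2 * n : ℤ)).image f)
  · have h0 : f 0 ∉ A := fun h0 =>
      Finset.disjoint_left.1 hd h0 (Finset.mem_image_of_mem _ (by simp))
    have d1 : 1 ≤ deg A (f 0) := one_le_deg i₂ (by simpa using hbelow 0 le_rfl (by omega))
    have e1 := energy_insert_le (h := h) hJ0 h0 d1
    have l1 : Low J h Γ A (insert (f 0) A) := .insert (by linarith) (by linarith)
    have p1 := per_insert_le_of_one h0 d1
    obtain ⟨l2, p2⟩ := low_fill_of_even_mem (Γ := Γ) (A := insert (f 0) A) (n := n) hf hh hJ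
      (fun j h0 h1 => Finset.mem_insert_of_mem (hbelow j h0 h1)) (a := 0) le_rfl (by omega)
      (by simp) (by linarith)
    have hset : insert (f 0) A ∪ (Finset.Icc 0 (2 * n : ℤ)).image f =
        A ∪ (Finset.Icc 0 (2 * n : ℤ)).image f := by
      rw [Finset.insert_union, Finset.insert_eq_of_mem]
      exact Finset.mem_union_right _ (Finset.mem_image_of_mem _ (by simp))
    rw [hset] at l2 p2
    exact ⟨l1.trans l2, by omega, Or.inl hd⟩
  · rw [Finset.not_disjoint_iff] at hd
    obtain ⟨u, huA, hu⟩ := hd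
    obtain ⟨m, hm, rfl⟩ := Finset.mem_image.1 hu
    rw [Finset.mem_Icc] at hm
    obtain ⟨l, p⟩ := low_fill_of_mem (Γ := Γ) hf hh hJ hbelow hm.1 hm.2 huA (by linarith)
    exact ⟨l, by omega, Or.inr p⟩

end Low

/-! ### Hexagons on the torus -/

section Torus

variable {L : ℕ} [NeZero L] {J h Γ : ℝ} {A : Finset (Site (ZMod L))}

/-- The image of a planar hexagon on the torus. -/
noncomputable def hexTorus (L : ℕ) (b : Fin 6 → ℤ) : Finset (Site (ZMod L)) :=
  (hexFin b).image (toTorus L)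

omit [NeZero L] in
theorem hexTorus_mono {b b' : Fin 6 → ℤ} (hb : ∀ k, b k ≤ b' k) :
    hexTorus L b ⊆ hexTorus L b' :=
  Finset.image_subset_image (hexFin_mono hb)

omit [NeZero L] in
theorem intCast_inj_of_lt {x y : ℤ} (h : (x : ZMod L) = y) (h1 : x - y < L) (h2 : y - x < L) :
    x = y := by
  rw [ZMod.intCast_eq_intCast_iff_dvd_sub] at h
  have := Int.eq_zero_of_abs_lt_dvd h (abs_lt.2 ⟨by omega, by omega⟩)
  omega

omit [NeZero L] in
theorem injOn_toTorus {b : Fin 6 → ℤ} (h0 : b 0 + b 3 ≤ L) (h2 : b 2 + b 5 ≤ L) :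
    Set.InjOn (toTorus L) (hexFin b : Set (Site ℤ)) := by
  rintro ⟨⟨x, y⟩, t⟩ hf ⟨⟨x', y'⟩, t'⟩ hg hfg
  rw [Finset.mem_coe, mem_hexFin] at hf hg
  simp only [toTorus, Prod.mk.injEq] at hfg
  obtain ⟨⟨ex, ey⟩, rfl⟩ := hfg
  have f0 := hf 0
  have f2 := hf 2
  have f3 := hf 3
  have f5 := hf 5
  have g0 := hg 0
  have g2 := hg 2
  have g3 := hg 3
  have g5 := hg 5
  simp [top, strip] at f0 f2 f3 f5 g0 g2 g3 g5
  rw [intCast_inj_of_lt ex (by omega) (by omega), intCast_inj_of_lt ey (by omega) (by omega)]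

namespace IsBar

variable {b : Fin 6 → ℤ} {k : Fin 6} {f : ℤ → Site ℤ} {i₀ i₁ i₂ : Fin 3}

omit [NeZero L] in
theorem isRow (hf : IsBar b k f i₀ i₁ i₂) : IsRow (fun n => toTorus L (f n)) i₀ i₁ i₂ where
  ne₀₁ := hf.ne₀₁
  ne₀₂ := hf.ne₀₂
  ne₁₂ := hf.ne₁₂
  odd j := by rw [hf.odd, toTorus_nb]
  even j := by rw [hf.even, toTorus_nb]

theorem hexFin_grow (hf : IsBar b k f i₀ i₁ i₂) {n : ℕ} (hn : sideLength b k = n + 1) :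
    hexFin (grow b k) = hexFin b ∪ (Finset.Icc 0 (2 * n : ℤ)).image f := by
  ext g
  have := hf.mem g
  rw [Finset.mem_union, Finset.mem_image]
  constructor
  · intro hg
    by_cases hgb : g ∈ hexFin b
    · exact Or.inl hgb
    · obtain ⟨m, h0, h1, rfl⟩ := this.1 ⟨hg, hgb⟩
      exact Or.inr ⟨m, Finset.mem_Icc.2 ⟨h0, by omega⟩, rfl⟩
  · rintro (hg | ⟨m, hm, rfl⟩)
    · exact hexFin_mono (le_grow b k) hg
    · rw [Finset.mem_Icc] at hm
      exact ((hf.mem _).2 ⟨m, hm.1, by omega, rfl⟩).1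

omit [NeZero L] in
theorem hexTorus_grow (hf : IsBar b k f i₀ i₁ i₂) {n : ℕ} (hn : sideLength b k = n + 1) :
    hexTorus L (grow b k) =
      hexTorus L b ∪ (Finset.Icc 0 (2 * n : ℤ)).image fun m => toTorus L (f m) := by
  rw [hexTorus, hf.hexFin_grow hn, Finset.image_union, Finset.image_image]
  rfl

omit [NeZero L] in
theorem nb_mem (hf : IsBar b k f i₀ i₁ i₂) {n : ℕ} (hn : sideLength b k = n + 1)
    (hA : hexTorus L b ⊆ A) (j : ℤ) (h0 : 0 ≤ j) (h1 : j ≤ n) :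
    nb (toTorus L (f (2 * j))) i₂ ∈ A := by
  rw [← toTorus_nb]
  exact hA (Finset.mem_image_of_mem _ (hf.below j h0 (by omega)))

end IsBar

/-- Attaching a bar to a hexagon that is contained in `A`. -/
theorem low_union_hexTorus_grow {b : Fin 6 → ℤ} {k : Fin 6} (hb : ∀ k, 0 ≤ sideLength b k)
    (hne : (hexFin b).Nonempty) (hk : 1 ≤ sideLength b k) (hh : 0 < h) (hJ : h < J)
    (hbA : hexTorus L b ⊆ A) (hA : energy J h A + 2 * J - 2 * h < Γ) :
    Low J h Γ A (A ∪ hexTorus L (grow b k)) ∧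
      per (A ∪ hexTorus L (grow b k)) ≤ per A + 1 ∧
      (per (A ∪ hexTorus L (grow b k)) ≤ per A ∨
        (Set.InjOn (toTorus L) (hexFin (grow b k) : Set (Site ℤ)) →
          ((A ∪ hexTorus L (grow b k)).card : ℤ) = A.card + 2 * sideLength b k - 1)) := by
  obtain ⟨f, i₀, i₁, i₂, hf⟩ := exists_isBar k b hb hne
  obtain ⟨n, hn⟩ : ∃ n : ℕ, sideLength b k = n + 1 :=
    ⟨(sideLength b k - 1).toNat, by omega⟩
  have hset : A ∪ hexTorus L (grow b k) =
      A ∪ (Finset.Icc 0 (2 * n : ℤ)).image fun m => toTorus L (f m) := by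
    rw [hf.hexTorus_grow hn, ← Finset.union_assoc, Finset.union_eq_left.2 hbA]
  obtain ⟨l, p, q⟩ := low_fill (L := L) hf.isRow hh hJ (hf.nb_mem hn hbA) hA
  rw [hset]
  refine ⟨l, p, q.symm.imp_right fun hd hinj => ?_⟩
  rw [Finset.card_union_of_disjoint hd, Finset.card_image_of_injOn, Int.card_Icc, hn]
  · push_cast
    omega
  · intro m hm m' hm' e
    rw [hf.hexFin_grow hn] at hinj
    exact hf.inj (hinj (by simpa using Or.inr ⟨m, by simpa using hm, rfl⟩)
      (by simpa using Or.inr ⟨m', by simpa using hm', rfl⟩) e)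

end Torus

/-! ### The quasi-regular hexagons of given perimeter -/

theorem sideForm_sub_add (k : Fin 6) (c : ℤ × ℤ) :
    sideForm (k - 1) c + sideForm (k + 1) c = sideForm k c := by
  have e : (-1 : Fin 6) = 5 := rfl
  fin_cases k <;> simp [sideForm, e] <;> ring

/-- The bounds of the quasi-regular hexagon of perimeter `s` around `c`, whose bars start at the
side `d`. -/
def chain (c : ℤ × ℤ) (d : Fin 6) (s : ℕ) : Fin 6 → ℤ := quasiHexBounds c (s / 6) (s % 6) d

theorem chain_eq (c : ℤ × ℤ) (d : Fin 6) (r : ℕ) (i : Fin 6) :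
    chain c d (6 * r + i) = quasiHexBounds c r i d := by
  have := i.isLt
  rw [chain, show (6 * r + (i : ℕ)) / 6 = r by omega, show (6 * r + (i : ℕ)) % 6 = i by omega]

theorem exists_eq_six_mul_add (s : ℕ) : ∃ (r : ℕ) (i : Fin 6), s = 6 * r + i :=
  ⟨s / 6, ⟨s % 6, by omega⟩, by simp only; omega⟩

theorem sideLength_quasiHexBounds (c : ℤ × ℤ) (r : ℕ) (i d k : Fin 6) :
    sideLength (quasiHexBounds c r i d) k = r + ((if (k - 1 - d).val < i.val then 1 else 0) +
      (if (k + 1 - d).val < i.val then 1 else 0) - if (k - d).val < i.val then 1 else 0) := by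
  have := sideForm_sub_add k c
  simp only [sideLength, quasiHexBounds]
  linarith

theorem sideLength_chain_nonneg (c : ℤ × ℤ) (d : Fin 6) {s : ℕ} (hs : 6 ≤ s) (k : Fin 6) :
    0 ≤ sideLength (chain c d s) k := by
  obtain ⟨r, i, rfl⟩ := exists_eq_six_mul_add s
  have := i.isLt
  rw [chain_eq, sideLength_quasiHexBounds]
  split_ifs <;> omega

theorem le_sideLength_chain (c : ℤ × ℤ) (d : Fin 6) (s : ℕ) :
    (s / 6 : ℕ) ≤ sideLength (chain c d s) (d + Fin.ofNat 6 s) := by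
  obtain ⟨r, i, rfl⟩ := exists_eq_six_mul_add s
  have := i.isLt
  have e : Fin.ofNat 6 (6 * r + i) = i := Fin.ext (by simp [Fin.ofNat])
  have : ¬ ((d + i - d).val < i.val) := by simp
  rw [chain_eq, sideLength_quasiHexBounds, show (6 * r + (i : ℕ)) / 6 = r by omega, e, if_neg this]
  split_ifs <;> omega

/-- The residue of s modulo 6 counts the bars present, so it points to the next side; the sixth bar
completes the next regular hexagon. -/
theorem chain_succ (c : ℤ × ℤ) (d : Fin 6) (s : ℕ) :
    chain c d (s + 1) = grow (chain c d s) (d + Fin.ofNat 6 s) := by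
  have key : ∀ d i k : Fin 6, (if (k - d).val < i.val + 1 then (1 : ℤ) else 0) =
      (if (k - d).val < i.val then 1 else 0) + if k = d + i then 1 else 0 := by decide
  obtain ⟨r, i, rfl⟩ := exists_eq_six_mul_add s
  have := i.isLt
  have e : Fin.ofNat 6 (6 * r + i) = i := Fin.ext (by simp [Fin.ofNat])
  rw [e, chain_eq]
  have h1 : chain c d (6 * r + i + 1) = quasiHexBounds c r (i + 1) d := by
    by_cases h : i.val = 5
    · rw [chain, show (6 * r + (i : ℕ) + 1) / 6 = r + 1 by omega,
        show (6 * r + (i : ℕ) + 1) % 6 = 0 by omega, h]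
      funext k
      have := (k - d).isLt
      simp [quasiHexBounds]
      omega
    · rw [chain, show (6 * r + (i : ℕ) + 1) / 6 = r by omega,
        show (6 * r + (i : ℕ) + 1) % 6 = i + 1 by omega]
  rw [h1]
  funext k
  rw [quasiHexBounds, key]
  by_cases hk : k = d + i
  · rw [hk, grow, Function.update_self, quasiHexBounds, if_pos rfl]
    ring
  · rw [grow, Function.update_of_ne hk, quasiHexBounds, if_neg hk]
    ring

theorem chain_le_succ (c : ℤ × ℤ) (d : Fin 6) (s : ℕ) (k : Fin 6) :
    chain c d s k ≤ chain c d (s + 1) k := by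
  rw [chain_succ]
  exact le_grow _ _ k

theorem chain_mul_six (c : ℤ × ℤ) (d : Fin 6) (r : ℕ) (k : Fin 6) :
    chain c d (6 * r) k = sideForm k c + r := by
  rw [chain, show 6 * r / 6 = r by omega, show 6 * r % 6 = 0 by omega]
  simp [quasiHexBounds]

theorem sum_quasiHexBounds (c : ℤ × ℤ) (r : ℕ) (i d : Fin 6) :
    ∑ k, quasiHexBounds c r i d k = 6 * r + i := by
  have key : ∀ d i : Fin 6, ∑ k : Fin 6, (if (k - d).val < i.val then (1 : ℤ) else 0) = i.val := by
    decide
  have h1 : ∑ k, sideForm k c = 0 := by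
    simp [Fin.sum_univ_succ, sideForm]
    ring
  simp only [quasiHexBounds, Finset.sum_add_distrib, h1, key]
  simp

/-- Six times the area of a quasi-regular hexagon of perimeter `s` falls short of `s ^ 2` by this
number, where `i` is the residue of `s`. -/
def defect (i : Fin 6) : ℤ := ![0, 7, 4, 3, 4, 7] i

theorem six_mul_card_quasiHexBounds (c : ℤ × ℤ) {r : ℕ} (hr : 1 ≤ r) (i d : Fin 6) :
    6 * ((hexFin (quasiHexBounds c r i d)).card : ℤ) = (6 * r + i : ℤ) ^ 2 - defect i := by
  have key : ∀ d i : Fin 6, ∀ χ : Fin 6 → ℤ, χ = (fun k => if (k - d).val < i.val then 1 else 0) →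
      2 * ((χ 0 + χ 3 - (χ 1 + χ 4)) ^ 2 + (χ 1 + χ 4 - (χ 2 + χ 5)) ^ 2 +
        (χ 0 + χ 3 - (χ 2 + χ 5)) ^ 2) + 3 * (χ 0 + χ 2 + χ 4 - (χ 1 + χ 3 + χ 5)) ^ 2 =
        defect i := by
    rintro d i _ rfl
    revert d i
    decide
  have ht : ∀ k, 0 ≤ sideLength (quasiHexBounds c r i d) k := by
    intro k
    rw [← chain_eq]
    exact sideLength_chain_nonneg c d (by omega) k
  rw [six_mul_card_hexFin ht, sum_quasiHexBounds, ← key d i _ rfl]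
  simp only [quasiHexBounds, sideForm]
  simp
  ring

theorem card_chain (c : ℤ × ℤ) (d : Fin 6) {s : ℕ} (hs : 6 ≤ s) :
    6 * ((hexFin (chain c d s)).card : ℤ) = (s : ℤ) ^ 2 - defect (Fin.ofNat 6 s) := by
  obtain ⟨r, i, rfl⟩ := exists_eq_six_mul_add s
  have := i.isLt
  have e : Fin.ofNat 6 (6 * r + i) = i := Fin.ext (by simp [Fin.ofNat])
  rw [chain_eq, six_mul_card_quasiHexBounds c (by omega), e]
  push_cast
  rfl

theorem nonempty_chain (c : ℤ × ℤ) (d : Fin 6) {s : ℕ} (hs : 6 ≤ s) :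
    (hexFin (chain c d s)).Nonempty := by
  rw [← Finset.card_pos]
  have h1 := card_chain c d hs
  have h2 : ∀ i, defect i ≤ 7 := by decide
  have h3 := h2 (Fin.ofNat 6 s)
  by_contra h
  rw [Nat.eq_zero_of_not_pos h, Nat.cast_zero] at h1
  zify at hs
  nlinarith

theorem width_chain (c : ℤ × ℤ) (d : Fin 6) (s : ℕ) :
    chain c d s 0 + chain c d s 3 ≤ 2 * (((s + 5) / 6 : ℕ) : ℤ) ∧
      chain c d s 2 + chain c d s 5 ≤ 2 * (((s + 5) / 6 : ℕ) : ℤ) := by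
  obtain ⟨r, i, rfl⟩ := exists_eq_six_mul_add s
  have := i.isLt
  rw [chain_eq]
  simp only [quasiHexBounds, sideForm]
  constructor <;> simp <;> split_ifs <;> omega

section Growth

variable {L : ℕ} [NeZero L] {J h Γ : ℝ} {A : Finset (Site (ZMod L))}

/-- The energy of a quasi-regular hexagon of perimeter `s`. -/
noncomputable def chainEnergy (J h : ℝ) (s : ℕ) : ℝ :=
  J * s - h * (((s : ℝ) ^ 2 - defect (Fin.ofNat 6 s)) / 6)

theorem injOn_chain (c : ℤ × ℤ) (d : Fin 6) {s : ℕ} (hL : 2 * ((s + 5) / 6) ≤ L) :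
    Set.InjOn (toTorus L) (hexFin (chain c d s) : Set (Site ℤ)) := by
  have h1 := width_chain c d s
  exact injOn_toTorus (h1.1.trans (by exact_mod_cast hL)) (h1.2.trans (by exact_mod_cast hL))

theorem card_hexTorus_chain (c : ℤ × ℤ) (d : Fin 6) {s : ℕ} (hL : 2 * ((s + 5) / 6) ≤ L) :
    (hexTorus L (chain c d s)).card = (hexFin (chain c d s)).card :=
  Finset.card_image_of_injOn (injOn_chain c d hL)

theorem energy_chain_le (hJ : 0 < J) {c : ℤ × ℤ} {d : Fin 6} {s : ℕ} (hs : 6 ≤ s)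
    (hL : 2 * ((s + 5) / 6) ≤ L) (hp : per (hexTorus L (chain c d s)) ≤ s) :
    energy J h (hexTorus L (chain c d s)) ≤ chainEnergy J h s := by
  have h1 := card_chain c d hs
  have h2 : (6 : ℝ) * (hexFin (chain c d s)).card = (s : ℝ) ^ 2 - defect (Fin.ofNat 6 s) := by
    exact_mod_cast h1
  have h3 : (per (hexTorus L (chain c d s)) : ℝ) ≤ s := by exact_mod_cast hp
  have h4 := mul_le_mul_of_nonneg_left h3 hJ.le
  rw [energy, chainEnergy, card_hexTorus_chain c d hL, ← h2]
  linarith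

theorem low_insert_of_one_le (hh : 0 < h) (hJ : h < J) {x : Site (ZMod L)} (hd : 1 ≤ deg A x)
    (hA : energy J h A + J - h < Γ) :
    Low J h Γ A (insert x A) ∧ energy J h (insert x A) ≤ energy J h A + J - h ∧
      per (insert x A) ≤ per A + 1 := by
  by_cases hx : x ∈ A
  · rw [Finset.insert_eq_of_mem hx]
    exact ⟨.refl (by linarith), by linarith, by omega⟩
  · have h1 := energy_insert_le (h := h) (hh.trans hJ) hx hd
    exact ⟨.insert (by linarith) (by linarith), h1, per_insert_le_of_one hx hd⟩

/-- The six faces around a vertex are filled one after the other. -/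
theorem low_chain_six (hh : 0 < h) (hJ : h < J) (hL : 2 ≤ L) (hΓ : 7 * J - 5 * h < Γ)
    (c : ℤ × ℤ) (d : Fin 6) :
    Low J h Γ ∅ (hexTorus L (chain c d 6)) ∧ per (hexTorus L (chain c d 6)) ≤ 6 := by
  obtain ⟨x, hx⟩ : ∃ x, x = toTorus L (c, true) := ⟨_, rfl⟩
  have hset : hexTorus L (chain c d 6) =
      insert (nb (nb (nb (nb (nb x 1) 0) 2) 1) 0) (insert (nb (nb (nb (nb x 1) 0) 2) 1)
        (insert (nb (nb (nb x 1) 0) 2) (insert (nb (nb x 1) 0) (insert (nb x 1) {x})))) := by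
    have h1 : hexFin (chain c d 6) = {((c.1, c.2 - 1), false), ((c.1, c.2 - 1), true),
        ((c.1 - 1, c.2 - 1), false), ((c.1 - 1, c.2), true), ((c.1 - 1, c.2), false),
        (c, true)} := by
      have h2 : ∀ k, chain c d 6 k = sideForm k c + 1 := fun k => by
        simpa using chain_mul_six c d 1 k
      obtain ⟨c1, c2⟩ := c
      ext ⟨⟨u, v⟩, t⟩
      rw [mem_hexFin]
      simp only [h2]
      cases t <;> simp [Fin.forall_fin_succ, top, strip, sideForm] <;> omega
    rw [hexTorus, h1, hx]
    simp only [Finset.image_insert, Finset.image_singleton]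
    simp [toTorus, nb]
  have p0 : (per ({x} : Finset (Site (ZMod L))) : ℤ) = 3 := by
    have := per_insert (Finset.notMem_empty x)
    rw [per_empty] at this
    simpa [deg] using this
  have e0 : energy J h {x} = 3 * J - h := by
    have : (per ({x} : Finset (Site (ZMod L))) : ℝ) = 3 := by exact_mod_cast p0
    rw [energy, this, Finset.card_singleton]
    push_cast
    ring
  have l0 : Low J h Γ ∅ {x} := by
    rw [← insert_empty_eq x] at e0 ⊢
    refine .insert ?_ (by linarith)
    rw [energy, per_empty]
    simp
    linarith
  have dn : ∀ (B : Finset (Site (ZMod L))) (y : Site (ZMod L)) (i : Fin 3), y ∈ B →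
      1 ≤ deg B (nb y i) := fun B y i hy => one_le_deg i (by rwa [nb_nb])
  -- Each of the next four faces costs at most J - h, which from 3 J - h leads to at most 7 J - 5 h.
  -- The sixth closes the ring and shares two edges.
  obtain ⟨l1, e1, p1⟩ := low_insert_of_one_le (Γ := Γ) hh hJ (dn {x} x 1 (by simp)) (by linarith)
  obtain ⟨l2, e2, p2⟩ := low_insert_of_one_le (Γ := Γ) hh hJ
    (dn _ (nb x 1) 0 (Finset.mem_insert_self _ {x})) (by linarith)
  obtain ⟨l3, e3, p3⟩ := low_insert_of_one_le (Γ := Γ) hh hJ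
    (dn _ (nb (nb x 1) 0) 2 (Finset.mem_insert_self _ (insert (nb x 1) {x}))) (by linarith)
  obtain ⟨l4, e4, p4⟩ := low_insert_of_one_le (Γ := Γ) hh hJ
    (dn _ (nb (nb (nb x 1) 0) 2) 1 (Finset.mem_insert_self _
      (insert (nb (nb x 1) 0) (insert (nb x 1) {x})))) (by linarith)
  have d5 : 2 ≤ deg (insert (nb (nb (nb (nb x 1) 0) 2) 1)
        (insert (nb (nb (nb x 1) 0) 2) (insert (nb (nb x 1) 0) (insert (nb x 1) {x}))))
        (nb (nb (nb (nb (nb x 1) 0) 2) 1) 0) := by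
    refine two_le_deg (i := 0) (j := 2) (by decide) (by rw [nb_nb]; simp) ?_
    have : nb (nb (nb (nb (nb (nb x 1) 0) 2) 1) 0) 2 = x := by
      rw [hx]
      simp [toTorus, nb]
    rw [this]
    simp
  obtain ⟨l5, p5⟩ := low_insert_of_two_le (Γ := Γ) hh (hh.trans hJ) (Or.inr d5) (by linarith)
  rw [← hset] at l5 p5
  refine ⟨((((l0.trans l1).trans l2).trans l3).trans l4).trans l5, ?_⟩
  have h1 := card_hexTorus_chain (L := L) c d (s := 6) (by omega)
  have h2 := card_chain c d (s := 6) le_rfl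
  have h3 : defect (Fin.ofNat 6 6) = 0 := rfl
  rw [h3] at h2
  -- The successive bounds only give perimeter at most 7; the area 6 is even, which excludes 7.
  have h4 := per_mod_two (hexTorus L (chain c d 6))
  zify at *
  omega

theorem low_union_chain_succ (hh : 0 < h) (hJ : h < J) {c : ℤ × ℤ} {d : Fin 6} {s : ℕ}
    (hs : 6 ≤ s) (hcA : hexTorus L (chain c d s) ⊆ A) (hA : energy J h A + 2 * J - 2 * h < Γ) :
    Low J h Γ A (A ∪ hexTorus L (chain c d (s + 1))) ∧
      per (A ∪ hexTorus L (chain c d (s + 1))) ≤ per A + 1 ∧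
      (per (A ∪ hexTorus L (chain c d (s + 1))) ≤ per A ∨ (2 * ((s + 1 + 5) / 6) ≤ L →
        A.card + 2 * (s / 6) ≤ (A ∪ hexTorus L (chain c d (s + 1))).card + 1)) := by
  have h1 := le_sideLength_chain c d s
  have h2 := low_union_hexTorus_grow (sideLength_chain_nonneg c d hs) (nonempty_chain c d hs)
    (k := d + Fin.ofNat 6 s) (by omega) hh hJ hcA hA
  rw [← chain_succ] at h2
  refine ⟨h2.1, h2.2.1, h2.2.2.imp_right fun h3 hL => ?_⟩
  have := h3 (injOn_chain c d hL)
  omega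

theorem low_chain (hh : 0 < h) (hJ : h < J) {c : ℤ × ℤ} {d : Fin 6} {s t : ℕ} (hs : 6 ≤ s)
    (hst : s ≤ t) (hL : 2 * ((t + 5) / 6) ≤ L) (hp : per (hexTorus L (chain c d s)) ≤ s)
    (hE₀ : chainEnergy J h s < Γ)
    (hE : ∀ u, s ≤ u → u < t → chainEnergy J h u + 2 * J - 2 * h < Γ) :
    Low J h Γ (hexTorus L (chain c d s)) (hexTorus L (chain c d t)) ∧
      per (hexTorus L (chain c d t)) ≤ t := by
  induction t, hst using Nat.le_induction with
  | base => exact ⟨.refl ((energy_chain_le (hh.trans hJ) hs hL hp).trans_lt hE₀), hp⟩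
  | succ t hst ih =>
    obtain ⟨l1, p1⟩ := ih (by omega) fun u h1 h2 => hE u h1 (by omega)
    have e1 := energy_chain_le (J := J) (h := h) (hh.trans hJ) (hs.trans hst) (by omega) p1
    obtain ⟨l2, p2, -⟩ := low_union_chain_succ (Γ := Γ) (c := c) (d := d) hh hJ (hs.trans hst)
      Finset.Subset.rfl (by linarith [hE t hst (by omega)])
    rw [Finset.union_eq_right.2 (hexTorus_mono (chain_le_succ c d t))] at l2 p2
    exact ⟨l1.trans l2, p2.trans (by omega)⟩

/-! ### Covering the torus -/

/-- Either the bar meets A and the perimeter does not rise, or it contributes at least 2 R - 1 new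
faces, which are worth J. -/
theorem low_union_chain_of_large (hh : 0 < h) (hJ : h < J) {R : ℕ} (hR : 1 ≤ R)
    (hJR : J ≤ (2 * R - 1) * h) {E : ℝ} (hE : E + 2 * J - 2 * h < Γ) {c : ℤ × ℤ} {d : Fin 6}
    {s : ℕ} (hs : 6 * R ≤ s) (hL : 2 * ((s + 1 + 5) / 6) ≤ L)
    (hcA : hexTorus L (chain c d s) ⊆ A) (hA : energy J h A ≤ E) :
    Low J h Γ A (A ∪ hexTorus L (chain c d (s + 1))) ∧
      energy J h (A ∪ hexTorus L (chain c d (s + 1))) ≤ E := by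
  obtain ⟨l, p, q⟩ := low_union_chain_succ (Γ := Γ) hh hJ (by omega) hcA (by linarith)
  refine ⟨l, ?_⟩
  rcases q with q | q
  · exact (energy_le_of_per_le hh (hh.trans hJ) Finset.subset_union_left q).trans hA
  · have h1 : A.card + 2 * R ≤ (A ∪ hexTorus L (chain c d (s + 1))).card + 1 := by
      have := q hL
      omega
    have h2 : (A.card : ℝ) + 2 * R ≤ (A ∪ hexTorus L (chain c d (s + 1))).card + 1 := by
      exact_mod_cast h1
    have h3 : (per (A ∪ hexTorus L (chain c d (s + 1))) : ℝ) ≤ per A + 1 := by exact_mod_cast p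
    have h4 := mul_le_mul_of_nonneg_left h3 (hh.trans hJ).le
    have h5 := mul_le_mul_of_nonneg_left h2 hh.le
    rw [energy] at hA ⊢
    linarith

theorem mem_hexTorus_chain {R : ℕ} (hR : 1 ≤ R) (c : ℤ × ℤ) (d : Fin 6) :
    toTorus L (c, true) ∈ hexTorus L (chain c d (6 * R)) ∧
      toTorus L ((c.1 - 1, c.2), false) ∈ hexTorus L (chain c d (6 * R)) := by
  constructor <;> refine Finset.mem_image_of_mem _ (mem_hexFin.2 fun k => ?_) <;>
    rw [chain_mul_six] <;> fin_cases k <;> simp [top, strip, sideForm] <;> omega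

theorem eq_univ_of_translates {R : ℕ} (hR : 1 ≤ R)
    (h0 : ∃ c d, hexTorus L (chain c d (6 * R)) ⊆ A)
    (hx : ∀ c d, hexTorus L (chain c d (6 * R)) ⊆ A →
      hexTorus L (chain (c.1 + 1, c.2) d (6 * R)) ⊆ A)
    (hy : ∀ c d, hexTorus L (chain c d (6 * R)) ⊆ A →
      hexTorus L (chain (c.1, c.2 + 1) d (6 * R)) ⊆ A) : A = Finset.univ := by
  obtain ⟨c, d, hc⟩ := h0
  have h1 : ∀ m : ℕ, hexTorus L (chain (c.1 + m, c.2) d (6 * R)) ⊆ A := by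
    intro m
    induction m with
    | zero => simpa using hc
    | succ m ih =>
      have := hx _ _ ih
      push_cast
      rwa [← add_assoc]
  have h2 : ∀ m n : ℕ, hexTorus L (chain (c.1 + m, c.2 + n) d (6 * R)) ⊆ A := by
    intro m n
    induction n with
    | zero => simpa using h1 m
    | succ n ih =>
      have := hy _ _ ih
      push_cast
      rwa [← add_assoc]
  have h3 : ∀ x y : ZMod L, ∃ e : ℤ × ℤ, (e.1 : ZMod L) = x ∧ (e.2 : ZMod L) = y ∧
      hexTorus L (chain e d (6 * R)) ⊆ A := fun x y =>
    ⟨_, by simp, by simp, h2 (x - c.1).val (y - c.2).val⟩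
  ext ⟨⟨x, y⟩, t⟩
  simp only [Finset.mem_univ, iff_true]
  cases t
  · obtain ⟨e, ex, ey, he⟩ := h3 (x + 1) y
    have := he (mem_hexTorus_chain hR e d).2
    rwa [toTorus, Int.cast_sub, ex, ey, Int.cast_one, add_sub_cancel_right] at this
  · obtain ⟨e, ex, ey, he⟩ := h3 x y
    have := he (mem_hexTorus_chain hR e d).1
    rwa [toTorus, ex, ey] at this

/-- As long as A is not everything, it contains a regular hexagon one of whose unit translates it
does not contain. Two bars on that hexagon cover the translate, enlarge A and keep the energy at
most E. -/
theorem low_univ (hh : 0 < h) (hJ : h < J) {R : ℕ} (hR : 1 ≤ R) (hL : 2 * R + 2 ≤ L)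
    (hJR : J ≤ (2 * R - 1) * h) {E : ℝ} (hE : E + 2 * J - 2 * h < Γ) :
    ∀ (n : ℕ) (A : Finset (Site (ZMod L))), Aᶜ.card ≤ n →
      (∃ c d, hexTorus L (chain c d (6 * R)) ⊆ A) → energy J h A ≤ E →
      Low J h Γ A Finset.univ := by
  have key : ∀ (A : Finset (Site (ZMod L))) (c : ℤ × ℤ) (d : Fin 6),
      hexTorus L (chain c d (6 * R)) ⊆ A → energy J h A ≤ E →
      ∃ B, A ⊆ B ∧ hexTorus L (chain c d (6 * R + 2)) ⊆ B ∧ Low J h Γ A B ∧ energy J h B ≤ E := by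
    intro A c d hc hA
    obtain ⟨l1, e1⟩ := low_union_chain_of_large (Γ := Γ) hh hJ hR hJR hE (s := 6 * R) le_rfl
      (by omega) hc hA
    obtain ⟨l2, e2⟩ := low_union_chain_of_large (Γ := Γ) hh hJ hR hJR hE (s := 6 * R + 1)
      (by omega) (by omega) (c := c) (d := d) Finset.subset_union_right e1
    exact ⟨_, Finset.subset_union_left.trans Finset.subset_union_left, Finset.subset_union_right,
      l1.trans l2, e2⟩
  have two : ∀ c d, chain c d (6 * R + 2) = quasiHexBounds c R 2 d := fun c d =>
    chain_eq c d R 2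
  -- Moving along the first axis advances only the sides 0, 1 on the front; along the second axis,
  -- the sides 1, 2. Two consecutive bars therefore suffice.
  have sx : ∀ c d, hexTorus L (chain (c.1 + 1, c.2) d (6 * R)) ⊆
      hexTorus L (chain c 0 (6 * R + 2)) := fun c d => hexTorus_mono fun k => by
    rw [chain_mul_six, two]
    fin_cases k <;> simp [quasiHexBounds, sideForm] <;> omega
  have sy : ∀ c d, hexTorus L (chain (c.1, c.2 + 1) d (6 * R)) ⊆
      hexTorus L (chain c 1 (6 * R + 2)) := fun c d => hexTorus_mono fun k => by
    rw [chain_mul_six, two]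
    fin_cases k <;> simp [quasiHexBounds, sideForm] <;> omega
  have hd : ∀ c d d', chain c d (6 * R) = chain c d' (6 * R) := fun c d d' => by
    funext k
    rw [chain_mul_six, chain_mul_six]
  intro n
  induction n with
  | zero =>
    intro A hn _ hA
    have : A = Finset.univ := by
      rw [← Finset.compl_eq_empty_iff, ← Finset.card_eq_zero]
      omega
    rw [← this]
    exact .refl (by linarith)
  | succ n ih =>
    intro A hn hc hA
    have grow : ∀ B : Finset (Site (ZMod L)), A ⊆ B → ¬ B ⊆ A → Bᶜ.card ≤ n := fun B h1 h2 => by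
      have := Finset.card_lt_card (Finset.compl_ssubset_compl.2 ⟨h1, h2⟩)
      omega
    by_cases hx : ∀ c d, hexTorus L (chain c d (6 * R)) ⊆ A →
      hexTorus L (chain (c.1 + 1, c.2) d (6 * R)) ⊆ A
    · by_cases hy : ∀ c d, hexTorus L (chain c d (6 * R)) ⊆ A →
        hexTorus L (chain (c.1, c.2 + 1) d (6 * R)) ⊆ A
      · rw [← eq_univ_of_translates hR hc hx hy]
        exact .refl (by linarith)
      · push Not at hy
        obtain ⟨c, d, hc, hn'⟩ := hy
        rw [hd c d 1] at hc
        obtain ⟨B, hAB, hcB, l, e⟩ := key A c 1 hc hA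
        exact l.trans (ih B (grow B hAB fun h1 => hn' ((sy c d).trans (hcB.trans h1)))
          ⟨_, d, (sy c d).trans hcB⟩ e)
    · push Not at hx
      obtain ⟨c, d, hc, hn'⟩ := hx
      rw [hd c d 0] at hc
      obtain ⟨B, hAB, hcB, l, e⟩ := key A c 0 hc hA
      exact l.trans (ih B (grow B hAB fun h1 => hn' ((sx c d).trans (hcB.trans h1)))
        ⟨_, d, (sx c d).trans hcB⟩ e)

end Growth

/-! ### Two faces on a longest side of a critical hexagon -/

/-- The area is s² / 6 up to a defect between 0 and 7, while consecutive squares are too far apart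
for another perimeter s. -/
theorem eq_chain_of_card {b : Fin 6 → ℤ} (hb : IsQuasiRegular b) {N p : ℕ}
    (hN : (hexFin b).card = N) (hNp : 6 * N + 7 = p ^ 2) (hp : 7 ≤ p) :
    ∃ c d, b = chain c d p ∧ defect (Fin.ofNat 6 p) = 7 := by
  obtain ⟨c, r, i, d, hr, hi, rfl⟩ := hb
  have h1 := chain_eq c d r ⟨i, by omega⟩
  simp only at h1
  rw [← h1] at hN ⊢
  have h2 := card_chain c d (s := 6 * r + i) (by omega)
  have h3 : ∀ i, 0 ≤ defect i ∧ defect i ≤ 7 := by decide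
  have h4 := h3 (Fin.ofNat 6 (6 * r + i))
  obtain ⟨s, hs⟩ : ∃ s, s = 6 * r + i := ⟨_, rfl⟩
  rw [← hs] at h2 h4 hN ⊢
  have h5 : p = s := by
    rw [hN] at h2
    zify at *
    apply le_antisymm
    · by_contra! h
      nlinarith
    · by_contra! h
      nlinarith
  subst h5
  refine ⟨c, d, rfl, ?_⟩
  rw [hN] at h2
  zify at hNp
  omega

/-- Defect 7 means one or five bars. A longest side is then next to the only bar or is the only side
without a bar, so the grown hexagon is again quasi-regular, possibly with another first side. -/
theorem exists_grow_chain {c : ℤ × ℤ} {d k : Fin 6} {s : ℕ} (hs : defect (Fin.ofNat 6 s) = 7)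
    (hk : IsLongestSide (chain c d s) k) : ∃ d', grow (chain c d s) k = chain c d' (s + 1) := by
  obtain ⟨r, i, rfl⟩ := exists_eq_six_mul_add s
  have e : Fin.ofNat 6 (6 * r + i) = i := Fin.ext (by simp [Fin.ofNat])
  rw [e] at hs
  have key : ∀ i : Fin 6, defect i = 7 → ∀ d k : Fin 6,
      (∀ k' : Fin 6, ((if (k' - 1 - d).val < i.val then (1 : ℤ) else 0) +
        (if (k' + 1 - d).val < i.val then 1 else 0) - if (k' - d).val < i.val then 1 else 0) ≤
        (if (k - 1 - d).val < i.val then 1 else 0) +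
        (if (k + 1 - d).val < i.val then 1 else 0) - if (k - d).val < i.val then 1 else 0) →
      ∃ d' : Fin 6, ∀ j : Fin 6, (if (j - d).val < i.val then (1 : ℤ) else 0) +
        (if j = k then 1 else 0) = (if (j - d').val < i.val then (1 : ℤ) else 0) +
        if j = d' + i then 1 else 0 := by decide
  rw [chain_eq] at hk ⊢
  obtain ⟨d', hd'⟩ := key i hs d k fun k' => by
    have := hk k'
    rw [sideLength_quasiHexBounds, sideLength_quasiHexBounds] at this
    linarith
  refine ⟨d', ?_⟩
  rw [chain_succ, chain_eq, e]
  have hg : ∀ d k j, grow (quasiHexBounds c r i d) k j = sideForm j c + r +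
      ((if (j - d).val < i.val then 1 else 0) + if j = k then 1 else 0) := by
    intro d k j
    by_cases h : j = k
    · rw [h, grow, Function.update_self, quasiHexBounds, if_pos rfl]
      ring
    · rw [grow, Function.update_of_ne h, quasiHexBounds, if_neg h]
      ring
  funext j
  rw [hg, hg, hd']

theorem exists_three_faces_of_adj {b : Fin 6 → ℤ} {k : Fin 6} {F : ℤ → Site ℤ} {i₀ i₁ i₂ : Fin 3}
    (hF : IsBar b k F i₀ i₁ i₂) {m m' : ℤ} (hm : 0 ≤ m ∧ m < 2 * sideLength b k - 1)
    (hm' : 0 ≤ m' ∧ m' < 2 * sideLength b k - 1) (hadj : m' = m + 1) :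
    ∃ a n q : ℤ, ({F m, F m'} : Set (Site ℤ)) = {F (2 * a), F n} ∧
      (0 ≤ 2 * a ∧ 2 * a < 2 * sideLength b k - 1) ∧ (0 ≤ n ∧ n < 2 * sideLength b k - 1) ∧
      (0 ≤ q ∧ q < 2 * sideLength b k - 1) ∧ n ≠ 2 * a ∧ q ≠ 2 * a ∧ q ≠ n ∧
      1 ≤ deg (insert (F (2 * a)) (hexFin b)) (F n) ∧
      2 ≤ deg (insert (F n) (insert (F (2 * a)) (hexFin b))) (F q) := by
  subst hadj
  rcases Int.even_or_odd' m with ⟨a, rfl | rfl⟩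
  · refine ⟨a, 2 * a + 1, 2 * a + 2, rfl, hm, hm', by omega, by omega, by omega, by omega, ?_, ?_⟩
    · exact one_le_deg i₀ (by rw [hF.nb_odd_zero]; simp)
    · have h1 := hF.nb_even_one (a + 1)
      have h2 := hF.below (a + 1) (by omega) (by omega)
      rw [show 2 * (a + 1) - 1 = 2 * a + 1 by ring, show 2 * (a + 1) = 2 * a + 2 by ring] at h1
      rw [show 2 * (a + 1) = 2 * a + 2 by ring] at h2
      exact two_le_deg hF.ne₁₂ (by rw [h1]; simp) (by simp [h2])
  · refine ⟨a + 1, 2 * a + 1, 2 * a, ?_, by omega, hm, by omega, by omega, by omega, by omega,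
      ?_, ?_⟩
    · rw [Set.pair_comm, show 2 * a + 1 + 1 = 2 * (a + 1) by ring]
    · refine one_le_deg i₁ ?_
      rw [hF.nb_odd_one, show 2 * (a + 1) = 2 * a + 2 by ring]
      simp
    · have h2 := hF.below a (by omega) (by omega)
      exact two_le_deg hF.ne₀₂ (by rw [hF.nb_even_zero]; simp) (by simp [h2])

theorem exists_three_faces_of_even {b : Fin 6 → ℤ} {k : Fin 6} {F : ℤ → Site ℤ} {i₀ i₁ i₂ : Fin 3}
    (hF : IsBar b k F i₀ i₁ i₂) {a : ℤ} (hm : 0 ≤ 2 * a ∧ 2 * a < 2 * sideLength b k - 1)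
    (hm' : 0 ≤ 2 * a + 2 ∧ 2 * a + 2 < 2 * sideLength b k - 1) :
    ∃ q : ℤ, (0 ≤ q ∧ q < 2 * sideLength b k - 1) ∧ q ≠ 2 * a ∧ q ≠ 2 * a + 2 ∧
      1 ≤ deg (insert (F (2 * a)) (hexFin b)) (F (2 * a + 2)) ∧
      2 ≤ deg (insert (F (2 * a + 2)) (insert (F (2 * a)) (hexFin b))) (F q) := by
  refine ⟨2 * a + 1, by omega, by omega, by omega, ?_, ?_⟩
  · have h2 := hF.below (a + 1) (by omega) (by omega)
    rw [show 2 * (a + 1) = 2 * a + 2 by ring] at h2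
    exact one_le_deg i₂ (by simp [h2])
  · exact two_le_deg hF.ne₀₁ (by rw [hF.nb_odd_zero]; simp) (by rw [hF.nb_odd_one]; simp)

theorem index_of_adj {b : Fin 6 → ℤ} {k : Fin 6} {F : ℤ → Site ℤ} {i₀ i₁ i₂ : Fin 3}
    (hF : IsBar b k F i₀ i₁ i₂) {m m' : ℤ} (hm : 0 ≤ m ∧ m < 2 * sideLength b k - 1)
    (hm' : 0 ≤ m' ∧ m' < 2 * sideLength b k - 1) (h : (hexLattice ℤ).Adj (F m) (F m')) :
    m' = m + 1 ∨ m = m' + 1 := by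
  obtain ⟨i, hi⟩ := (hexLattice_adj_iff _ _).1 h
  rcases Int.even_or_odd' m with ⟨a, rfl | rfl⟩
  · rcases hF.index_cases i with rfl | rfl | rfl
    · rw [hF.nb_even_zero, hF.inj.eq_iff] at hi
      omega
    · rw [hF.nb_even_one, hF.inj.eq_iff] at hi
      omega
    · exact absurd (hi ▸ hF.below a (by omega) (by omega)) (hF.notMem m')
  · rcases hF.index_cases i with rfl | rfl | rfl
    · rw [hF.nb_odd_zero, hF.inj.eq_iff] at hi
      omega
    · rw [hF.nb_odd_one, hF.inj.eq_iff] at hi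
      omega
    · exact absurd (hi ▸ ((hF.mem (F m')).2 ⟨m', hm'.1, hm'.2, rfl⟩).1) (hF.above a)

theorem index_of_dist {b : Fin 6 → ℤ} {k : Fin 6} {F : ℤ → Site ℤ} {i₀ i₁ i₂ : Fin 3}
    (hF : IsBar b k F i₀ i₁ i₂) {a a' : ℤ} (hm : 0 ≤ 2 * a ∧ 2 * a < 2 * sideLength b k - 1)
    (hm' : 0 ≤ 2 * a' ∧ 2 * a' < 2 * sideLength b k - 1)
    (h : (hexLattice ℤ).dist (F (2 * a)) (F (2 * a')) = 2) : a' = a + 1 ∨ a = a' + 1 := by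
  have hne : a ≠ a' := by
    rintro rfl
    simp at h
  have hr : (hexLattice ℤ).Reachable (F (2 * a)) (F (2 * a')) := by
    by_contra hr
    rw [SimpleGraph.dist_eq_zero_of_not_reachable hr] at h
    omega
  obtain ⟨ω, hω⟩ := hr.exists_walk_length_eq_dist
  rw [h] at hω
  obtain ⟨u, h1, h2⟩ : ∃ u, (hexLattice ℤ).Adj (F (2 * a)) u ∧
      (hexLattice ℤ).Adj u (F (2 * a')) := by
    have key : ∀ {v w : Site ℤ} (ω : (hexLattice ℤ).Walk v w), ω.length = 2 →
        ∃ u, (hexLattice ℤ).Adj v u ∧ (hexLattice ℤ).Adj u w := by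
      intro v w ω hω
      rcases ω with _ | ⟨h1, _ | ⟨h2, _ | ⟨h3, ω⟩⟩⟩
      · simp at hω
      · simp at hω
      · exact ⟨_, h1, h2⟩
      · simp at hω
    exact key ω hω
  obtain ⟨i, rfl⟩ := (hexLattice_adj_iff _ _).1 h1
  obtain ⟨j, hj⟩ := (hexLattice_adj_iff _ _).1 h2.symm
  rcases hF.index_cases i with rfl | rfl | rfl
  · rw [hF.nb_even_zero] at hj
    rcases hF.index_cases j with rfl | rfl | rfl
    · rw [hF.nb_even_zero, hF.inj.eq_iff] at hj
      omega
    · rw [hF.nb_even_one, hF.inj.eq_iff] at hj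
      omega
    · exact absurd (hj ▸ hF.below a' (by omega) (by omega)) (hF.notMem _)
  · rw [hF.nb_even_one] at hj
    rcases hF.index_cases j with rfl | rfl | rfl
    · rw [hF.nb_even_zero, hF.inj.eq_iff] at hj
      omega
    · rw [hF.nb_even_one, hF.inj.eq_iff] at hj
      omega
    · exact absurd (hj ▸ hF.below a' (by omega) (by omega)) (hF.notMem _)
  · have hb := hF.below a (by omega) (by omega)
    rcases hF.index_cases j with rfl | rfl | rfl
    · rw [hj, hF.nb_even_zero] at hb
      exact absurd hb (hF.notMem _)
    · rw [hj, hF.nb_even_one] at hb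
      exact absurd hb (hF.notMem _)
    · have := congrArg (fun f => nb f j) hj
      simp only [nb_nb] at this
      rw [hF.inj.eq_iff] at this
      omega

/-- Two faces that form an elementary rhombus in a bar, or that are attached to the side at
distance two: one of them is attached to the side, and the next face of the bar to be filled
shares two edges with the cluster. -/
theorem exists_three_faces {b : Fin 6 → ℤ} {k : Fin 6} {F : ℤ → Site ℤ} {i₀ i₁ i₂ : Fin 3}
    (hF : IsBar b k F i₀ i₁ i₂) {f g : Site ℤ} (hf : f ∈ sideBar b k) (hg : g ∈ sideBar b k)
    (hfg : (hexLattice ℤ).Adj f g ∨ IsAttachedTo f (hexagon b) ∧ IsAttachedTo g (hexagon b) ∧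
      (hexLattice ℤ).dist f g = 2) :
    ∃ a n q : ℤ, ({f, g} : Set (Site ℤ)) = {F (2 * a), F n} ∧
      (0 ≤ 2 * a ∧ 2 * a < 2 * sideLength b k - 1) ∧ (0 ≤ n ∧ n < 2 * sideLength b k - 1) ∧
      (0 ≤ q ∧ q < 2 * sideLength b k - 1) ∧ n ≠ 2 * a ∧ q ≠ 2 * a ∧ q ≠ n ∧
      1 ≤ deg (insert (F (2 * a)) (hexFin b)) (F n) ∧
      2 ≤ deg (insert (F n) (insert (F (2 * a)) (hexFin b))) (F q) := by
  rw [sideBar_eq] at hf hg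
  obtain ⟨m, hm0, hm1, rfl⟩ := (hF.mem f).1 hf
  obtain ⟨m', hm0', hm1', rfl⟩ := (hF.mem g).1 hg
  rcases hfg with h | ⟨af, ag, h⟩
  · rcases index_of_adj hF ⟨hm0, hm1⟩ ⟨hm0', hm1'⟩ h with e | e
    · exact exists_three_faces_of_adj hF ⟨hm0, hm1⟩ ⟨hm0', hm1'⟩ e
    · rw [Set.pair_comm]
      exact exists_three_faces_of_adj hF ⟨hm0', hm1'⟩ ⟨hm0, hm1⟩ e
  · have att : ∀ m, IsAttachedTo (F m) (hexagon b) → ∃ a, m = 2 * a := by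
      rintro m ⟨e, he, hadj⟩
      obtain ⟨i, rfl⟩ := (hexLattice_adj_iff _ _).1 hadj
      rw [← coe_hexFin, Finset.mem_coe] at he
      exact hF.even_of_deg (one_le_deg i he)
    obtain ⟨a, rfl⟩ := att m af
    obtain ⟨a', rfl⟩ := att m' ag
    rcases index_of_dist hF ⟨hm0, hm1⟩ ⟨hm0', hm1'⟩ h with rfl | rfl
    · rw [show 2 * (a + 1) = 2 * a + 2 by ring] at hm0' hm1' ⊢
      obtain ⟨q, h1, h2, h3, h4, h5⟩ := exists_three_faces_of_even hF ⟨hm0, hm1⟩ ⟨hm0', hm1'⟩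
      exact ⟨a, 2 * a + 2, q, rfl, ⟨hm0, hm1⟩, ⟨hm0', hm1'⟩, h1, by omega, h2, h3, h4, h5⟩
    · rw [show 2 * (a' + 1) = 2 * a' + 2 by ring] at hm0 hm1 ⊢
      obtain ⟨q, h1, h2, h3, h4, h5⟩ := exists_three_faces_of_even hF ⟨hm0', hm1'⟩ ⟨hm0, hm1⟩
      exact ⟨a', 2 * a' + 2, q, Set.pair_comm _ _, ⟨hm0', hm1'⟩, ⟨hm0, hm1⟩, h1, by omega, h2, h3,
        h4, h5⟩

/-! ### Paths through the gate -/

/-- Among the quasi-regular hexagons of perimeter at most `6 R`, those of perimeter `p`, whose area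
is `N`, have the highest energy, and further growth beyond perimeter `6 R` is favorable. -/
structure Barrier (L : ℕ) (J h : ℝ) (N p R : ℕ) : Prop where
  pos : 0 < h
  lt : h < J
  width : 2 * R + 2 ≤ L
  area_eq : 6 * N + 7 = p ^ 2
  seven_le : 7 ≤ p
  lt_mul : p + 1 ≤ 6 * R
  le_mul : J ≤ (2 * R - 1) * h
  start : 7 * J - 5 * h < J * (p + 2) - h * (N + 2)
  peak : ∀ s, 6 ≤ s → s ≤ 6 * R → s ≠ p →
    chainEnergy J h s + 2 * J - 2 * h < J * (p + 2) - h * (N + 2)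

theorem exists_planar_of_mem_gate {L A : ℕ} [NeZero L] {η : Config L}
    (hη : η ∈ canonicalConfigs L (A + 2) ∪ defectiveConfigs L (A + 2)) :
    ∃ b k f g, IsQuasiRegular b ∧ IsLongestSide b k ∧ f ∈ sideBar b k ∧ g ∈ sideBar b k ∧
      ((hexLattice ℤ).Adj f g ∨ IsAttachedTo f (hexagon b) ∧ IsAttachedTo g (hexagon b) ∧
        (hexLattice ℤ).dist f g = 2) ∧ (hexFin b).card = A ∧
      (plus η : Set (Site (ZMod L))) = toTorus L '' (hexFin b ∪ {f, g}) := by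
  have key : ∀ b k f g, f ∈ sideBar b k → g ∈ sideBar b k → f ≠ g →
      (hexagon b ∪ {f, g}).ncard = A + 2 → (hexFin b).card = A := by
    intro b k f g hf hg hfg hcard
    rw [sideBar_eq] at hf hg
    have e : hexagon b ∪ {f, g} = ((insert f (insert g (hexFin b)) : Finset (Site ℤ)) :
        Set (Site ℤ)) := by
      rw [← coe_hexFin]
      push_cast
      rw [Set.union_comm, Set.insert_union, Set.singleton_union]
    rw [e, Set.ncard_coe_finset, Finset.card_insert_of_notMem, Finset.card_insert_of_notMem hg.2]
      at hcard
    · omega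
    · simp [hfg, hf.2]
  rcases hη with ⟨P, ⟨b, k, f, g, hb, hk, hf, hg, hfg, rfl⟩, hcard, -, hP⟩ |
    ⟨P, ⟨b, k, f, g, hb, hk, hf, hg, af, ag, hfg, rfl⟩, hcard, -, hP⟩
  · exact ⟨b, k, f, g, hb, hk, hf, hg, Or.inl hfg, key b k f g hf hg hfg.ne hcard,
      by rw [coe_plus, hP, coe_hexFin]⟩
  · refine ⟨b, k, f, g, hb, hk, hf, hg, Or.inr ⟨af, ag, hfg⟩, key b k f g hf hg ?_ hcard,
      by rw [coe_plus, hP, coe_hexFin]⟩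
    rintro rfl
    simp at hfg

theorem deg_le_deg_image {L : ℕ} (P : Finset (Site ℤ)) (x : Site ℤ) :
    deg P x ≤ deg (P.image (toTorus L)) (toTorus L x) :=
  Finset.card_le_card fun i hi => by
    simp only [Finset.mem_filter, Finset.mem_univ, true_and] at hi ⊢
    rw [← toTorus_nb]
    exact Finset.mem_image_of_mem _ hi

theorem energy_le_of_bounds {L : ℕ} {J h : ℝ} (hJ : 0 < J) {A : Finset (Site (ZMod L))} {q n : ℕ}
    (hp : per A ≤ q) (hn : A.card = n) : energy J h A ≤ J * q - h * n := by
  have h1 : (per A : ℝ) ≤ q := by exact_mod_cast hp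
  have h2 := mul_le_mul_of_nonneg_left h1 hJ.le
  rw [energy, hn]
  linarith

@[simp] theorem conf_empty (L : ℕ) : conf (∅ : Finset (Site (ZMod L))) = allMinus L := by
  funext s
  simp [conf, allMinus]

@[simp] theorem conf_univ (L : ℕ) [NeZero L] :
    conf (Finset.univ : Finset (Site (ZMod L))) = allPlus L := by
  funext s
  simp [conf, allPlus]

namespace Barrier

variable {L N p R : ℕ} [NeZero L] {J h : ℝ}

theorem low_empty_chain (hB : Barrier L J h N p R) (c : ℤ × ℤ) (d : Fin 6) :
    Low J h (J * (p + 2) - h * (N + 2)) ∅ (hexTorus L (chain c d p)) ∧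
      per (hexTorus L (chain c d p)) ≤ p := by
  have h1 := hB.seven_le
  have h2 := hB.lt_mul
  have h3 := hB.width
  have h4 := hB.lt
  obtain ⟨l1, p1⟩ := low_chain_six (L := L) hB.pos hB.lt (by omega) hB.start c d
  obtain ⟨l2, p2⟩ := low_chain (L := L) hB.pos hB.lt (s := 6) (t := p) le_rfl (by omega) (by omega)
    p1 (by linarith [hB.peak 6 le_rfl (by omega) (by omega)])
    (fun u hu hup => hB.peak u hu (by omega) (by omega))
  exact ⟨l1.trans l2, p2⟩

theorem low_chain_univ (hB : Barrier L J h N p R) (c : ℤ × ℤ) (d : Fin 6)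
    (hp : per (hexTorus L (chain c d (p + 1))) ≤ p + 1) :
    Low J h (J * (p + 2) - h * (N + 2)) (hexTorus L (chain c d (p + 1))) Finset.univ := by
  have h1 := hB.seven_le
  have h2 := hB.lt_mul
  have h3 := hB.width
  have h4 := hB.lt
  obtain ⟨l1, p1⟩ := low_chain (L := L) hB.pos hB.lt (s := p + 1) (t := 6 * R) (by omega) h2
    (by omega) hp (by linarith [hB.peak (p + 1) (by omega) (by omega) (by omega)])
    (fun u hu hup => hB.peak u (by omega) (by omega) (by omega))
  exact l1.trans (low_univ hB.pos hB.lt (by omega) h3 hB.le_mul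
    (hB.peak (6 * R) (by omega) le_rfl (by omega)) _ _ le_rfl ⟨c, d, Finset.Subset.rfl⟩
    (energy_chain_le (hB.pos.trans hB.lt) (by omega) (by omega) p1))

/-- Every configuration of the gate is the only one of maximal energy of some path. -/
theorem exists_path (hB : Barrier L J h N p R) {η : Config L}
    (hη : η ∈ canonicalConfigs L (N + 2) ∪ defectiveConfigs L (N + 2)) :
    ∃ ω : Path (allMinus L) (allPlus L), η ∈ ω.support ∧
      (∀ ζ ∈ ω.support, ζ = η ∨ energy J h (plus ζ) < J * (p + 2) - h * (N + 2)) ∧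
      energy J h (plus η) ≤ J * (p + 2) - h * (N + 2) := by
  have hh := hB.pos
  have hJ := hB.lt
  have hJ0 := hh.trans hJ
  have hw := hB.width
  have hpR := hB.lt_mul
  have h7 := hB.seven_le
  obtain ⟨b, k, f, g, hb, hk, hf, hg, hfg, hcard, hplus⟩ := exists_planar_of_mem_gate hη
  obtain ⟨c, d, rfl, hdef⟩ := eq_chain_of_card hb hcard hB.area_eq h7
  obtain ⟨d', hd'⟩ := exists_grow_chain hdef hk
  obtain ⟨F, i₀, i₁, i₂, hF⟩ := exists_isBar k _ (sideLength_chain_nonneg c d (by omega))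
    (nonempty_chain c d (s := p) (by omega))
  obtain ⟨a, n, q, hset, ha, hn, hq, hna, hqa, hqn, dn, dq⟩ := exists_three_faces hF hf hg hfg
  obtain ⟨l, hl⟩ : ∃ l : ℕ, sideLength (chain c d p) k = l + 1 :=
    ⟨(sideLength (chain c d p) k - 1).toNat, by omega⟩
  have hinj : Set.InjOn (toTorus L) (hexFin (grow (chain c d p) k) : Set (Site ℤ)) := by
    rw [hd']
    exact injOn_chain c d' (by omega)
  obtain ⟨lowQ, pQ⟩ := hB.low_empty_chain c d
  have cQ : (hexTorus L (chain c d p)).card = N := by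
    rw [card_hexTorus_chain c d (by omega), hcard]
  have mem : ∀ m, (0 ≤ m ∧ m < 2 * sideLength (chain c d p) k - 1) →
      F m ∈ hexFin (grow (chain c d p) k) := fun m hm => ((hF.mem _).2 ⟨m, hm.1, hm.2, rfl⟩).1
  have ne : ∀ m m', (0 ≤ m ∧ m < 2 * sideLength (chain c d p) k - 1) →
      (0 ≤ m' ∧ m' < 2 * sideLength (chain c d p) k - 1) → m ≠ m' →
      toTorus L (F m) ≠ toTorus L (F m') := fun m m' hm hm' hne e =>
    hne (hF.inj (hinj (mem m hm) (mem m' hm') e))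
  have notMem : ∀ m, (0 ≤ m ∧ m < 2 * sideLength (chain c d p) k - 1) →
      toTorus L (F m) ∉ hexTorus L (chain c d p) := by
    intro m hm hmem
    obtain ⟨v, hv, e⟩ := Finset.mem_image.1 hmem
    have := hinj (hexFin_mono (le_grow _ k) hv) (mem m hm) e
    exact hF.notMem m (this ▸ hv)
  set Q := hexTorus L (chain c d p) with hQ
  have d1 : 1 ≤ deg Q (toTorus L (F (2 * a))) := one_le_deg i₂
    (hF.nb_mem hl Finset.Subset.rfl a (by omega) (by omega))
  have d2 : 1 ≤ deg (insert (toTorus L (F (2 * a))) Q) (toTorus L (F n)) := by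
    have := deg_le_deg_image (L := L) (insert (F (2 * a)) (hexFin (chain c d p))) (F n)
    rw [Finset.image_insert] at this
    exact dn.trans this
  have d3 : 2 ≤ deg (insert (toTorus L (F n)) (insert (toTorus L (F (2 * a))) Q))
      (toTorus L (F q)) := by
    have := deg_le_deg_image (L := L) (insert (F n) (insert (F (2 * a)) (hexFin (chain c d p))))
      (F q)
    rw [Finset.image_insert, Finset.image_insert] at this
    exact dq.trans this
  have n1 := notMem _ ha
  have n2 : toTorus L (F n) ∉ insert (toTorus L (F (2 * a))) Q := by
    rw [Finset.mem_insert, not_or]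
    exact ⟨ne _ _ hn ha hna, notMem _ hn⟩
  have n3 : toTorus L (F q) ∉ insert (toTorus L (F n)) (insert (toTorus L (F (2 * a))) Q) := by
    rw [Finset.mem_insert, Finset.mem_insert, not_or, not_or]
    exact ⟨ne _ _ hq hn hqn, ne _ _ hq ha hqa, notMem _ hq⟩
  have p1 := per_insert_le_of_one n1 d1
  have p2 := per_insert_le_of_one n2 d2
  have p3 := per_insert_le_of_two n3 d3
  have c1 := Finset.card_insert_of_notMem n1
  have c2 := Finset.card_insert_of_notMem n2
  have c3 := Finset.card_insert_of_notMem n3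
  have hηQ : plus η = insert (toTorus L (F n)) (insert (toTorus L (F (2 * a))) Q) := by
    rw [← Finset.coe_inj, hplus, hset, hQ]
    push_cast [hexTorus]
    rw [Set.image_union, Set.image_pair, Set.union_comm, Set.insert_union, Set.singleton_union,
      Set.insert_comm]
  set Q₁ := insert (toTorus L (F (2 * a))) Q with hQ₁
  set Q₂ := insert (toTorus L (F n)) Q₁ with hQ₂
  set Q₃ := insert (toTorus L (F q)) Q₂ with hQ₃
  -- Only `Q₂` may reach Γ: the bound for `Q₁` is lower by J - h and the one for `Q₃` by J + h.
  -- Filling the rest of the bar from `Q₃` stays 2 h below Γ.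
  have e0 := energy_le_of_bounds (h := h) hJ0 pQ cQ
  have e1 := energy_le_of_bounds (h := h) (A := Q₁) (q := p + 1) (n := N + 1) hJ0 (by omega)
    (by omega)
  have e2 := energy_le_of_bounds (h := h) (A := Q₂) (q := p + 2) (n := N + 2) hJ0 (by omega)
    (by omega)
  have e3 := energy_le_of_bounds (h := h) (A := Q₃) (q := p + 1) (n := N + 3) hJ0 (by omega)
    (by omega)
  push_cast at e1 e2 e3
  have hsub : Q ⊆ Q₃ := ((Finset.subset_insert _ _).trans (Finset.subset_insert _ _)).trans
    (Finset.subset_insert _ _)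
  obtain ⟨l3, p4⟩ := low_fill_of_even_mem (Γ := J * (p + 2) - h * (N + 2)) (A := Q₃) (n := l)
    (hF.isRow (L := L)) hh hJ (hF.nb_mem hl hsub) (a := a) (by omega) (by omega)
    (by simp [hQ₃, hQ₂, hQ₁]) (by linarith)
  have hgrow : Q₃ ∪ (Finset.Icc 0 (2 * l : ℤ)).image (fun m => toTorus L (F m)) =
      hexTorus L (chain c d' (p + 1)) := by
    rw [← hd', hF.hexTorus_grow hl]
    refine Finset.Subset.antisymm (Finset.union_subset ?_ Finset.subset_union_right)
      (Finset.union_subset_union hsub Finset.Subset.rfl)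
    rw [← hF.hexTorus_grow hl, hQ₃, hQ₂, hQ₁]
    refine Finset.insert_subset (Finset.mem_image_of_mem _ (mem q hq)) (Finset.insert_subset
      (Finset.mem_image_of_mem _ (mem n hn)) (Finset.insert_subset
      (Finset.mem_image_of_mem _ (mem _ ha)) (hexTorus_mono (le_grow _ k))))
  rw [hgrow] at l3 p4
  have lowdown : Low J h (J * (p + 2) - h * (N + 2)) ∅ Q₁ :=
    lowQ.trans (.insert (by linarith) (by linarith))
  have lowup : Low J h (J * (p + 2) - h * (N + 2)) Q₃ Finset.univ :=
    l3.trans (hB.low_chain_univ c d' (by omega))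
  obtain ⟨ω₁, hω₁⟩ := lowdown
  obtain ⟨ω₂, hω₂⟩ := lowup
  have hη2 : conf Q₂ = η := by rw [← hηQ, conf_plus]
  have a1 := adj_insert n2
  have a2 := adj_insert n3
  rw [← hQ₂, hη2] at a1
  rw [hη2] at a2
  rw [← conf_empty, ← conf_univ]
  refine ⟨ω₁.append (.cons a1 (.cons a2 ω₂)), ?_, fun ζ hζ => ?_, by rw [hηQ]; exact e2⟩
  · rw [SimpleGraph.Walk.mem_support_append_iff]
    simp
  · rw [SimpleGraph.Walk.mem_support_append_iff] at hζ
    simp only [SimpleGraph.Walk.support_cons, List.mem_cons] at hζ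
    rcases hζ with hζ | rfl | rfl | hζ
    · exact Or.inr (hω₁ _ hζ)
    · exact Or.inr (hω₁ _ (SimpleGraph.Walk.end_mem_support _))
    · exact Or.inl rfl
    · exact Or.inr (hω₂ _ hζ)

/-- The barrier can be crossed at every height above the energy of the gate. -/
theorem low_of_lt (hB : Barrier L J h N p R) {Γ : ℝ} (hΓ : J * (p + 2) - h * (N + 2) < Γ) :
    Low J h Γ ∅ (Finset.univ : Finset (Site (ZMod L))) := by
  have h1 := hB.seven_le
  have h2 := hB.lt_mul
  have h3 := hB.width
  have h4 := hB.lt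
  have h5 := hB.area_eq
  -- By 6 N + 7 = p², the residue of p modulo 6 is 1 or 5.
  have hdef : defect (Fin.ofNat 6 p) = 7 := by
    obtain ⟨r, i, rfl⟩ := exists_eq_six_mul_add p
    have e : Fin.ofNat 6 (6 * r + i) = i := Fin.ext (by simp [Fin.ofNat])
    rw [e]
    have h6 : (6 * r + (i : ℕ)) ^ 2 = 6 * (6 * r ^ 2 + 2 * r * i) + (i : ℕ) ^ 2 := by ring
    rw [h6] at h5
    fin_cases i <;> first | rfl | (exfalso; simp at h5; omega)
  have hp : chainEnergy J h p + 2 * J - 2 * h ≤ J * (p + 2) - h * (N + 2) := by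
    have h6 : (6 : ℝ) * N + 7 = (p : ℝ) ^ 2 := by exact_mod_cast h5
    rw [chainEnergy, hdef, ← h6]
    push_cast
    linarith
  have hall : ∀ s, 6 ≤ s → s ≤ 6 * R → chainEnergy J h s + 2 * J - 2 * h < Γ := by
    intro s hs hsR
    by_cases e : s = p
    · rw [e]
      linarith
    · exact (hB.peak s hs hsR e).trans hΓ
  obtain ⟨l1, p1⟩ := low_chain_six (L := L) hB.pos hB.lt (by omega) (hB.start.trans hΓ) 0 0
  obtain ⟨l2, p2⟩ := low_chain (L := L) hB.pos hB.lt (s := 6) (t := 6 * R) le_rfl (by omega)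
    (by omega) p1 (by linarith [hall 6 le_rfl (by omega)])
    (fun u hu hup => hall u hu hup.le)
  exact (l1.trans l2).trans (low_univ hB.pos hB.lt (by omega) h3 hB.le_mul
    (hall (6 * R) (by omega) le_rfl) _ _ le_rfl ⟨0, 0, Finset.Subset.rfl⟩
    (energy_chain_le (hB.pos.trans hB.lt) (by omega) (by omega) p2))

end Barrier

/-! ### The gate -/

section Gate

variable {L N p M R : ℕ} [NeZero L] {J h : ℝ}

theorem card_plus_of_mem_gate {A : ℕ} {η : Config L}
    (hη : η ∈ canonicalConfigs L A ∪ defectiveConfigs L A) : (plus η).card = A := by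
  have key : ∀ P : Set (Site ℤ), P.ncard = A → HasCluster η P → (plus η).card = A := by
    rintro P hP ⟨hinj, h⟩
    rw [← Set.ncard_coe_finset, coe_plus, h, hinj.ncard_image, hP]
  rcases hη with ⟨P, -, hP, h⟩ | ⟨P, -, hP, h⟩ <;> exact key P hP h

theorem Critical.le_energy (hc : Critical L N p M) (hJ : 0 < J) {η : Config L}
    (hη : η ∈ canonicalConfigs L (N + 2) ∪ defectiveConfigs L (N + 2)) :
    J * (p + 2) - h * (N + 2) ≤ energy J h (plus η) := by
  have h1 := card_plus_of_mem_gate hη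
  have h2 : ((p : ℝ) + 2) ≤ per (plus η) := by exact_mod_cast hc.add_two_le_per h1
  have h3 := mul_le_mul_of_nonneg_left h2 hJ.le
  rw [energy, h1]
  push_cast
  linarith

theorem Critical.exists_mem_gate_of_energy_le (hc : Critical L N p M) (hh : 0 < h) (hJ : 0 < J)
    (hM : M * h < J + (N + 2) * h) (ω : Path (allMinus L) (allPlus L))
    (hω : ∀ ζ ∈ ω.support, energy J h (plus ζ) ≤ J * (p + 2) - h * (N + 2)) :
    ∃ ζ ∈ ω.support, ζ ∈ canonicalConfigs L (N + 2) ∪ defectiveConfigs L (N + 2) := by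
  have hcard : (Finset.univ : Finset (Site (ZMod L))).card = 2 * L ^ 2 := by
    rw [Finset.card_univ, Fintype.card_prod, Fintype.card_prod, ZMod.card, Fintype.card_bool]
    ring
  have hcut := hc.cut
  have hle := hc.le
  refine hc.exists_mem_gate _ ω le_rfl
    (fun ζ hζ => admissible_of_energy_le hh hJ hM (hω ζ hζ)) (by simp) ?_ ?_ ?_
  · rw [plus_allPlus, hcard]
    omega
  · rw [plus_allMinus]
    exact ⟨by simp; omega, Or.inl (by simp)⟩
  · rw [plus_allPlus]
    rintro ⟨h1, -⟩
    rw [hcard] at h1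
    have := Nat.zero_le (L * (p + 2))
    omega

theorem height_le_iff {σ η : Config L} {ω : Path σ η} {c : ℝ} :
    height J h ω ≤ c ↔ ∀ ζ ∈ ω.support, hamiltonian J h ζ ≤ c :=
  (Finset.sup'_le_iff _ _).trans (by simp)

theorem height_lt_iff {σ η : Config L} {ω : Path σ η} {c : ℝ} :
    height J h ω < c ↔ ∀ ζ ∈ ω.support, hamiltonian J h ζ < c :=
  (Finset.sup'_lt_iff _).trans (by simp)

theorem minimalGatesUnion_eq (hc : Critical L N p M) (hB : Barrier L J h N p R)
    (hM : M * h < J + (N + 2) * h) :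
    (∀ ω : Path (allMinus L) (allPlus L), IsOptimal J h ω →
      ∃ ζ ∈ ω.support, ζ ∈ canonicalConfigs L (N + 2) ∪ defectiveConfigs L (N + 2)) ∧
    minimalGatesUnion J h (allMinus L) (allPlus L) =
      canonicalConfigs L (N + 2) ∪ defectiveConfigs L (N + 2) := by
  have hJ0 := hB.pos.trans hB.lt
  have ham := hamiltonian_eq hc.two_le J h
  obtain ⟨Γ, hΓ⟩ : ∃ Γ, Γ = J * (p + 2) - h * (N + 2) := ⟨_, rfl⟩
  obtain ⟨W, hW⟩ : ∃ W, W = canonicalConfigs L (N + 2) ∪ defectiveConfigs L (N + 2) := ⟨_, rfl⟩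
  have hge : ∀ η ∈ W, Γ ≤ energy J h (plus η) := fun η hη => by
    rw [hΓ]
    exact hc.le_energy hJ0 (hW ▸ hη)
  have hmeet : ∀ ω : Path (allMinus L) (allPlus L),
      (∀ ζ ∈ ω.support, energy J h (plus ζ) ≤ Γ) → ∃ ζ ∈ ω.support, ζ ∈ W := fun ω hω => by
    rw [hW]
    exact hc.exists_mem_gate_of_energy_le hB.pos hJ0 hM ω (hΓ ▸ hω)
  -- Upper bound: the barrier can be crossed below any level above Γ. Lower bound: a path strictly
  -- below Γ would meet W, where the energy is at least Γ.
  have hΦ : commHeight J h (allMinus L) (allPlus L) = hamiltonian J h (allMinus L) + Γ := by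
    have hleast := commHeight_isLeast J h (allMinus L) (allPlus L)
    apply le_antisymm
    · refine le_of_forall_gt_imp_ge_of_dense fun c hcΓ => ?_
      have hlow := hB.low_of_lt (Γ := c - hamiltonian J h (allMinus L)) (by linarith)
      rw [Low, conf_empty, conf_univ] at hlow
      obtain ⟨ω, hω⟩ := hlow
      refine (hleast.2 ⟨ω, rfl⟩).trans (height_le_iff.2 fun ζ hζ => ?_)
      have := hω ζ hζ
      rw [ham]
      linarith
    · obtain ⟨ω, hω⟩ := hleast.1
      rw [← hω]
      by_contra! hlt
      rw [height_lt_iff] at hlt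
      have hlt' : ∀ ζ ∈ ω.support, energy J h (plus ζ) < Γ := fun ζ hζ => by
        have := hlt ζ hζ
        rw [ham] at this
        linarith
      obtain ⟨ζ, hζ, hζW⟩ := hmeet ω fun ζ hζ => (hlt' ζ hζ).le
      exact absurd (hge ζ hζW) (not_le.2 (hlt' ζ hζ))
  have hopt : ∀ ω : Path (allMinus L) (allPlus L), IsOptimal J h ω → ∃ ζ ∈ ω.support, ζ ∈ W := by
    intro ω hω
    refine hmeet ω fun ζ hζ => ?_
    have h1 := height_le_iff.1 (hω.le.trans hΦ.le) ζ hζ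
    rw [ham] at h1
    linarith
  have hpath : ∀ η ∈ W, energy J h (plus η) = Γ ∧ ∃ ω : Path (allMinus L) (allPlus L),
      η ∈ ω.support ∧ IsOptimal J h ω ∧
      ∀ ζ ∈ ω.support, ζ = η ∨ energy J h (plus ζ) < Γ := by
    intro η hη
    obtain ⟨ω, h1, h2, h3⟩ := hB.exists_path (hW ▸ hη)
    rw [← hΓ] at h2 h3
    have h4 := le_antisymm h3 (hge η hη)
    refine ⟨h4, ω, h1, le_antisymm ?_ ((commHeight_isLeast J h _ _).2 ⟨ω, rfl⟩), h2⟩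
    rw [hΦ, height_le_iff]
    intro ζ hζ
    rw [ham]
    rcases h2 ζ hζ with rfl | h5 <;> linarith
  -- Gates contain saddles only, and η is the only configuration at saddle height on its path, so V
  -- must contain η.
  have hsub : ∀ V, IsGate J h (allMinus L) (allPlus L) V → W ⊆ V := by
    intro V hV η hη
    obtain ⟨h1, ω, h2, h3, h4⟩ := hpath η hη
    obtain ⟨ζ, h5, h6⟩ := hV.2 ω h3
    rcases h4 ζ h5 with rfl | h7
    · exact h6
    · obtain ⟨-, -, -, h8⟩ := hV.1 h6
      rw [hΦ, ham] at h8
      linarith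
  have hgate : IsGate J h (allMinus L) (allPlus L) W := by
    refine ⟨fun η hη => ?_, hopt⟩
    obtain ⟨h1, ω, h2, h3, h4⟩ := hpath η hη
    have h5 : hamiltonian J h η = commHeight J h (allMinus L) (allPlus L) := by
      rw [hΦ, ham, h1]
    exact ⟨ω, h2, h3.trans h5.symm, h5⟩
  have hmin : IsMinimalGate J h (allMinus L) (allPlus L) W := by
    refine ⟨hgate, fun V hV => ?_⟩
    by_contra! hcon
    exact hV.2 (hsub V ⟨hV.1.trans hgate.1, hcon⟩)
  rw [← hW]
  refine ⟨hopt, Set.Subset.antisymm (Set.sUnion_subset fun V hV => ?_)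
    (Set.subset_sUnion_of_mem hmin)⟩
  -- A minimal gate strictly larger than W would have W as a proper subset avoided by some optimal
  -- path.
  by_contra hne
  obtain ⟨ω, h1, h2⟩ := hV.2 W ⟨hsub V hV.1, hne⟩
  obtain ⟨ζ, h3, h4⟩ := hopt ω h1
  exact h2 ζ h3 h4

end Gate

/-! ### The critical constants -/

section Constants

variable {L : ℕ} {J h : ℝ}

/-- The expression is six times the difference of the two sides, after substitution of 6 N + 7 = p².
-/
theorem chainEnergy_lt_of_pos {N p s : ℕ} (hNp : 6 * N + 7 = p ^ 2)
    (hpos : 0 < ((p : ℝ) - s) * (6 * J - h * (p + s)) + h * (7 - defect (Fin.ofNat 6 s))) :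
    chainEnergy J h s + 2 * J - 2 * h < J * (p + 2) - h * (N + 2) := by
  have h1 : (6 : ℝ) * N + 7 = (p : ℝ) ^ 2 := by exact_mod_cast hNp
  have h2 : h * (p : ℝ) ^ 2 = h * (6 * N + 7) := by rw [h1]
  rw [chainEnergy]
  linarith

theorem defect_le (i : Fin 6) : (defect i : ℝ) ≤ 7 := by
  have : ∀ i, defect i ≤ 7 := by decide
  exact_mod_cast this i

theorem pos_of_mul_pos (hh : 0 < h) {x : ℝ} (hx : 0 < x) (i : Fin 6) :
    0 < x + h * (7 - defect i) := by
  have := mul_nonneg hh.le (sub_nonneg.2 (defect_le i))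
  linarith

theorem ofNat_six_mul_add (r : ℕ) (i : Fin 6) : Fin.ofNat 6 (6 * r + i) = i :=
  Fin.ext (by simp [Fin.ofNat])

theorem critical_of_delta_lt {r : ℕ} (hr : 1 ≤ r) (hL : 8 * (2 * r + 1) ^ 2 < L ^ 2) :
    Critical L (6 * r ^ 2 + 10 * r + 3) (6 * r + 5) (6 * r ^ 2 + 12 * r + 6) := by
  -- A linear consequence of L > 2 √2 (2 r + 1), from which the size conditions on the torus follow.
  have h1 : 11 * r + 6 ≤ 2 * L := by
    by_contra! h
    nlinarith
  refine ⟨by ring, by omega, by nlinarith, by omega, by omega, by omega, ?_, by omega⟩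
  zify at *
  nlinarith

theorem critical_of_lt_delta {t : ℕ} (hL : 8 * (2 * t + 2) ^ 2 < L ^ 2) :
    Critical L (6 * t ^ 2 + 14 * t + 7) (6 * t + 7) (6 * t ^ 2 + 16 * t + 10) := by
  have h1 : 11 * t + 12 ≤ 2 * L := by
    by_contra! h
    nlinarith
  refine ⟨by ring, by omega, by nlinarith, by omega, by omega, by omega, ?_, by omega⟩
  zify at *
  nlinarith

/-- The residues 2, 3, 4 below the peak use exactly (2 r + 1) h < J, and s = 6 r + 7 uses exactly J
< (2 r + 2) h. These are the thresholds δ = 0 and δ = 1/2. -/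
theorem barrier_of_delta_lt {r : ℕ} (hr : 1 ≤ r) (hL : 8 * (2 * r + 1) ^ 2 < L ^ 2) (hh : 0 < h)
    (h1 : (2 * r + 1) * h < J) (h2 : J < (2 * r + 2) * h) :
    Barrier L J h (6 * r ^ 2 + 10 * r + 3) (6 * r + 5) (r + 2) := by
  have h3 : 11 * r + 6 ≤ 2 * L := by
    by_contra! h
    nlinarith
  have hr' : (1 : ℝ) ≤ r := by exact_mod_cast hr
  have hrh : h ≤ r * h := by nlinarith
  have hNp : 6 * (6 * r ^ 2 + 10 * r + 3) + 7 = (6 * r + 5) ^ 2 := by ring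
  refine ⟨hh, by linarith, by omega, hNp, by omega, by omega, by push_cast; linarith, ?_,
    fun s h6 hsR hne => ?_⟩
  · push_cast
    nlinarith
  refine chainEnergy_lt_of_pos hNp ?_
  rcases (by omega : s ≤ 6 * r + 1 ∨ s = 6 * r + 2 ∨ s = 6 * r + 3 ∨ s = 6 * r + 4 ∨
    s = 6 * r + 6 ∨ 6 * r + 7 ≤ s) with e | rfl | rfl | rfl | rfl | e
  · have e' : (s : ℝ) ≤ 6 * r + 1 := by exact_mod_cast e
    refine pos_of_mul_pos hh (mul_pos (by push_cast; linarith) ?_) _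
    push_cast
    nlinarith
  · have := ofNat_six_mul_add r 2
    simp only [Fin.val_two] at this
    rw [this, show defect 2 = 4 from rfl]
    push_cast
    nlinarith
  · have : Fin.ofNat 6 (6 * r + 3) = 3 := ofNat_six_mul_add r 3
    rw [this, show defect 3 = 3 from rfl]
    push_cast
    nlinarith
  · have : Fin.ofNat 6 (6 * r + 4) = 4 := ofNat_six_mul_add r 4
    rw [this, show defect 4 = 4 from rfl]
    push_cast
    nlinarith
  · have : Fin.ofNat 6 (6 * r + 6) = 0 := ofNat_six_mul_add (r + 1) 0
    rw [this, show defect 0 = 0 from rfl]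
    push_cast
    nlinarith
  · have e' : (6 : ℝ) * r + 7 ≤ s := by exact_mod_cast e
    refine pos_of_mul_pos hh (mul_pos_of_neg_of_neg (by push_cast; linarith) ?_) _
    push_cast
    nlinarith

/-- Here s = 6 t + 5 uses exactly (2 t + 2) h < J, and the perimeters 6 t + 8, 6 t + 9, 6 t + 10
above the peak use exactly J < (2 t + 3) h. -/
theorem barrier_of_lt_delta {t : ℕ} (hL : 8 * (2 * t + 2) ^ 2 < L ^ 2) (hh : 0 < h)
    (h1 : (2 * t + 2) * h < J) (h2 : J < (2 * t + 3) * h) :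
    Barrier L J h (6 * t ^ 2 + 14 * t + 7) (6 * t + 7) (t + 2) := by
  have h3 : 11 * t + 12 ≤ 2 * L := by
    by_contra! h
    nlinarith
  have hth : 0 ≤ t * h := by positivity
  have hNp : 6 * (6 * t ^ 2 + 14 * t + 7) + 7 = (6 * t + 7) ^ 2 := by ring
  refine ⟨hh, by linarith, by omega, hNp, by omega, by omega, by push_cast; linarith, ?_,
    fun s h6 hsR hne => ?_⟩
  · push_cast
    nlinarith
  refine chainEnergy_lt_of_pos hNp ?_
  rcases (by omega : s ≤ 6 * t + 5 ∨ s = 6 * t + 6 ∨ s = 6 * t + 8 ∨ s = 6 * t + 9 ∨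
    s = 6 * t + 10 ∨ 6 * t + 11 ≤ s) with e | rfl | rfl | rfl | rfl | e
  · have e' : (s : ℝ) ≤ 6 * t + 5 := by exact_mod_cast e
    refine pos_of_mul_pos hh (mul_pos (by push_cast; linarith) ?_) _
    push_cast
    nlinarith
  · have : Fin.ofNat 6 (6 * t + 6) = 0 := ofNat_six_mul_add (t + 1) 0
    rw [this, show defect 0 = 0 from rfl]
    push_cast
    nlinarith
  · have : Fin.ofNat 6 (6 * t + 8) = 2 := ofNat_six_mul_add (t + 1) 2
    rw [this, show defect 2 = 4 from rfl]
    push_cast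
    nlinarith
  · have : Fin.ofNat 6 (6 * t + 9) = 3 := ofNat_six_mul_add (t + 1) 3
    rw [this, show defect 3 = 3 from rfl]
    push_cast
    nlinarith
  · have : Fin.ofNat 6 (6 * t + 10) = 4 := ofNat_six_mul_add (t + 1) 4
    rw [this, show defect 4 = 4 from rfl]
    push_cast
    nlinarith
  · have e' : (6 : ℝ) * t + 11 ≤ s := by exact_mod_cast e
    refine pos_of_mul_pos hh (mul_pos_of_neg_of_neg (by push_cast; linarith) ?_) _
    push_cast
    nlinarith

/-- The field in terms of the critical radius. -/
theorem eq_criticalRadius_add_delta (hh : 0 < h) (hJ : h ≤ J) :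
    J = (2 * criticalRadius J h + 1 + 2 * delta J h) * h := by
  have h1 : 0 ≤ J / (2 * h) - 1 / 2 := by
    rw [sub_nonneg, div_le_div_iff₀ (by norm_num) (by positivity)]
    linarith
  have h2 : (criticalRadius J h : ℝ) + delta J h = J / (2 * h) - 1 / 2 := by
    rw [criticalRadius, delta, natCast_floor_eq_intCast_floor h1]
    exact Int.floor_add_fract _
  have h3 : J / (2 * h) * (2 * h) = J := div_mul_cancel₀ _ (by positivity)
  linear_combination (-2 * h) * h2 - h3

theorem lt_sq_of_le_card [NeZero L] (hh : 0 < h) {m : ℕ} (hm : m * h < J)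
    (hL : (4 * J / h) ^ 2 ≤ (Fintype.card (Site (ZMod L)) : ℝ)) : 8 * m ^ 2 < L ^ 2 := by
  have h1 : (m : ℝ) < J / h := by rwa [lt_div_iff₀ hh]
  have h2 : (m : ℝ) ^ 2 < (J / h) ^ 2 := by
    have := Nat.cast_nonneg (α := ℝ) m
    nlinarith
  have h3 : (Fintype.card (Site (ZMod L)) : ℝ) = 2 * (L : ℝ) ^ 2 := by
    rw [Fintype.card_prod, Fintype.card_prod, ZMod.card, Fintype.card_bool]
    push_cast
    ring
  rw [h3, mul_div_assoc, mul_pow] at hL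
  have h4 : 8 * (m : ℝ) ^ 2 < (L : ℝ) ^ 2 := by linarith
  exact_mod_cast h4

end Constants

end HexIsing

theorem theorem6 (L : ℕ) [NeZero L] (J h : ℝ) (hh_pos : 0 < h) (hh_lt : h < 1) (hJ : 2 * h ≤ J)
    (hδ_zero : HexIsing.delta J h ≠ 0) (hδ_half : HexIsing.delta J h ≠ 1 / 2)
    (hL : (4 * J / h) ^ 2 ≤ (Fintype.card (HexIsing.Site (ZMod L)) : ℝ)) :
    (∀ ω : HexIsing.Path (HexIsing.allMinus L) (HexIsing.allPlus L), HexIsing.IsOptimal J h ω →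
      ∃ ζ ∈ ω.support,
        ζ ∈ HexIsing.canonicalConfigs L (HexIsing.criticalArea J h) ∪
          HexIsing.defectiveConfigs L (HexIsing.criticalArea J h)) ∧
    HexIsing.minimalGatesUnion J h (HexIsing.allMinus L) (HexIsing.allPlus L) =
      HexIsing.canonicalConfigs L (HexIsing.criticalArea J h) ∪
        HexIsing.defectiveConfigs L (HexIsing.criticalArea J h) := by
  have hJδ := HexIsing.eq_criticalRadius_add_delta hh_pos (by linarith : h ≤ J)
  have hδ0 : 0 < HexIsing.delta J h := lt_of_le_of_ne (Int.fract_nonneg _) hδ_zero.symm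
  have hδ1 : HexIsing.delta J h < 1 := Int.fract_lt_one _
  obtain ⟨r, hr⟩ : ∃ r, r = HexIsing.criticalRadius J h := ⟨_, rfl⟩
  rw [← hr] at hJδ
  have hδh := mul_pos hδ0 hh_pos
  by_cases hδ : HexIsing.delta J h < 1 / 2
  -- With r = 0 and δ < 1/2 one would have J < 2 h. For δ > 1/2 the value r = 0 is allowed, with a
  -- critical hexagon of perimeter 7.
  · have hr1 : 1 ≤ r := by
      by_contra hr0
      rw [show r = 0 by omega] at hJδ
      push_cast at hJδ
      nlinarith
    have h1 : (2 * r + 1) * h < J := by nlinarith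
    have h2 : J < (2 * r + 2) * h := by nlinarith
    have h3 := HexIsing.lt_sq_of_le_card hh_pos (m := 2 * r + 1) (by push_cast; exact h1) hL
    have hA : HexIsing.criticalArea J h = 6 * r ^ 2 + 10 * r + 3 + 2 := by
      rw [HexIsing.criticalArea, if_pos hδ, ← hr]
    rw [hA]
    exact HexIsing.minimalGatesUnion_eq (HexIsing.critical_of_delta_lt hr1 h3)
      (HexIsing.barrier_of_delta_lt hr1 h3 hh_pos h1 h2) (by push_cast; linarith)
  · have hδ' : 1 / 2 < HexIsing.delta J h := lt_of_le_of_ne (not_lt.1 hδ) hδ_half.symm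
    have h1 : (2 * r + 2) * h < J := by nlinarith
    have h2 : J < (2 * r + 3) * h := by nlinarith
    have h3 := HexIsing.lt_sq_of_le_card hh_pos (m := 2 * r + 2) (by push_cast; exact h1) hL
    have hA : HexIsing.criticalArea J h = 6 * r ^ 2 + 14 * r + 7 + 2 := by
      rw [HexIsing.criticalArea, if_neg hδ, ← hr]
      ring
    rw [hA]
    exact HexIsing.minimalGatesUnion_eq (HexIsing.critical_of_lt_delta h3)
      (HexIsing.barrier_of_lt_delta h3 hh_pos h1 h2) (by push_cast; linarith)
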